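/- Let $n\ge 1$ and let $\mathbb H^n=\mathbb C^n\times\mathbb R$ be the Heisenberg group with product $[z,t]*[z',t']=[z+z',t+t'+\mathrm{Im}\sum_i z_i\overline{z_i'}]$, with the left-invariant Riemannian metric $\langle\cdot,\cdot\rangle$ for which $X_k=\partial_{x_k}+y_k\partial_t$, $Y_k=\partial_{y_k}-x_k\partial_t$, $T=\partial_t$ are orthonormal, and with the horizontal distribution spanned by the $X_k,Y_k$. For a (possibly immersed) $C^2$ hypersurface $\Sigma$ with unit normal $N$, let $N_H$ be the horizontal projection of $N$; the singular points are those where $N_H=0$, equivalently where the tangent hyperplane is the horizontal one. At the other (regular) points put $\nu_H=N_H/|N_H|$ and define the mean curvature $H$ with respect to $N$ by $-2nH=\mathrm{div}_\Sigma\,\nu_H=\sum_i\langle D_{e_i}\nu_H,e_i\rangle$, where $D$ is the Levi-Civita connection and $(e_i)$ is an orthonormal basis of the tangent hyperplane. $\Sigma$ has constant mean curvature $H$ if this holds with the same $H$ at all regular points. For $H\in\mathbb R$ consider, for $x>0$, the system $$(*)_H\quad x'=\sin\sigma,\qquad t'=\cos\sigma,\qquad \sigma'=(2n-1)\frac{\cos^3\sigma}{x^3}+2(n-1)\frac{\sin^2\sigma\cos\sigma}{x}-2nH\,\frac{(x^2\sin^2\sigma+\cos^2\sigma)^{3/2}}{x^2}.$$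 Let $\gamma=(x,t,\sigma)$ be a complete solution, that is, a solution on a nonempty open interval $I$, with $x>0$, that cannot be extended to a solution on a larger open interval. Let $E$ be the value of $$\frac{x^{2n-1}\cos\sigma}{\sqrt{x^2\sin^2\sigma+\cos^2\sigma}}-Hx^{2n}$$ at some point of $\gamma$. Let $\Sigma$ be the generated hypersurface: the image of $\phi(s,\omega)=(x(s)\omega,t(s))$, $s\in I$, $\omega\in\mathbb S^{2n-1}\subset\mathbb C^n$, together with the points $(0,\tau)$ of the $t$-axis for which $(0,\tau)$ lies in the closure of the curve $(x,t)(I)$. "Embedded" below means that $s\mapsto(x(s),t(s))$ is injective on $I$ and that $\Sigma$ is an embedded $C^2$ hypersurface, i.e. near each of its points it is the zero set of a $C^2$ function with nowhere vanishing differential. Then the function above is constantly equal to $E$ along $\gamma$ (the energy of $\gamma$). The map $\phi$ is a $C^2$ immersion of $I\times\mathbb S^{2n-1}$ without singular points and of constant mean curvature $H$ with respect to the unit normal with horizontal part $-(t'+i\,xx')\,\omega/\sqrt{1+x^2(x')^2}$ and $T$-component $x'/\sqrt{1+x^2(x')^2}$. Near every point of $\Sigma$ on the $t$-axis, $\Sigma$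 is an embedded $C^2$ hypersurface, and this point is singular. Moreover: (i) If $H=0$ and $E=0$, the curve $(x,t)(I)$ is a half-line $\{x>0,\ t=t_0\}$ and $\Sigma$ is the hyperplane $\{t=t_0\}$. (ii) If $H=0$ and $E\ne0$, $\Sigma$ is embedded and of catenoidal type: the curve is the graph $x=f(t)$, over an open interval $J$, of a positive strictly convex function, symmetric about some $c\in J$ and tending to $+\infty$ at both ends of $J$. If $n\ge2$, then $\Sigma$ is contained in a slab $\{a<t<b\}$. (iii) If $H\ne0$ and $E=0$, $\Sigma$ is compact, embedded and homeomorphic to the sphere $\mathbb S^{2n}$; up to a translation along the $t$-axis it is the hypersurface $S_{|H|}$, where for $h>0$ $$S_h:\quad t=\pm\frac1{2h^2}\left\{h|z|\sqrt{1-h^2|z|^2}+\arccos(h|z|)\right\},\qquad |z|\le\frac1h.$$ (iv) If $EH>0$, the curve is a periodic graph $x=f(t)$ over the whole $t$-axis, $\Sigma$ is embedded, and $\Sigma$ is either the cylinder $|z|=\frac{2n-1}{2n|H|}$ or of unduloid type: for some period $P>0$ and some $c\in\mathbb R$, $f$ is positive, $P$-periodic, symmetric about $t=c$, strictly increasing on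 $[c,c+P/2]$, and, for some $0<\ell<P/2$, strictly convex on $[c,c+\ell]$ and strictly concave on $[c+\ell,c+P/2]$. (v) If $EH<0$, $\gamma$ is locally convex (its curvature $\sigma'$ has a constant sign and never vanishes) and of nodoid type: $I=\mathbb R$ and there are $L>0$, $d\ne0$, $c\in\mathbb R$ such that $x(s+L)=x(s)$, $t(s+L)=t(s)+d$ and $|\sigma(s+L)-\sigma(s)|=2\pi$ for all $s$; $\gamma$ is symmetric about the line $t=t(c)$, i.e. $x(2c-s)=x(s)$ and $t(2c-s)=2t(c)-t(s)$; $x$ is strictly decreasing on $[c,c+L/2]$; and $d\cos\sigma(c)>0$. Moreover $\Sigma$ has self-intersections: there are $s_1,s_2$ with $(x,t)(s_1)=(x,t)(s_2)$ and different tangent lines there, and $\Sigma$ is not an embedded $C^2$ hypersurface. -/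

import Mathlib

open Set Filter Topology
open scoped ComplexConjugate

/-! ### The Heisenberg group and its left-invariant metric -/

/-- Points `[z, t]` of the Heisenberg group, `z ∈ ℂⁿ`, `t ∈ ℝ`.  The same type is used for tangent
vectors in the coordinates `(z, t)`, and for the components of a tangent vector in the
left-invariant frame, `(ζ, c)` standing for `∑ₖ (Re ζₖ) Xₖ + (Im ζₖ) Yₖ + c T`. -/
abbrev Heis (n : ℕ) : Type := EuclideanSpace ℂ (Fin n) × ℝ

namespace Heis

variable {n : ℕ}

/-- `Im ∑ zᵢ conj(wᵢ)`. -/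
noncomputable def symp (z w : EuclideanSpace ℂ (Fin n)) : ℝ := (∑ i, z i * conj (w i)).im

/-- The group law `[z,t] * [z',t'] = [z + z', t + t' + Im ∑ zᵢ conj(z'ᵢ)]`. -/
noncomputable def mul (p q : Heis n) : Heis n := (p.1 + q.1, p.2 + q.2 + symp p.1 q.1)

/-- The left-invariant vector field with constant frame components `ξ`, where
`Xₖ = ∂/∂xₖ + yₖ ∂/∂t`, `Yₖ = ∂/∂yₖ - xₖ ∂/∂t`, `T = ∂/∂t`. -/
noncomputable def leftField (ξ p : Heis n) : Heis n := (ξ.1, ξ.2 + symp p.1 ξ.1)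

/-- Components in the frame `Xₖ, Yₖ, T` of the tangent vector `v` at `p`. -/
noncomputable def toFrame (p v : Heis n) : Heis n := (v.1, v.2 - symp p.1 v.1)

/-- A tangent vector `v` at `p` is horizontal if its `T`-component vanishes. -/
def IsHorizontal (p v : Heis n) : Prop := (toFrame p v).2 = 0

/-- The Riemannian metric making `Xₖ, Yₖ, T` orthonormal, on frame components. -/
noncomputable def metric (ξ η : Heis n) : ℝ := inner ℝ ξ.1 η.1 + ξ.2 * η.2

/-- The Christoffel term `D_U V` of the Levi-Civita connection for fields with constant frame
components: `D_{Xₖ}Yₖ = -T`, `D_{Yₖ}Xₖ = T`, `D_{Xₖ}T = D_T Xₖ = Yₖ`, `D_{Yₖ}T = D_T Yₖ = -Xₖ`,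
all the others being zero. -/
noncomputable def christoffel (u v : Heis n) : Heis n :=
  (Complex.I • (v.2 • u.1 + u.2 • v.1), symp u.1 v.1)

/-- Frame components of the Levi-Civita derivative `D_u V` of a vector field along a map, from the
frame components `u` of the direction, `v` of the value of `V`, and the directional derivative `dv`
of the frame components of `V`. -/
noncomputable def covDeriv (u v dv : Heis n) : Heis n := dv + christoffel u v

/-- `toFrame` inverts `leftField`. -/
theorem toFrame_leftField (ξ p : Heis n) : toFrame p (leftField ξ p) = ξ := by
  ext <;> simp [toFrame, leftField]

/-- The connection is compatible with the metric. -/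
theorem metric_christoffel (u v w : Heis n) :
    metric (christoffel u v) w + metric v (christoffel u w) = 0 := by
  simp only [metric, christoffel, symp, PiLp.inner_apply, Complex.inner, Complex.im_sum,
    PiLp.smul_apply, PiLp.add_apply, Finset.sum_mul, Finset.mul_sum, ← Finset.sum_add_distrib]
  refine Finset.sum_eq_zero fun i _ => ?_
  simp
  ring

/-- The connection is torsion free: `D_U V - D_V U = [U, V]` for left-invariant fields. -/
theorem christoffel_sub_christoffel (u v p : Heis n) :
    christoffel u v - christoffel v u
      = toFrame p (VectorField.lieBracket ℝ (leftField u) (leftField v) p) := by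
  let L : EuclideanSpace ℂ (Fin n) → EuclideanSpace ℂ (Fin n) →ₗ[ℝ] ℝ := fun w =>
    { toFun := fun z => symp z w
      map_add' := fun a b => by simp [symp, add_mul, Finset.sum_add_distrib]
      map_smul' := fun c a => by
        simp only [symp, PiLp.smul_apply, Complex.real_smul, mul_assoc, ← Finset.mul_sum]
        simp }
  have hd : ∀ w : Heis n, HasFDerivAt (leftField w)
      ((0 : Heis n →L[ℝ] EuclideanSpace ℂ (Fin n)).prod
        ((L w.1).toContinuousLinearMap.comp
          (ContinuousLinearMap.fst ℝ (EuclideanSpace ℂ (Fin n)) ℝ))) p := fun w =>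
    (hasFDerivAt_const _ _).prodMk
      ((((L w.1).toContinuousLinearMap.comp
          (ContinuousLinearMap.fst ℝ (EuclideanSpace ℂ (Fin n)) ℝ)).hasFDerivAt).const_add w.2)
  have hL : ∀ a b : EuclideanSpace ℂ (Fin n), L a b = symp b a := fun _ _ => rfl
  rw [VectorField.lieBracket, (hd u).fderiv, (hd v).fderiv]
  ext
  · simp [christoffel, toFrame, leftField, add_comm]
  · simp [christoffel, toFrame, leftField, hL, symp]

end Heis

/-! ### Mean curvature of immersed hypersurfaces -/

section Hypersurface

variable {n : ℕ} {F : Type*} [NormedAddCommGroup F] [NormedSpace ℝ F]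

/-- Frame components of `dφ_b(e)`. -/
noncomputable def pushFrame (φ : F → Heis n) (b e : F) : Heis n :=
  Heis.toFrame (φ b) (fderiv ℝ φ b e)

/-- The horizontal unit normal `ν_H = N_H / |N_H|` (in frame components). -/
noncomputable def horizontalNormal (N : F → Heis n) (b : F) : Heis n :=
  (‖(N b).1‖⁻¹ • (N b).1, 0)

/-- `-2nH = div_Σ ν_H` at `b`, the divergence `∑ᵢ ⟨D_{eᵢ} ν_H, eᵢ⟩` relative to the hypersurface
being computed in any orthonormal basis of the tangent hyperplane.  Here `W` is the tangent
space at `b` of the parameter manifold (a submanifold of `F`). -/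
def HasMeanCurvatureAt (φ N : F → Heis n) (W : Submodule ℝ F) (b : F) (H : ℝ) : Prop :=
  ∀ e : Fin (2 * n) → F, (∀ i, e i ∈ W) →
    (∀ i j, Heis.metric (pushFrame φ b (e i)) (pushFrame φ b (e j)) = if i = j then 1 else 0) →
    -(2 * n * H) = ∑ i, Heis.metric
      (Heis.covDeriv (pushFrame φ b (e i)) (horizontalNormal N b)
        (fderiv ℝ (horizontalNormal N) b (e i)))
      (pushFrame φ b (e i))

/-- `φ`, restricted to the `2n`-dimensional submanifold `B` of `F` with tangent spaces `T b`, is a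
`C²` immersion with unit normal `N` (in frame components, `C¹`), whose mean curvature with respect
to `N` equals `H` at every regular point, that is, wherever `N_H ≠ 0`. -/
structure IsCMCImmersion (φ N : F → Heis n) (B : Set F) (T : F → Submodule ℝ F) (H : ℝ) :
    Prop where
  contDiffAt : ∀ b ∈ B, ContDiffAt ℝ 2 φ b
  finrank_eq : ∀ b ∈ B, Module.finrank ℝ (T b) = 2 * n
  immersion : ∀ b ∈ B, ∀ e ∈ T b, fderiv ℝ φ b e = 0 → e = 0
  normal_contDiffAt : ∀ b ∈ B, ContDiffAt ℝ 1 N b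
  normal_unit : ∀ b ∈ B, Heis.metric (N b) (N b) = 1
  normal_orthogonal : ∀ b ∈ B, ∀ e ∈ T b, Heis.metric (N b) (pushFrame φ b e) = 0
  meanCurvature : ∀ b ∈ B, (N b).1 ≠ 0 → HasMeanCurvatureAt φ N (T b) b H

/-- `u` is a `C²` local defining function of `S` on the open set `U`. -/
structure IsDefiningFunction (S U : Set (Heis n)) (u : Heis n → ℝ) : Prop where
  isOpen : IsOpen U
  contDiffOn : ContDiffOn ℝ 2 u U
  fderiv_ne_zero : ∀ p ∈ U, fderiv ℝ u p ≠ 0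
  inter_eq : S ∩ U = {p ∈ U | u p = 0}

/-- `S` is an embedded `C²` hypersurface. -/
def IsEmbeddedHypersurface (S : Set (Heis n)) : Prop :=
  ∀ p ∈ S, ∃ U u, p ∈ U ∧ IsDefiningFunction S U u

/-- `S` is a `C²` embedded hypersurface near its point `p`, and its tangent hyperplane at `p` is
the horizontal one. -/
def IsSingularPoint (S : Set (Heis n)) (p : Heis n) : Prop :=
  p ∈ S ∧ ∃ U u, p ∈ U ∧ IsDefiningFunction S U u ∧
    ∀ v, Heis.IsHorizontal p v → fderiv ℝ u p v = 0

end Hypersurface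

/-! ### The system of ordinary differential equations -/

/-- `(x, t, σ)` solves the system `(*)_H` on the nonempty open interval `I`, with `x > 0`. -/
structure IsSolution (n : ℕ) (H : ℝ) (I : Set ℝ) (x t σ : ℝ → ℝ) : Prop where
  isOpen : IsOpen I
  ordConnected : I.OrdConnected
  nonempty : I.Nonempty
  pos : ∀ s ∈ I, 0 < x s
  deriv_x : ∀ s ∈ I, HasDerivAt x (Real.sin (σ s)) s
  deriv_t : ∀ s ∈ I, HasDerivAt t (Real.cos (σ s)) s
  deriv_σ : ∀ s ∈ I, HasDerivAt σ
    ((2 * n - 1) * (Real.cos (σ s) ^ 3 / x s ^ 3)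
      + 2 * (n - 1) * (Real.sin (σ s) ^ 2 * Real.cos (σ s) / x s)
      - 2 * n * H *
        (√(x s ^ 2 * Real.sin (σ s) ^ 2 + Real.cos (σ s) ^ 2) ^ 3 / x s ^ 2)) s

/-- A complete solution: one that cannot be extended to a larger interval. -/
structure IsCompleteSolution (n : ℕ) (H : ℝ) (I : Set ℝ) (x t σ : ℝ → ℝ) : Prop
    extends IsSolution n H I x t σ where
  maximal : ∀ (I' : Set ℝ) (x' t' σ' : ℝ → ℝ), IsSolution n H I' x' t' σ' → I ⊆ I' →
    EqOn x' x I → EqOn t' t I → EqOn σ' σ I → I' = I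

/-- The first integral `x^{2n-1} cos σ / √(x² sin² σ + cos² σ) - H x^{2n}`. -/
noncomputable def energy (n : ℕ) (H x σ : ℝ) : ℝ :=
  x ^ (2 * n - 1) * Real.cos σ / √(x ^ 2 * Real.sin σ ^ 2 + Real.cos σ ^ 2) - H * x ^ (2 * n)

/-! ### The generated hypersurface -/

/-- The trace in the `(x, t)`-half-plane of the generating curve `γ`. -/
def generatingCurve (I : Set ℝ) (x t : ℝ → ℝ) : Set (ℝ × ℝ) := (fun s => (x s, t s)) '' I

/-- `φ(s, ω) = (x(s) ω, t(s))`, considered for all `ω ∈ ℂⁿ`. -/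
noncomputable def revolution (n : ℕ) (x t : ℝ → ℝ) (b : ℝ × EuclideanSpace ℂ (Fin n)) : Heis n :=
  (x b.1 • b.2, t b.1)

/-- The manifold `I × S^{2n-1}`. -/
def revolutionDomain (n : ℕ) (I : Set ℝ) : Set (ℝ × EuclideanSpace ℂ (Fin n)) :=
  I ×ˢ Metric.sphere 0 1

/-- The tangent space `ℝ × ω^⊥` of `I × S^{2n-1}` at `(s, ω)`. -/
noncomputable def revolutionTangent (n : ℕ) (b : ℝ × EuclideanSpace ℂ (Fin n)) :
    Submodule ℝ (ℝ × EuclideanSpace ℂ (Fin n)) :=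
  (⊤ : Submodule ℝ ℝ).prod (Submodule.span ℝ {b.2})ᗮ

/-- The unit normal along `φ`, in frame components: the horizontal part is
`-(t' + i x x') ω` and the `T`-component is `x'`, divided by `√(|γ'|² + x² x'²)`, where
`x' = sin σ`, `t' = cos σ`, `|γ'| = 1`. -/
noncomputable def revolutionNormal (n : ℕ) (x σ : ℝ → ℝ) (b : ℝ × EuclideanSpace ℂ (Fin n)) :
    Heis n :=
  (√(1 + x b.1 ^ 2 * Real.sin (σ b.1) ^ 2))⁻¹ •
    ((-(Real.cos (σ b.1) + Complex.I * (x b.1 * Real.sin (σ b.1))) : ℂ) • b.2,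
      Real.sin (σ b.1))

/-- The hypersurface generated by rotating `γ` about the `t`-axis, together with the points at
which `γ` reaches the `t`-axis. -/
def generatedHypersurface (n : ℕ) (I : Set ℝ) (x t : ℝ → ℝ) : Set (Heis n) :=
  revolution n x t '' revolutionDomain n I ∪
    {p | p.1 = 0 ∧ ((0 : ℝ), p.2) ∈ closure (generatingCurve I x t)}

/-- The sphere `t = ± (1 / 2H²) (H|z| √(1 - H²|z|²) + arccos (H|z|))`, `|z| ≤ 1/H`, for `H > 0`. -/
def sphereS (n : ℕ) (H : ℝ) : Set (Heis n) :=
  {p | ‖p.1‖ ≤ 1 / H ∧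
    |p.2| = 1 / (2 * H ^ 2) *
      (H * ‖p.1‖ * √(1 - H ^ 2 * ‖p.1‖ ^ 2) + Real.arccos (H * ‖p.1‖))}

/-- The part over `J` of the graph `x = f(t)`. -/
def graphOver (J : Set ℝ) (f : ℝ → ℝ) : Set (ℝ × ℝ) := (fun τ => (f τ, τ)) '' J

/-! ### The types of generating curves -/

/-- Catenoidal type: the graph `x = f(t)` over an open `t`-interval `J` of a positive, strictly
convex function, symmetric about a line `t = c` and tending to infinity at both ends of `J`. -/
def IsCatenoidCurve (C : Set (ℝ × ℝ)) : Prop :=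
  ∃ (J : Set ℝ) (c : ℝ) (f : ℝ → ℝ), IsOpen J ∧ c ∈ J ∧
    (∀ τ ∈ J, 0 < f τ) ∧ StrictConvexOn ℝ J f ∧
    (∀ τ ∈ J, 2 * c - τ ∈ J ∧ f (2 * c - τ) = f τ) ∧
    (∀ R : ℝ, ∃ K ⊆ J, IsCompact K ∧ ∀ τ ∈ J \ K, R < f τ) ∧
    C = graphOver J f

/-- Unduloid type: the graph over the whole `t`-axis of a positive function of period `P`,
symmetric about the line `t = c` of a minimum, strictly increasing up to the next maximum at
`c + P/2`, and on this half period first strictly convex and then strictly concave. -/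
def IsUnduloidCurve (C : Set (ℝ × ℝ)) : Prop :=
  ∃ (f : ℝ → ℝ) (P c l : ℝ), 0 < l ∧ l < P / 2 ∧
    (∀ τ, 0 < f τ) ∧ Function.Periodic f P ∧ (∀ τ, f (2 * c - τ) = f τ) ∧
    StrictMonoOn f (Icc c (c + P / 2)) ∧
    StrictConvexOn ℝ (Icc c (c + l)) f ∧ StrictConcaveOn ℝ (Icc (c + l) (c + P / 2)) f ∧
    C = graphOver univ f

/-- Local convexity: the signed curvature of `γ` never vanishes and has a constant sign.  Since `γ`
is parametrized by arc length with tangent angle `σ`, this curvature is `σ'`. -/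
def IsLocallyConvexCurve (I : Set ℝ) (σ : ℝ → ℝ) : Prop :=
  (∀ s ∈ I, 0 < deriv σ s) ∨ (∀ s ∈ I, deriv σ s < 0)

/-- `γ` crosses itself transversally (the tangent lines at the two parameters are different). -/
def HasSelfIntersection (I : Set ℝ) (x t σ : ℝ → ℝ) : Prop :=
  ∃ s₁ ∈ I, ∃ s₂ ∈ I, x s₁ = x s₂ ∧ t s₁ = t s₂ ∧ Real.sin (σ s₁ - σ s₂) ≠ 0

/-- Nodoid type: `γ` is defined on `ℝ`, locally convex, and invariant under the translation by `d`
along the `t`-axis after a parameter period `L`, along which the tangent makes exactly one full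
turn; it is symmetric about the line `t = t(c)`, where `x` is maximal, and `x` strictly decreases
on the following half period.  At the maxima of `x` the curve runs in the direction of the
translation. -/
def IsNodoidCurve (I : Set ℝ) (x t σ : ℝ → ℝ) : Prop :=
  I = univ ∧ IsLocallyConvexCurve I σ ∧
  ∃ L d c : ℝ, 0 < L ∧ d ≠ 0 ∧
    (∀ s, x (s + L) = x s ∧ t (s + L) = t s + d ∧ |σ (s + L) - σ s| = 2 * Real.pi) ∧
    (∀ s, x (2 * c - s) = x s ∧ t (2 * c - s) = 2 * t c - t s) ∧
    StrictAntiOn x (Icc c (c + L / 2)) ∧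
    0 < d * Real.cos (σ c)

/-!
The system is integrated with the help of the tilt of the generating curve. Put
`Q = √(x² sin² σ + cos² σ)`, `U = cos σ / Q` and `V = x sin σ / Q`; then `U² + V² = 1`, the
horizontal normal along `φ` is `-(U + iV) ω`, and the energy is `x^(2n-1) U - H x^(2n)`. Hence the
energy makes `U` a function of `x` alone, `U = E / x^(2n-1) + H x`, with derivative
`W = (2nHx - (2n-1)U) / x`, and the system becomes `x' = QV/x`, `t' = QU`, `V' = -(cos σ / x) W`,
while the curvature `σ'` has the sign of `G = U³ + 2(n-1)U - 2nHx = U³ - U - xW`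
(`hasDerivAt_tiltCos`, `hasDerivAt_tiltSin`, `deriv_σ'`, `energy_eq`).

The mean curvature is computed from the quadratic form `E ↦ ⟨D_E ν_H, E⟩`
(`metric_covDeriv_horizontalNormal`), which extends to the whole tangent space of the Heisenberg
group. By Parseval's identity its trace over any orthonormal basis of the tangent hyperplane is the
full trace minus the value at the normal.

Three facts about the system drive the classification. At a finite end of its parameter
interval a complete solution runs into the axis (`tendsto_zero_of_isLUB`); since `|U| ≤ 1`, this
does not happen when `E ≠ 0`, and the solution is then defined on `ℝ`. A solution on `ℝ` is
symmetric about every parameter where `sin σ = 0` (`symmetric`), by uniqueness, and so periodic up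
to a translation along the axis as soon as there are two of them (`periodic`). Finally the sign of
`H` can be reversed by running backwards or by reflecting.

* If `E = 0` and `H = 0`, then `cos σ = 0`. If `E = 0` and `H ≠ 0`, then `U = H x`, and
  `t ± Ψ(V) / H²` is constant for `Ψ(a) = (arcsin a + a √(1 - a²)) / 2`, while `V` runs through
  `(-1, 1)`: the curve is a half meridian of the sphere `S_{|H|}`
  (`generatingCurve_eq_sphereMeridian`). Near its poles the sphere is a graph `t = g(z)` with
  gradient a `C¹` multiple of `|z| z`, hence of class `C²` and horizontal there.
* Where `cos σ ≠ 0` the curve is a graph `x = f(t)` with `f' = tan σ`, and `|z|² - f(t)²` is a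
  defining function off the axis.
* If `H = 0` and `E > 0`, then `x'' = cos σ · σ'` is bounded below by a positive constant wherever
  `x` is bounded, so `x` has a minimum, and `f` is strictly convex. For `n ≥ 2` one has
  `t' ≤ C / x²`, which bounds `t`.
* If `H > 0` and `E > 0`, then `U > 0` and `W` increases with `x`. If `x` were eventually monotone,
  then either `V` would stay away from `0`, making `x` unbounded, or `V` itself would be unbounded
  (`exists_sin_eq_zero`). So there are consecutive critical points of `x`, unless the curve is the
  line of a cylinder, and between them `G` changes sign once (`exists_inflection`).
* If `H > 0` and `E < 0`, then `G ≤ -Hx`, so the tangent turns clockwise without end. On a half turn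
  from a maximum to a minimum of `x`, a suitable combination `t + K V` is increasing and `V` vanishes
  at the ends, so the curve advances (`t_lt_t_of_half_turn`); as it recedes on the second quarter
  turn, it meets its mirror image transversally. At such a crossing the tangent hyperplanes of the
  two sheets span the whole tangent space, on which the differential of a defining function would
  have to vanish (`not_isEmbeddedHypersurface`).
-/

/-! ### The tilt of a generating curve -/

/-- The length `Q = √(x² sin² σ + cos² σ)` of the vector `(cos σ, x sin σ)`. -/
noncomputable def tiltNorm (x σ : ℝ) : ℝ := √(x ^ 2 * Real.sin σ ^ 2 + Real.cos σ ^ 2)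

/-- `U = cos σ / Q`, the cosine of the tilt angle `θ`, where `tan θ = x tan σ`. -/
noncomputable def tiltCos (x σ : ℝ) : ℝ := Real.cos σ / tiltNorm x σ

/-- `V = x sin σ / Q`, the sine of the tilt angle. -/
noncomputable def tiltSin (x σ : ℝ) : ℝ := x * Real.sin σ / tiltNorm x σ

/-- The derivative of `x ↦ U` along solutions, `W = (2nHx - (2n-1)U) / x`; the tilt angle satisfies
`θ' = -(Q / x) W`. -/
noncomputable def tiltSlope (n : ℕ) (H x U : ℝ) : ℝ := (2 * n * H * x - (2 * n - 1) * U) / x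

/-- The factor `G = U³ + 2(n-1)U - 2nHx`, which has the sign of the curvature `σ'`. -/
noncomputable def curvatureFactor (n : ℕ) (H x U : ℝ) : ℝ :=
  U ^ 3 + 2 * (n - 1) * U - 2 * n * H * x

theorem tiltNorm_arg_pos {x : ℝ} (hx : 0 < x) (σ : ℝ) :
    0 < x ^ 2 * Real.sin σ ^ 2 + Real.cos σ ^ 2 := by
  rcases eq_or_ne (Real.cos σ) 0 with h | h
  · have : Real.sin σ ^ 2 = 1 := by have := Real.sin_sq_add_cos_sq σ; rw [h] at this; linarith
    rw [this]; positivity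
  · positivity

theorem tiltNorm_pos {x : ℝ} (hx : 0 < x) (σ : ℝ) : 0 < tiltNorm x σ :=
  Real.sqrt_pos.2 (tiltNorm_arg_pos hx σ)

theorem tiltNorm_sq (x σ : ℝ) :
    tiltNorm x σ ^ 2 = x ^ 2 * Real.sin σ ^ 2 + Real.cos σ ^ 2 :=
  Real.sq_sqrt (by positivity)

theorem tiltNorm_le {x M : ℝ} (hx : 0 < x) (hM : 1 ≤ M) (hxM : x ≤ M) (σ : ℝ) :
    tiltNorm x σ ≤ M := by
  refine Real.sqrt_le_iff.2 ⟨by linarith, ?_⟩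
  have h1 : x ^ 2 ≤ M ^ 2 := by gcongr
  have h2 : 1 ≤ M ^ 2 := one_le_pow₀ hM
  nlinarith [Real.sin_sq_add_cos_sq σ, sq_nonneg (Real.sin σ), sq_nonneg (Real.cos σ)]

theorem le_tiltNorm {x m : ℝ} (hm : 0 < m) (hm1 : m ≤ 1) (hmx : m ≤ x) (σ : ℝ) :
    m ≤ tiltNorm x σ := by
  refine Real.le_sqrt_of_sq_le ?_
  have h1 : m ^ 2 ≤ x ^ 2 := by gcongr
  have h2 : m ^ 2 ≤ 1 := pow_le_one₀ hm.le hm1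
  nlinarith [Real.sin_sq_add_cos_sq σ, sq_nonneg (Real.sin σ), sq_nonneg (Real.cos σ)]

theorem tiltCos_sq_add_tiltSin_sq {x : ℝ} (hx : 0 < x) (σ : ℝ) :
    tiltCos x σ ^ 2 + tiltSin x σ ^ 2 = 1 := by
  have h := tiltNorm_pos hx σ
  have h2 := tiltNorm_sq x σ
  rw [tiltCos, tiltSin, div_pow, div_pow, ← add_div, div_eq_one_iff_eq (by positivity), h2]
  ring

theorem cos_eq_tiltCos_mul {x : ℝ} (hx : 0 < x) (σ : ℝ) :
    Real.cos σ = tiltCos x σ * tiltNorm x σ := by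
  rw [tiltCos, div_mul_cancel₀ _ (tiltNorm_pos hx σ).ne']

theorem sin_eq_tiltSin_mul {x : ℝ} (hx : 0 < x) (σ : ℝ) :
    Real.sin σ = tiltSin x σ * tiltNorm x σ / x := by
  rw [tiltSin, div_mul_cancel₀ _ (tiltNorm_pos hx σ).ne', mul_div_cancel_left₀ _ hx.ne']

theorem tiltCos_le_one {x : ℝ} (hx : 0 < x) (σ : ℝ) : tiltCos x σ ≤ 1 := by
  nlinarith [tiltCos_sq_add_tiltSin_sq hx σ, sq_nonneg (tiltSin x σ)]

theorem neg_one_le_tiltCos {x : ℝ} (hx : 0 < x) (σ : ℝ) : -1 ≤ tiltCos x σ := by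
  nlinarith [tiltCos_sq_add_tiltSin_sq hx σ, sq_nonneg (tiltSin x σ)]

theorem abs_tiltSin_le_one {x : ℝ} (hx : 0 < x) (σ : ℝ) : |tiltSin x σ| ≤ 1 := by
  rw [abs_le]
  constructor <;> nlinarith [tiltCos_sq_add_tiltSin_sq hx σ, sq_nonneg (tiltCos x σ)]

theorem tiltSin_pos_iff {x : ℝ} (hx : 0 < x) (σ : ℝ) : 0 < tiltSin x σ ↔ 0 < Real.sin σ := by
  rw [tiltSin, div_pos_iff_of_pos_right (tiltNorm_pos hx σ), mul_pos_iff_of_pos_left hx]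

theorem tiltCos_pos_iff {x : ℝ} (hx : 0 < x) (σ : ℝ) : 0 < tiltCos x σ ↔ 0 < Real.cos σ := by
  rw [tiltCos, div_pos_iff_of_pos_right (tiltNorm_pos hx σ)]

theorem tiltSin_eq_zero_iff {x : ℝ} (hx : 0 < x) (σ : ℝ) : tiltSin x σ = 0 ↔ Real.sin σ = 0 := by
  simp [tiltSin, (tiltNorm_pos hx σ).ne', hx.ne']

/-- The energy in terms of the tilt. -/
theorem energy_eq_tiltCos (n : ℕ) (H x σ : ℝ) :
    energy n H x σ = x ^ (2 * n - 1) * tiltCos x σ - H * x ^ (2 * n) := by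
  rw [energy, tiltCos, tiltNorm, mul_div_assoc]

/-- The energy determines the tilt cosine as a function of `x`. -/
theorem tiltCos_eq_of_energy {n : ℕ} (hn : 1 ≤ n) {H E x σ : ℝ} (hx : 0 < x)
    (h : energy n H x σ = E) : tiltCos x σ = E / x ^ (2 * n - 1) + H * x := by
  obtain ⟨k, hk⟩ : ∃ k, 2 * n = k + 1 := ⟨2 * n - 1, by omega⟩
  rw [energy_eq_tiltCos, hk, Nat.add_sub_cancel] at h
  rw [hk, Nat.add_sub_cancel]
  field_simp
  rw [← h]; ring

namespace IsSolution

variable {n : ℕ} {H : ℝ} {I : Set ℝ} {x t σ : ℝ → ℝ} {s : ℝ}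

/-- The right-hand side of the third equation in terms of the tilt. -/
theorem deriv_σ' (h : IsSolution n H I x t σ) (hs : s ∈ I) :
    HasDerivAt σ ((tiltNorm (x s) (σ s) / x s) ^ 3 *
      curvatureFactor n H (x s) (tiltCos (x s) (σ s))) s := by
  have hx := h.pos s hs
  convert h.deriv_σ s hs using 1
  have hQ := tiltNorm_pos hx (σ s)
  have h2 := tiltNorm_sq (x s) (σ s)
  rw [← tiltNorm, curvatureFactor, tiltCos]
  field_simp
  linear_combination (2 * (n - 1) * Real.cos (σ s)) * h2

theorem hasDerivAt_tiltNorm (h : IsSolution n H I x t σ) (hs : s ∈ I) {σ' : ℝ}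
    (hσ : HasDerivAt σ σ' s) :
    HasDerivAt (fun s => tiltNorm (x s) (σ s))
      ((x s * Real.sin (σ s) ^ 3 + (x s ^ 2 - 1) * Real.sin (σ s) * Real.cos (σ s) * σ')
        / tiltNorm (x s) (σ s)) s := by
  have hx := h.pos s hs
  have hd : HasDerivAt (fun s => x s ^ 2 * Real.sin (σ s) ^ 2 + Real.cos (σ s) ^ 2) _ s :=
    (((h.deriv_x s hs).pow 2).mul (hσ.sin.pow 2)).add (hσ.cos.pow 2)
  have := hd.sqrt (tiltNorm_arg_pos hx (σ s)).ne'
  refine this.congr_deriv ?_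
  have hQ := tiltNorm_pos hx (σ s)
  rw [← tiltNorm]
  simp only [Pi.pow_apply]
  field_simp
  push_cast
  ring

/-- `U' = -V θ'` with `θ' = -(Q / x) W`. -/
theorem hasDerivAt_tiltCos (h : IsSolution n H I x t σ) (hs : s ∈ I) :
    HasDerivAt (fun s => tiltCos (x s) (σ s))
      (Real.sin (σ s) * tiltSlope n H (x s) (tiltCos (x s) (σ s))) s := by
  have hx := h.pos s hs
  have hQ := tiltNorm_pos hx (σ s)
  have h2 := tiltNorm_sq (x s) (σ s)
  have hσ := h.deriv_σ' hs
  have hd := hσ.cos.div (h.hasDerivAt_tiltNorm hs hσ) hQ.ne'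
  refine hd.congr_deriv ?_
  have h1 := Real.sin_sq_add_cos_sq (σ s)
  simp only [tiltSlope, curvatureFactor, tiltCos]
  generalize tiltNorm (x s) (σ s) = Q at *
  generalize Real.cos (σ s) = c at *
  generalize Real.sin (σ s) = a at *
  generalize x s = X at *
  field_simp
  linear_combination (a * (X ^ 2 * c - (c * (c ^ 2 + Q ^ 2 * 2 * (n - 1)) - Q ^ 3 * X * 2 * n * H))) * h2
    - a * X ^ 2 * (c * (c ^ 2 + Q ^ 2 * 2 * (n - 1)) - Q ^ 3 * X * 2 * n * H) * h1

/-- `V' = U θ'` with `θ' = -(Q / x) W`. -/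
theorem hasDerivAt_tiltSin (h : IsSolution n H I x t σ) (hs : s ∈ I) :
    HasDerivAt (fun s => tiltSin (x s) (σ s))
      (-(Real.cos (σ s) / x s * tiltSlope n H (x s) (tiltCos (x s) (σ s)))) s := by
  have hx := h.pos s hs
  have hQ := tiltNorm_pos hx (σ s)
  have h2 := tiltNorm_sq (x s) (σ s)
  have hσ := h.deriv_σ' hs
  have hd := ((h.deriv_x s hs).mul hσ.sin).div (h.hasDerivAt_tiltNorm hs hσ) hQ.ne'
  refine hd.congr_deriv ?_
  have h1 := Real.sin_sq_add_cos_sq (σ s)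
  simp only [tiltSlope, curvatureFactor, tiltCos, Pi.mul_apply]
  generalize tiltNorm (x s) (σ s) = Q at *
  generalize Real.cos (σ s) = c at *
  generalize Real.sin (σ s) = a at *
  generalize x s = X at *
  field_simp
  linear_combination (c * (c * (c ^ 2 + Q ^ 2 * 2 * (n - 1)) - Q ^ 3 * X * 2 * n * H) + a ^ 2 * X ^ 2 - c ^ 2) * h2
    + c * (c * (c ^ 2 + Q ^ 2 * 2 * (n - 1)) - Q ^ 3 * X * 2 * n * H) * h1

theorem convex (h : IsSolution n H I x t σ) : Convex ℝ I := h.ordConnected.convex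

theorem hasDerivAt_energy (hn : 1 ≤ n) (h : IsSolution n H I x t σ) (hs : s ∈ I) :
    HasDerivAt (fun s => energy n H (x s) (σ s)) 0 s := by
  obtain ⟨k, hk⟩ : ∃ k, 2 * n = k + 2 := ⟨2 * n - 2, by omega⟩
  have hkR : (2 * n : ℝ) = k + 2 := by exact_mod_cast hk
  have hx := h.pos s hs
  have hd := (((h.deriv_x s hs).pow (k + 1)).mul (h.hasDerivAt_tiltCos hs)).sub
    (((h.deriv_x s hs).pow (k + 2)).const_mul H)
  have e : (fun s => energy n H (x s) (σ s)) =
      (x ^ (k + 1) * fun s => tiltCos (x s) (σ s)) - fun s => H * (x ^ (k + 2)) s := by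
    ext s
    simp [energy_eq_tiltCos, hk]
  rw [e]
  refine hd.congr_deriv ?_
  simp only [tiltSlope, hkR, Pi.pow_apply]
  push_cast
  field_simp
  ring

/-- The energy is a first integral. -/
theorem energy_eq (hn : 1 ≤ n) (h : IsSolution n H I x t σ) {s₀ : ℝ} (hs₀ : s₀ ∈ I) (hs : s ∈ I) :
    energy n H (x s) (σ s) = energy n H (x s₀) (σ s₀) :=
  h.isOpen.is_const_of_deriv_eq_zero h.convex.isPreconnected
    (fun _ hr => (h.hasDerivAt_energy hn hr).differentiableAt.differentiableWithinAt)
    (fun _ hr => (h.hasDerivAt_energy hn hr).deriv) hs hs₀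

/-! ### Symmetries, uniqueness and extension of solutions -/

/-- Running backwards along a solution gives a solution for the opposite curvature. -/
theorem reverse (h : IsSolution n H I x t σ) :
    IsSolution n (-H) (Neg.neg ⁻¹' I) (fun s => x (-s)) (fun s => t (-s))
      (fun s => σ (-s) + Real.pi) where
  isOpen := h.isOpen.preimage continuous_neg
  ordConnected := by
    refine ⟨fun a ha b hb c hc => ?_⟩
    exact h.ordConnected.out hb ha ⟨neg_le_neg hc.2, neg_le_neg hc.1⟩
  nonempty := by
    obtain ⟨s, hs⟩ := h.nonempty
    exact ⟨-s, by simpa using hs⟩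
  pos s hs := h.pos _ hs
  deriv_x s hs := by
    refine ((h.deriv_x _ hs).comp s (hasDerivAt_neg s)).congr_deriv ?_
    simp
  deriv_t s hs := by
    refine ((h.deriv_t _ hs).comp s (hasDerivAt_neg s)).congr_deriv ?_
    simp
  deriv_σ s hs := by
    refine (((h.deriv_σ _ hs).comp s (hasDerivAt_neg s)).add_const Real.pi).congr_deriv ?_
    simp only [Real.cos_add_pi, Real.sin_add_pi, neg_sq, Odd.neg_pow (by decide : Odd 3)]
    ring

/-- Reflecting a solution in the `x`-axis gives a solution for the opposite curvature. -/
theorem reflect (h : IsSolution n H I x t σ) :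
    IsSolution n (-H) I x (fun s => -t s) (fun s => Real.pi - σ s) where
  isOpen := h.isOpen
  ordConnected := h.ordConnected
  nonempty := h.nonempty
  pos s hs := h.pos _ hs
  deriv_x s hs := by simpa using h.deriv_x s hs
  deriv_t s hs := by simpa using (h.deriv_t s hs).fun_neg
  deriv_σ s hs := by
    refine ((h.deriv_σ _ hs).const_sub Real.pi).congr_deriv ?_
    simp only [Real.cos_pi_sub, Real.sin_pi_sub, neg_sq, Odd.neg_pow (by decide : Odd 3)]
    ring

/-- The reflection of a solution on `ℝ` about a parameter `c` at which the tangent is parallel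
to the axis is again a solution. -/
theorem reflectAbout (h : IsSolution n H univ x t σ) {c : ℝ} (hc : Real.sin (σ c) = 0) :
    IsSolution n H univ (fun s => x (2 * c - s)) (fun s => 2 * t c - t (2 * c - s))
      (fun s => 2 * σ c - σ (2 * c - s)) := by
  have hs2 : Real.sin (2 * σ c) = 0 := by rw [Real.sin_two_mul, hc]; ring
  have hc2 : Real.cos (2 * σ c) = 1 := by
    rw [Real.cos_two_mul']; nlinarith [Real.sin_sq_add_cos_sq (σ c)]
  have hd : ∀ s, HasDerivAt (fun s => 2 * c - s) (-1) s := fun s => by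
    simpa using (hasDerivAt_id s).const_sub (2 * c)
  refine ⟨isOpen_univ, ordConnected_univ, univ_nonempty, fun s _ => h.pos _ trivial, fun s _ => ?_,
    fun s _ => ?_, fun s _ => ?_⟩
  · refine ((h.deriv_x _ trivial).comp s (hd s)).congr_deriv ?_
    simp [Real.sin_sub, hs2, hc2]
  · refine (((h.deriv_t _ trivial).comp s (hd s)).const_sub _).congr_deriv ?_
    simp [Real.cos_sub, hs2, hc2]
  · refine (((h.deriv_σ _ trivial).comp s (hd s)).const_sub _).congr_deriv ?_
    simp [Real.sin_sub, Real.cos_sub, hs2, hc2]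

end IsSolution

/-- The vector field on `{x > 0}` whose integral curves are the solutions of the system. -/
noncomputable def flowField (n : ℕ) (H : ℝ) (p : ℝ × ℝ × ℝ) : ℝ × ℝ × ℝ :=
  (Real.sin p.2.2, Real.cos p.2.2,
    (2 * n - 1) * (Real.cos p.2.2 ^ 3 / p.1 ^ 3)
      + 2 * (n - 1) * (Real.sin p.2.2 ^ 2 * Real.cos p.2.2 / p.1)
      - 2 * n * H *
        (√(p.1 ^ 2 * Real.sin p.2.2 ^ 2 + Real.cos p.2.2 ^ 2) ^ 3 / p.1 ^ 2))

theorem contDiffAt_flowField (n : ℕ) (H : ℝ) {p : ℝ × ℝ × ℝ} (hp : 0 < p.1) :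
    ContDiffAt ℝ 1 (flowField n H) p := by
  have hx : ContDiffAt ℝ 1 (fun p : ℝ × ℝ × ℝ => p.1) p := contDiff_fst.contDiffAt
  have hσ : ContDiffAt ℝ 1 (fun p : ℝ × ℝ × ℝ => p.2.2) p := contDiff_snd.snd.contDiffAt
  have hq : ContDiffAt ℝ 1
      (fun p : ℝ × ℝ × ℝ => √(p.1 ^ 2 * Real.sin p.2.2 ^ 2 + Real.cos p.2.2 ^ 2)) p :=
    ContDiffAt.sqrt (((hx.pow 2).mul (hσ.sin.pow 2)).add (hσ.cos.pow 2))
      (tiltNorm_arg_pos hp p.2.2).ne'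
  refine hσ.sin.prodMk (hσ.cos.prodMk ?_)
  refine ((contDiffAt_const.mul ((hσ.cos.pow 3).div (hx.pow 3) (by positivity))).add
    (contDiffAt_const.mul (((hσ.sin.pow 2).mul hσ.cos).div hx hp.ne'))).sub
    (contDiffAt_const.mul ((hq.pow 3).div (hx.pow 2) (by positivity)))

namespace IsSolution

variable {n : ℕ} {H : ℝ} {I : Set ℝ} {x t σ : ℝ → ℝ} {s : ℝ}

theorem hasDerivAt_flowField (h : IsSolution n H I x t σ) (hs : s ∈ I) :
    HasDerivAt (fun s => (x s, t s, σ s)) (flowField n H (x s, t s, σ s)) s :=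
  (h.deriv_x s hs).prodMk ((h.deriv_t s hs).prodMk (h.deriv_σ s hs))

theorem of_flowField (hI : IsOpen I) (hI' : I.OrdConnected) (hne : I.Nonempty) {γ : ℝ → ℝ × ℝ × ℝ}
    (hpos : ∀ s ∈ I, 0 < (γ s).1) (hd : ∀ s ∈ I, HasDerivAt γ (flowField n H (γ s)) s) :
    IsSolution n H I (fun s => (γ s).1) (fun s => (γ s).2.1) (fun s => (γ s).2.2) where
  isOpen := hI
  ordConnected := hI'
  nonempty := hne
  pos := hpos
  deriv_x s hs := (hasFDerivAt_fst (𝕜 := ℝ) (p := γ s)).comp_hasDerivAt s (hd s hs)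
  deriv_t s hs := ((hasFDerivAt_fst (𝕜 := ℝ) (p := (γ s).2)).comp (γ s)
    (hasFDerivAt_snd (𝕜 := ℝ) (p := γ s))).comp_hasDerivAt s (hd s hs)
  deriv_σ s hs := ((hasFDerivAt_snd (𝕜 := ℝ) (p := (γ s).2)).comp (γ s)
    (hasFDerivAt_snd (𝕜 := ℝ) (p := γ s))).comp_hasDerivAt s (hd s hs)

theorem continuousAt (h : IsSolution n H I x t σ) (hs : s ∈ I) :
    ContinuousAt (fun s => (x s, t s, σ s)) s := (h.hasDerivAt_flowField hs).continuousAt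

/-- Solutions are determined by their initial values. -/
theorem unique {x' t' σ' : ℝ → ℝ} (h : IsSolution n H I x t σ) (h' : IsSolution n H I x' t' σ')
    {s₀ : ℝ} (hs₀ : s₀ ∈ I) (hx : x s₀ = x' s₀) (ht : t s₀ = t' s₀) (hσ : σ s₀ = σ' s₀) :
    ∀ s ∈ I, x s = x' s ∧ t s = t' s ∧ σ s = σ' s := by
  set γ : ℝ → ℝ × ℝ × ℝ := fun s => (x s, t s, σ s) with hγ
  set γ' : ℝ → ℝ × ℝ × ℝ := fun s => (x' s, t' s, σ' s) with hγ'
  have key : ∀ r ∈ I, γ r = γ' r → γ =ᶠ[𝓝 r] γ' := by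
    intro r hr he
    obtain ⟨K, S, hS, hl⟩ := (contDiffAt_flowField n H (p := γ r) (h.pos r hr)).exists_lipschitzOnWith
    refine ODE_solution_unique_of_eventually (v := fun _ => flowField n H) (s := fun _ => S)
      (Eventually.of_forall fun _ => hl) ?_ ?_ he
    · filter_upwards [h.isOpen.mem_nhds hr, (h.continuousAt hr).eventually_mem hS] with a ha ha'
      exact ⟨h.hasDerivAt_flowField ha, ha'⟩
    · rw [he] at hS
      filter_upwards [h.isOpen.mem_nhds hr, (h'.continuousAt hr).eventually_mem hS] with a ha ha'
      exact ⟨h'.hasDerivAt_flowField ha, ha'⟩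
  have hsub : I ⊆ {r | γ =ᶠ[𝓝 r] γ'} := by
    refine h.convex.isPreconnected.subset_of_closure_inter_subset ?_
      ⟨s₀, hs₀, key s₀ hs₀ (by simp [hγ, hγ', hx, ht, hσ])⟩ ?_
    · exact isOpen_setOfPred_eventually_nhds
    · rintro r ⟨hr, hrI⟩
      refine key r hrI ?_
      by_contra hne
      have hev : ∀ᶠ a in 𝓝 r, γ a ≠ γ' a :=
        ((h.continuousAt hrI).prodMk (h'.continuousAt hrI)).eventually
          (isClosed_diagonal.isOpen_compl.mem_nhds hne)
      obtain ⟨a, ha, ha'⟩ := mem_closure_iff_nhds.1 hr _ hev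
      exact ha ha'.self_of_nhds
  intro s hs
  have := (hsub hs).self_of_nhds
  simpa [hγ, hγ'] using this

end IsSolution

/-- An integral curve which converges at the end of its interval of definition can be continued by
an integral curve issuing from its limit. -/
theorem hasDerivAt_concat {V : Type*} [NormedAddCommGroup V] [NormedSpace ℝ V] {F : V → V}
    {γ η : ℝ → V} {a b d : ℝ} (hab : a < b) (hbd : b < d) (hF : ContinuousAt F (η b))
    (hγ : ∀ s ∈ Ioo a b, HasDerivAt γ (F (γ s)) s)
    (hη : ∀ s ∈ Ico b d, HasDerivAt η (F (η s)) s)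
    (hlim : Tendsto γ (𝓝[<] b) (𝓝 (η b))) :
    ∀ s ∈ Ioo a d, HasDerivAt (fun s => if s < b then γ s else η s)
      (F (if s < b then γ s else η s)) s := by
  set δ : ℝ → V := fun s => if s < b then γ s else η s with hδ
  have hl : ∀ s < b, δ s = γ s := fun s hs => if_pos hs
  have hr : ∀ s, b ≤ s → δ s = η s := fun s hs => if_neg hs.not_gt
  have hleft : ∀ s ∈ Ioo a b, HasDerivAt δ (F (δ s)) s := fun s hs => by
    rw [hl s hs.2]
    refine (hγ s hs).congr_of_eventuallyEq ?_
    filter_upwards [Iio_mem_nhds hs.2] with r hr using hl r hr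
  intro s hs
  rcases lt_trichotomy s b with h | h | h
  · exact hleft s ⟨hs.1, h⟩
  · subst h
    have e : δ s = η s := hr s le_rfl
    have hev : ∀ᶠ r in 𝓝[<] s, r ∈ Ioo a s := Ioo_mem_nhdsLT hab
    have hlim' : Tendsto δ (𝓝[<] s) (𝓝 (η s)) := by
      refine hlim.congr' ?_
      filter_upwards [self_mem_nhdsWithin] with r hr' using (hl r hr').symm
    have h1 : HasDerivWithinAt δ (F (δ s)) (Iic s) s := by
      refine hasDerivWithinAt_Iic_of_tendsto_deriv (s := Ioo a s)
        (fun r hr' => (hleft r hr').differentiableAt.differentiableWithinAt) ?_ hev ?_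
      · rw [ContinuousWithinAt, e]
        exact hlim'.mono_left (nhdsWithin_mono _ Ioo_subset_Iio_self)
      · rw [e]
        refine (hF.tendsto.comp hlim').congr' ?_
        filter_upwards [hev] with r hr' using ((hleft r hr').deriv).symm
    have h2 : HasDerivWithinAt δ (F (δ s)) (Ici s) s := by
      rw [e]
      exact (hη s ⟨le_rfl, hbd⟩).hasDerivWithinAt.congr (fun r hr' => hr r hr') e
    have := h1.union h2
    rwa [Iic_union_Ici, hasDerivWithinAt_univ] at this
  · change HasDerivAt δ (F (δ s)) s
    rw [hr s h.le]
    refine (hη s ⟨h.le, hs.2⟩).congr_of_eventuallyEq ?_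
    filter_upwards [Ioi_mem_nhds h] with r hr' using hr r (le_of_lt hr')

/-- A function with bounded derivative has a limit at the end of a bounded interval. -/
theorem exists_tendsto_nhdsLT_of_deriv_bounded {f f' : ℝ → ℝ} {a b C : ℝ} (hab : a < b)
    (hf : ∀ s ∈ Ioo a b, HasDerivAt f (f' s) s) (hC : ∀ s ∈ Ioo a b, |f' s| ≤ C) :
    ∃ l, Tendsto f (𝓝[<] b) (𝓝 l) := by
  have hlip : LipschitzOnWith (Real.toNNReal C) f (Ioo a b) := by
    refine (convex_Ioo a b).lipschitzOnWith_of_nnnorm_hasDerivWithin_le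
      (fun s hs => (hf s hs).hasDerivWithinAt) fun s hs => ?_
    rw [← NNReal.coe_le_coe, coe_nnnorm, Real.norm_eq_abs]
    exact (hC s hs).trans (Real.le_coe_toNNReal C)
  obtain ⟨g, hg, hfg⟩ := hlip.extend_real
  refine ⟨g b, ((hg.continuous.tendsto b).mono_left nhdsWithin_le_nhds).congr' ?_⟩
  filter_upwards [Ioo_mem_nhdsLT hab] with s hs using (hfg hs).symm

theorem IsLUB.notMem_of_isOpen {I : Set ℝ} {b : ℝ} (hb : IsLUB I b) (hI : IsOpen I) : b ∉ I :=
  fun hbI => by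
    have h : ∀ᶠ c in 𝓝[>] b, c ∈ I := mem_nhdsWithin_of_mem_nhds (hI.mem_nhds hbI)
    obtain ⟨c, hc, hc'⟩ := (h.and self_mem_nhdsWithin).exists
    exact absurd (hb.1 hc) (not_le.2 hc')

namespace IsCompleteSolution

variable {n : ℕ} {H : ℝ} {I : Set ℝ} {x t σ : ℝ → ℝ}

/-- A complete solution defined up to a finite time `b` only tends to the `t`-axis there. -/
theorem tendsto_zero_of_isLUB (h : IsCompleteSolution n H I x t σ) {b : ℝ} (hb : IsLUB I b) :
    Tendsto x (𝓝[<] b) (𝓝 0) := by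
  obtain ⟨a, ha⟩ := h.nonempty
  have hbI : b ∉ I := hb.notMem_of_isOpen h.isOpen
  have hab : a < b := lt_of_le_of_ne (hb.1 ha) fun e => hbI (e ▸ ha)
  have hsub : Ioo a b ⊆ I := fun s hs => by
    obtain ⟨c, hc, hc'⟩ := (lt_isLUB_iff hb).1 hs.2
    exact h.ordConnected.out ha hc ⟨hs.1.le, hc'.le⟩
  obtain ⟨x₁, hx₁⟩ := exists_tendsto_nhdsLT_of_deriv_bounded hab
    (fun s hs => h.deriv_x s (hsub hs)) (C := 1) (fun s _ => Real.abs_sin_le_one _)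
  have hx₁0 : 0 ≤ x₁ := ge_of_tendsto hx₁ (by
    filter_upwards [Ioo_mem_nhdsLT hab] with s hs using (h.pos s (hsub hs)).le)
  rcases hx₁0.eq_or_lt with h0 | h0
  · rwa [← h0] at hx₁
  exfalso
  obtain ⟨t₁, ht₁⟩ := exists_tendsto_nhdsLT_of_deriv_bounded hab
    (fun s hs => h.deriv_t s (hsub hs)) (C := 1) (fun s _ => Real.abs_cos_le_one _)
  -- close to the end `x` stays in a compact subset of `(0, ∞)`, where `σ'` is bounded
  obtain ⟨σ₁, hσ₁⟩ : ∃ σ₁, Tendsto σ (𝓝[<] b) (𝓝 σ₁) := by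
    have hev : ∀ᶠ s in 𝓝[<] b, x s ∈ Ioo (x₁ / 2) (2 * x₁) :=
      hx₁.eventually_mem (Ioo_mem_nhds (by linarith) (by linarith))
    obtain ⟨a', ha', hev⟩ := (mem_nhdsLT_iff_exists_mem_Ico_Ioo_subset hab).1 hev
    set M := max 1 (2 * x₁)
    refine exists_tendsto_nhdsLT_of_deriv_bounded ha'.2
      (C := (M / (x₁ / 2)) ^ 3 * (1 + (2 * n + 2) * 1 + 2 * n * |H| * M))
      (fun s hs => h.deriv_σ' (hsub ⟨ha'.1.trans_lt hs.1, hs.2⟩)) fun s hs => ?_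
    have hxs := h.pos s (hsub ⟨ha'.1.trans_lt hs.1, hs.2⟩)
    have hs' := hev hs
    have hM : x s ≤ M := hs'.2.le.trans (le_max_right _ _)
    have hQ := tiltNorm_pos hxs (σ s)
    have hQM := tiltNorm_le hxs (le_max_left 1 (2 * x₁)) hM (σ s)
    have hU : |tiltCos (x s) (σ s)| ≤ 1 := abs_le.2 ⟨neg_one_le_tiltCos hxs _, tiltCos_le_one hxs _⟩
    rw [abs_mul, abs_of_pos (by positivity)]
    gcongr
    · exact hs'.1.le
    · rw [curvatureFactor]
      refine (abs_sub _ _).trans (add_le_add ((abs_add_le _ _).trans (add_le_add ?_ ?_)) ?_)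
      · rw [abs_pow]; exact pow_le_one₀ (abs_nonneg _) hU
      · rw [abs_mul]
        gcongr
        rw [abs_le]
        constructor <;> nlinarith [(Nat.cast_nonneg n : (0 : ℝ) ≤ n)]
      · rw [abs_mul, abs_mul, abs_of_pos hxs, abs_of_nonneg (by positivity : (0 : ℝ) ≤ 2 * n)]
        gcongr
  obtain ⟨η, hη, ε, hε, hηd⟩ :=
    (contDiffAt_flowField n H
      (p := (x₁, t₁, σ₁)) h0).exists_forall_mem_closedBall_exists_eq_forall_mem_Ioo_hasDerivAt₀ b
  have hηc : ContinuousAt (fun s => (η s).1) b :=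
    continuous_fst.continuousAt.comp (hηd b ⟨by linarith, by linarith⟩).continuousAt
  have hpos : ∀ᶠ s in 𝓝 b, 0 < (η s).1 :=
    hηc.eventually_const_lt (by simpa [hη] using h0)
  obtain ⟨ε', hε', hpos⟩ := Metric.eventually_nhds_iff.1 hpos
  set d := b + min ε ε' with hd
  have hbd : b < d := by have := lt_min hε hε'; linarith
  have hconc := hasDerivAt_concat (F := flowField n H) (γ := fun s => (x s, t s, σ s)) (η := η)
    hab hbd (by rw [hη]; exact (contDiffAt_flowField n H h0).continuousAt)
    (fun s hs => h.hasDerivAt_flowField (hsub hs))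
    (fun s hs => hηd s ⟨by linarith [hs.1], by linarith [hs.2, min_le_left ε ε']⟩)
    (by rw [hη]; exact hx₁.prodMk_nhds (ht₁.prodMk_nhds hσ₁))
  set δ : ℝ → ℝ × ℝ × ℝ := fun s => if s < b then (x s, t s, σ s) else η s with hδ
  have hIb : ∀ s ∈ I, s < b := fun s hs => lt_of_le_of_ne (hb.1 hs) fun e => hbI (e ▸ hs)
  have hδI : ∀ s ∈ I, δ s = (x s, t s, σ s) := fun s hs => if_pos (hIb s hs)
  have hsol : IsSolution n H (I ∪ Ioo a d) (fun s => (δ s).1) (fun s => (δ s).2.1)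
      (fun s => (δ s).2.2) := by
    refine IsSolution.of_flowField (h.isOpen.union isOpen_Ioo) ?_ ⟨a, Or.inl ha⟩ ?_ ?_
    · refine (IsPreconnected.union' ?_ h.convex.isPreconnected isPreconnected_Ioo).ordConnected
      obtain ⟨c, hc⟩ := exists_between hab
      exact ⟨c, hsub hc, hc.1, hc.2.trans hbd⟩
    · intro s hs
      by_cases hsb : s < b
      · have : s ∈ I := hs.elim id fun hs => hsub ⟨hs.1, hsb⟩
        rw [hδI s this]; exact h.pos s this
      · have hs' : s ∈ Ioo a d := hs.resolve_left fun hs => hsb (hIb s hs)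
        simp only [hδ, if_neg hsb]
        refine hpos ?_
        rw [Real.dist_eq, abs_of_nonneg (by linarith)]
        linarith [hs'.2, min_le_right ε ε']
    · intro s hs
      by_cases hsI : s ∈ I
      · rw [hδI s hsI]
        exact (h.hasDerivAt_flowField hsI).congr_of_eventuallyEq
          (by filter_upwards [h.isOpen.mem_nhds hsI] with r hr using hδI r hr)
      · exact hconc s (hs.resolve_left hsI)
  have := h.maximal _ _ _ _ hsol subset_union_left (fun s hs => by simp [hδI s hs])
    (fun s hs => by simp [hδI s hs]) (fun s hs => by simp [hδI s hs])
  exact hbI (this ▸ Or.inr ⟨hab, hbd⟩)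

theorem reverse (h : IsCompleteSolution n H I x t σ) :
    IsCompleteSolution n (-H) (Neg.neg ⁻¹' I) (fun s => x (-s)) (fun s => t (-s))
      (fun s => σ (-s) + Real.pi) where
  toIsSolution := h.toIsSolution.reverse
  maximal I' x' t' σ' h' hI hx ht hσ := by
    have hr := h'.reverse
    rw [neg_neg] at hr
    have hm : ∀ s ∈ I, -s ∈ Neg.neg ⁻¹' I := fun s hs => by simpa using hs
    -- reversing twice shifts the angle by `2π`, which has to be undone
    have hr' : IsSolution n H (Neg.neg ⁻¹' I') (fun s => x' (-s)) (fun s => t' (-s))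
        (fun s => σ' (-s) - Real.pi) := by
      refine ⟨hr.isOpen, hr.ordConnected, hr.nonempty, hr.pos, fun s hs => ?_, fun s hs => ?_,
        fun s hs => ?_⟩
      · convert hr.deriv_x s hs using 1
        simp
      · convert hr.deriv_t s hs using 1
        simp
      · have := (hr.deriv_σ s hs).sub_const (2 * Real.pi)
        have e1 : Real.cos (σ' (-s) - Real.pi) = Real.cos (σ' (-s) + Real.pi) := by
          rw [Real.cos_sub_pi, Real.cos_add_pi]
        have e2 : Real.sin (σ' (-s) - Real.pi) = Real.sin (σ' (-s) + Real.pi) := by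
          rw [Real.sin_sub_pi, Real.sin_add_pi]
        rw [e1, e2]
        have e3 : (fun s => σ' (-s) - Real.pi) = fun s => σ' (-s) + Real.pi - 2 * Real.pi := by
          ext s; ring
        rw [e3]
        exact this
    have := h.maximal _ _ _ _ hr' (fun s hs => hI (hm s hs)) (fun s hs => by simpa using hx (hm s hs))
      (fun s hs => by simpa using ht (hm s hs))
      (fun s hs => by simpa [sub_eq_iff_eq_add] using hσ (hm s hs))
    rw [← this]
    ext s; simp

theorem tendsto_zero_of_isGLB (h : IsCompleteSolution n H I x t σ) {a : ℝ} (ha : IsGLB I a) :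
    Tendsto x (𝓝[>] a) (𝓝 0) := by
  have h1 : IsLUB (Neg.neg ⁻¹' I) (-a) := by
    have := ha.neg
    rwa [← Set.image_neg_eq_neg, Set.image_neg_eq_neg] at this
  have h2 := h.reverse.tendsto_zero_of_isLUB h1
  have h3 : Tendsto Neg.neg (𝓝[>] a) (𝓝[<] (-a)) := tendsto_neg_nhdsGT
  simpa [Function.comp_def] using h2.comp h3

theorem not_bddAbove (h : IsCompleteSolution n H I x t σ) {m : ℝ} (hm : 0 < m)
    (hx : ∀ s ∈ I, m ≤ x s) : ¬ BddAbove I := fun hb => by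
  have hl := isLUB_csSup h.nonempty hb
  obtain ⟨a, ha⟩ := h.nonempty
  have h1 := (h.tendsto_zero_of_isLUB hl).eventually_lt_const hm
  have hne : sSup I ∉ I := hl.notMem_of_isOpen h.isOpen
  have hab : a < sSup I := lt_of_le_of_ne (hl.1 ha) fun e => hne (e ▸ ha)
  obtain ⟨s, hs, hs'⟩ := (h1.and (Ioo_mem_nhdsLT hab)).exists
  obtain ⟨c, hc, hc'⟩ := (lt_isLUB_iff hl).1 hs'.2
  exact absurd (hx s (h.ordConnected.out ha hc ⟨hs'.1.le, hc'.le⟩)) (not_le.2 hs)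

/-- A complete solution which stays away from the `t`-axis is defined on `ℝ`. -/
theorem eq_univ (h : IsCompleteSolution n H I x t σ) {m : ℝ} (hm : 0 < m)
    (hx : ∀ s ∈ I, m ≤ x s) : I = univ := by
  have h1 := h.not_bddAbove hm hx
  have h2 := h.reverse.not_bddAbove hm (fun s hs => hx _ hs)
  refine eq_univ_of_forall fun s => ?_
  obtain ⟨b, hb, hb'⟩ := not_bddAbove_iff.1 h1 s
  obtain ⟨a, ha, ha'⟩ := not_bddAbove_iff.1 h2 (-s)
  exact h.ordConnected.out ha hb ⟨by linarith, hb'.le⟩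

end IsCompleteSolution

/-! ### Mean curvature of hypersurfaces of revolution -/

namespace Heis

variable {n : ℕ}

theorem inner_I_smul_right (z w : EuclideanSpace ℂ (Fin n)) :
    inner ℝ z (Complex.I • w) = symp z w := by
  simp only [symp, PiLp.inner_apply, Complex.inner, Complex.im_sum, PiLp.smul_apply]
  refine Finset.sum_congr rfl fun i _ => ?_
  simp; ring

theorem inner_I_smul_left (z w : EuclideanSpace ℂ (Fin n)) :
    inner ℝ (Complex.I • z) w = -symp z w := by
  simp only [symp, PiLp.inner_apply, Complex.inner, Complex.im_sum, PiLp.smul_apply,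
    ← Finset.sum_neg_distrib]
  refine Finset.sum_congr rfl fun i _ => ?_
  simp; ring

theorem symp_comm (z w : EuclideanSpace ℂ (Fin n)) : symp w z = -symp z w := by
  rw [← inner_I_smul_right, real_inner_comm, inner_I_smul_left]

theorem symp_self (z : EuclideanSpace ℂ (Fin n)) : symp z z = 0 := by
  linarith [symp_comm z z]

theorem symp_add_right (z w w' : EuclideanSpace ℂ (Fin n)) :
    symp z (w + w') = symp z w + symp z w' := by
  simp only [← inner_I_smul_right, smul_add, inner_add_right]

theorem symp_smul_right (z w : EuclideanSpace ℂ (Fin n)) (a : ℝ) :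
    symp z (a • w) = a * symp z w := by
  have := inner_I_smul_left z (a • w)
  rw [inner_smul_right, inner_I_smul_left] at this
  simp at this
  linarith

theorem symp_smul_left (z w : EuclideanSpace ℂ (Fin n)) (a : ℝ) :
    symp (a • z) w = a * symp z w := by
  rw [symp_comm w, symp_smul_right, symp_comm z]; ring

theorem complex_smul_eq (c : ℂ) (z : EuclideanSpace ℂ (Fin n)) :
    c • z = c.re • z + c.im • (Complex.I • z) := by
  conv_lhs => rw [← Complex.re_add_im c]
  rw [add_smul, mul_smul, Complex.coe_smul, Complex.coe_smul]

theorem inner_complex_smul_left (c : ℂ) (z w : EuclideanSpace ℂ (Fin n)) :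
    inner ℝ (c • z) w = c.re * inner ℝ z w - c.im * symp z w := by
  rw [complex_smul_eq, inner_add_left, real_inner_smul_left, real_inner_smul_left,
    inner_I_smul_left]
  ring

theorem inner_complex_smul_right (c : ℂ) (z w : EuclideanSpace ℂ (Fin n)) :
    inner ℝ z (c • w) = c.re * inner ℝ z w + c.im * symp z w := by
  rw [real_inner_comm, inner_complex_smul_left, real_inner_comm, symp_comm]
  ring

theorem symp_complex_smul_right (c : ℂ) (z w : EuclideanSpace ℂ (Fin n)) :
    symp z (c • w) = c.re * symp z w - c.im * inner ℝ z w := by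
  rw [← inner_I_smul_right, smul_smul, inner_complex_smul_right, Complex.I_mul_re,
    Complex.I_mul_im]
  ring

end Heis

/-- Parseval's identity in the orthogonal complement of a unit vector. -/
theorem sum_inner_mul_inner_of_orthogonal {V : Type*} [NormedAddCommGroup V]
    [InnerProductSpace ℝ V] {m : ℕ} (hV : Module.finrank ℝ V = m + 1) {v : Fin m → V} {N : V}
    (hv : Orthonormal ℝ v) (hN : inner ℝ N N = (1 : ℝ)) (hNv : ∀ i, inner ℝ N (v i) = (0 : ℝ))
    (f g : V) :
    ∑ i, inner ℝ f (v i) * inner ℝ g (v i) = inner ℝ f g - inner ℝ f N * inner ℝ g N := by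
  have : FiniteDimensional ℝ V := Module.finite_of_finrank_eq_succ hV
  have ho : Orthonormal ℝ (Fin.cons N v : Fin (m + 1) → V) := by
    rw [orthonormal_iff_ite] at hv ⊢
    intro i j
    refine Fin.cases ?_ (fun i => ?_) i <;> refine Fin.cases ?_ (fun j => ?_) j
    · simpa using hN
    · simpa [(Fin.succ_ne_zero j).symm] using hNv j
    · simpa [Fin.succ_ne_zero i, real_inner_comm] using hNv i
    · simpa using hv i j
  have hspan := ho.linearIndependent.span_eq_top_of_card_eq_finrank' (by simp [hV])
  have := (OrthonormalBasis.mk ho hspan.ge).sum_inner_mul_inner f g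
  simp only [OrthonormalBasis.coe_mk, Fin.sum_univ_succ, Fin.cons_zero, Fin.cons_succ,
    fun a : V => real_inner_comm g a] at this
  linarith [real_inner_comm f g]

theorem finrank_euclideanSpace_complex (n : ℕ) :
    Module.finrank ℝ (EuclideanSpace ℂ (Fin n)) = 2 * n := by
  rw [← Module.finrank_mul_finrank ℝ ℂ]; simp

theorem finrank_withLp_heis (n : ℕ) :
    Module.finrank ℝ (WithLp 2 (EuclideanSpace ℂ (Fin n) × ℝ)) = 2 * n + 1 := by
  rw [(WithLp.linearEquiv 2 ℝ _).finrank_eq, Module.finrank_prod, finrank_euclideanSpace_complex]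
  simp

/-- Parseval's identity for a family of tangent vectors of a hypersurface with unit normal `N`. -/
theorem sum_metric_mul_metric {n : ℕ} {v : Fin (2 * n) → Heis n} {N : Heis n}
    (hv : ∀ i j, Heis.metric (v i) (v j) = if i = j then 1 else 0)
    (hN : Heis.metric N N = 1) (hNv : ∀ i, Heis.metric N (v i) = 0) (f g : Heis n) :
    ∑ i, Heis.metric f (v i) * Heis.metric g (v i)
      = Heis.metric f g - Heis.metric f N * Heis.metric g N := by
  have e : ∀ a b : Heis n, Heis.metric a b
      = inner ℝ (WithLp.toLp 2 a : WithLp 2 (EuclideanSpace ℂ (Fin n) × ℝ)) (WithLp.toLp 2 b) := by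
    intro a b
    rw [WithLp.prod_inner_apply, Heis.metric]
    simp [mul_comm]
  have := sum_inner_mul_inner_of_orthogonal (finrank_withLp_heis n)
    (v := fun i => WithLp.toLp 2 (v i)) (N := WithLp.toLp 2 N)
    (by rw [orthonormal_iff_ite]; intro i j; rw [← e]; exact hv i j) (by rw [← e]; exact hN)
    (fun i => by rw [← e]; exact hNv i) (WithLp.toLp 2 f) (WithLp.toLp 2 g)
  simpa only [e] using this

theorem finrank_revolutionTangent {n : ℕ} (hn : 1 ≤ n) {b : ℝ × EuclideanSpace ℂ (Fin n)}
    (hb : ‖b.2‖ = 1) : Module.finrank ℝ (revolutionTangent n b) = 2 * n := by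
  obtain ⟨k, hk⟩ : ∃ k, 2 * n = k + 1 := ⟨2 * n - 1, by omega⟩
  have : Fact (Module.finrank ℝ (EuclideanSpace ℂ (Fin n)) = k + 1) :=
    ⟨by rw [finrank_euclideanSpace_complex, hk]⟩
  have h0 : b.2 ≠ 0 := by rw [← norm_ne_zero_iff, hb]; exact one_ne_zero
  let f : (revolutionTangent n b) ≃ₗ[ℝ] ℝ × (Submodule.span ℝ {b.2})ᗮ :=
    { toFun := fun v => (v.1.1, ⟨v.1.2, v.2.2⟩)
      invFun := fun v => ⟨(v.1, v.2.1), ⟨trivial, v.2.2⟩⟩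
      map_add' := fun _ _ => rfl
      map_smul' := fun _ _ => rfl
      left_inv := fun _ => rfl
      right_inv := fun _ => rfl }
  rw [f.finrank_eq, Module.finrank_prod, Submodule.finrank_orthogonal_span_singleton (n := k) h0, hk]
  simp [add_comm]

theorem mem_revolutionTangent {n : ℕ} {b e : ℝ × EuclideanSpace ℂ (Fin n)} :
    e ∈ revolutionTangent n b ↔ inner ℝ b.2 e.2 = (0 : ℝ) := by
  rw [revolutionTangent, Submodule.mem_prod, Submodule.mem_orthogonal_singleton_iff_inner_right]
  simp

/-- The horizontal normal along `φ` is `-(U + iV) ω`, `ω` being normalized. -/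
theorem horizontalNormal_revolutionNormal {n : ℕ} {x σ : ℝ → ℝ}
    {b : ℝ × EuclideanSpace ℂ (Fin n)} (hx : 0 < x b.1) :
    horizontalNormal (revolutionNormal n x σ) b =
      ((-(tiltCos (x b.1) (σ b.1) + Complex.I * tiltSin (x b.1) (σ b.1)) : ℂ) •
        (‖b.2‖⁻¹ • b.2), 0) := by
  set Q := tiltNorm (x b.1) (σ b.1) with hQ
  have hQ0 : 0 < Q := tiltNorm_pos hx _
  set k := √(1 + x b.1 ^ 2 * Real.sin (σ b.1) ^ 2) with hk
  have hk0 : 0 < k := Real.sqrt_pos.2 (by positivity)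
  set c : ℂ := -(Real.cos (σ b.1) + Complex.I * (x b.1 * Real.sin (σ b.1))) with hc
  have hnc : ‖c‖ = Q := by
    rw [Complex.norm_def, hQ, tiltNorm, Complex.normSq_apply, hc]
    congr 1
    simp only [← Complex.ofReal_mul, Complex.neg_re, Complex.neg_im, Complex.add_re,
      Complex.add_im, Complex.ofReal_re, Complex.ofReal_im, Complex.re_mul_ofReal,
      Complex.im_mul_ofReal, Complex.I_re, Complex.I_im]
    ring
  have h1 : (revolutionNormal n x σ b).1 = k⁻¹ • c • b.2 := rfl
  have hg : (-(tiltCos (x b.1) (σ b.1) + Complex.I * tiltSin (x b.1) (σ b.1)) : ℂ) = Q⁻¹ • c := by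
    rw [hc, tiltCos, tiltSin, ← hQ]
    simp only [Complex.real_smul]
    push_cast
    ring
  rw [horizontalNormal, h1, norm_smul, norm_smul, hnc, norm_inv, Real.norm_of_nonneg hk0.le, hg]
  ext1
  · change (k⁻¹ * (Q * ‖b.2‖))⁻¹ • k⁻¹ • c • b.2 = (Q⁻¹ • c) • ‖b.2‖⁻¹ • b.2
    rw [smul_assoc, smul_comm c, smul_smul, smul_smul]
    congr 1
    rw [mul_inv, mul_inv, inv_inv]
    field_simp
  · rfl

/-- The differential of the radial projection to the unit sphere at a point `y` of the sphere is
the orthogonal projection to `y^⊥`. -/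
theorem hasFDerivAt_inv_norm_smul {V : Type*} [NormedAddCommGroup V] [InnerProductSpace ℝ V]
    {y : V} (hy : ‖y‖ = 1) :
    HasFDerivAt (fun y : V => ‖y‖⁻¹ • y)
      (ContinuousLinearMap.id ℝ V - (innerSL ℝ y).smulRight y) y := by
  have h1 : HasFDerivAt (fun y : V => ‖y‖ ^ 2) (2 • innerSL ℝ y) y :=
    (hasStrictFDerivAt_norm_sq y).hasFDerivAt
  have h2 : HasFDerivAt (fun y : V => √(‖y‖ ^ 2)) _ y := h1.sqrt (by simp [hy])
  simp only [Real.sqrt_sq (norm_nonneg _)] at h2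
  have h3 := ((hasDerivAt_inv (by simp [hy] : ‖y‖ ≠ 0)).comp_hasFDerivAt y h2).smul (hasFDerivAt_id y)
  refine h3.congr_fderiv ?_
  ext v
  simp [hy, ContinuousLinearMap.smulRight_apply]
  module

namespace IsSolution

variable {n : ℕ} {H : ℝ} {I : Set ℝ} {x t σ : ℝ → ℝ} {b : ℝ × EuclideanSpace ℂ (Fin n)}

theorem fderiv_revolution (h : IsSolution n H I x t σ) (hb : b.1 ∈ I)
    (e : ℝ × EuclideanSpace ℂ (Fin n)) :
    fderiv ℝ (revolution n x t) b e =
      ((e.1 * Real.sin (σ b.1)) • b.2 + x b.1 • e.2, e.1 * Real.cos (σ b.1)) := by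
  have hf : HasFDerivAt (Prod.fst : ℝ × EuclideanSpace ℂ (Fin n) → ℝ)
    (ContinuousLinearMap.fst ℝ ℝ _) b := hasFDerivAt_fst
  have hx := (h.deriv_x _ hb).comp_hasFDerivAt b hf
  have ht := (h.deriv_t _ hb).comp_hasFDerivAt b hf
  have : HasFDerivAt (revolution n x t) _ b := (hx.smul hasFDerivAt_snd).prodMk ht
  rw [this.fderiv]
  ext1
  · simp [mul_comm, add_comm]
  · simp [mul_comm]

theorem pushFrame_revolution (h : IsSolution n H I x t σ) (hb : b.1 ∈ I)
    (e : ℝ × EuclideanSpace ℂ (Fin n)) :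
    pushFrame (revolution n x t) b e =
      ((e.1 * Real.sin (σ b.1)) • b.2 + x b.1 • e.2,
        e.1 * Real.cos (σ b.1) - x b.1 ^ 2 * Heis.symp b.2 e.2) := by
  rw [pushFrame, h.fderiv_revolution hb, Heis.toFrame, revolution]
  ext1
  · rfl
  · simp only [Heis.symp_smul_left, Heis.symp_add_right, Heis.symp_smul_right, Heis.symp_self]
    ring

theorem fderiv_horizontalNormal (h : IsSolution n H I x t σ) (hb : b.1 ∈ I) (hb' : ‖b.2‖ = 1)
    {e : ℝ × EuclideanSpace ℂ (Fin n)} (he : inner ℝ b.2 e.2 = (0 : ℝ)) :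
    fderiv ℝ (horizontalNormal (revolutionNormal n x σ)) b e =
      (-((e.1 * (tiltSlope n H (x b.1) (tiltCos (x b.1) (σ b.1)) *
            (Real.sin (σ b.1) - Complex.I * (Real.cos (σ b.1) / x b.1))) : ℂ) • b.2
          + (tiltCos (x b.1) (σ b.1) + Complex.I * tiltSin (x b.1) (σ b.1) : ℂ) • e.2), 0) := by
  have hx := h.pos _ hb
  have hU := (h.hasDerivAt_tiltCos hb).ofReal_comp
  have hV := (h.hasDerivAt_tiltSin hb).ofReal_comp
  have hg := (hU.add (hV.const_mul Complex.I)).neg.hasFDerivAt.comp b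
    (hasFDerivAt_fst (𝕜 := ℝ))
  have hy := (hasFDerivAt_inv_norm_smul hb').comp b (hasFDerivAt_snd (𝕜 := ℝ))
  have hN := (hg.smul hy).prodMk (hasFDerivAt_const (0 : ℝ) b)
  have hev : horizontalNormal (revolutionNormal n x σ) =ᶠ[𝓝 b] fun b =>
      ((-(tiltCos (x b.1) (σ b.1) + Complex.I * tiltSin (x b.1) (σ b.1)) : ℂ) •
        (‖b.2‖⁻¹ • b.2), 0) := by
    filter_upwards [(h.isOpen.preimage continuous_fst).mem_nhds hb] with c hc
    exact horizontalNormal_revolutionNormal (h.pos _ hc)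
  rw [(hN.congr_of_eventuallyEq hev).fderiv]
  ext1
  · simp [hb', he]
    module
  · simp

theorem metric_revolutionNormal_self (hb' : ‖b.2‖ = 1) :
    Heis.metric (revolutionNormal n x σ b) (revolutionNormal n x σ b) = 1 := by
  have hK : √(1 + x b.1 ^ 2 * Real.sin (σ b.1) ^ 2) ^ 2 = _ :=
    Real.sq_sqrt (by positivity : 0 ≤ 1 + x b.1 ^ 2 * Real.sin (σ b.1) ^ 2)
  have hK0 : 0 < √(1 + x b.1 ^ 2 * Real.sin (σ b.1) ^ 2) := Real.sqrt_pos.2 (by positivity)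
  have h1 := Real.sin_sq_add_cos_sq (σ b.1)
  have hω : inner ℝ b.2 b.2 = (1 : ℝ) := by rw [real_inner_self_eq_norm_sq, hb']; norm_num
  simp only [Heis.metric, revolutionNormal, Prod.smul_mk, real_inner_smul_left,
    real_inner_smul_right, ← Complex.ofReal_mul, Heis.inner_complex_smul_right, smul_eq_mul]
  rw [Heis.inner_complex_smul_left, Heis.symp_comm b.2 ((_ : ℂ) • b.2),
    Heis.symp_complex_smul_right, hω,
    Heis.symp_self]
  simp only [Complex.mul_re, Complex.neg_re, Complex.neg_im, Complex.add_re,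
      Complex.add_im, Complex.ofReal_re, Complex.ofReal_im, Complex.mul_im,
      Complex.I_re, Complex.I_im]
  field_simp
  rw [hK]
  linear_combination h1

theorem metric_horizontal_left (z : EuclideanSpace ℂ (Fin n)) (v : Heis n) :
    Heis.metric (z, 0) v = inner ℝ z v.1 := by
  simp [Heis.metric]

theorem inner_revolutionNormal (hb' : ‖b.2‖ = 1) :
    inner ℝ b.2 (revolutionNormal n x σ b).1
      = -((√(1 + x b.1 ^ 2 * Real.sin (σ b.1) ^ 2))⁻¹ * Real.cos (σ b.1)) := by
  have hω : inner ℝ b.2 b.2 = (1 : ℝ) := by rw [real_inner_self_eq_norm_sq, hb']; norm_num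
  simp only [revolutionNormal, Prod.smul_mk, real_inner_smul_right, ← Complex.ofReal_mul]
  rw [Heis.inner_complex_smul_right, hω, Heis.symp_self]
  simp only [Complex.mul_re, Complex.neg_re, Complex.add_re, Complex.ofReal_re,
      Complex.ofReal_im, Complex.I_re, Complex.I_im]
  ring

theorem inner_I_revolutionNormal (hb' : ‖b.2‖ = 1) :
    inner ℝ (Complex.I • b.2) (revolutionNormal n x σ b).1
      = -((√(1 + x b.1 ^ 2 * Real.sin (σ b.1) ^ 2))⁻¹ * (x b.1 * Real.sin (σ b.1))) := by
  have hω : inner ℝ b.2 b.2 = (1 : ℝ) := by rw [real_inner_self_eq_norm_sq, hb']; norm_num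
  simp only [revolutionNormal, Prod.smul_mk, real_inner_smul_right, ← Complex.ofReal_mul]
  rw [Heis.inner_I_smul_left, Heis.symp_complex_smul_right, hω, Heis.symp_self]
  simp only [Complex.neg_im, Complex.add_im, Complex.ofReal_re,
      Complex.ofReal_im, Complex.mul_im, Complex.I_re, Complex.I_im]
  ring

theorem metric_revolutionNormal_pushFrame (h : IsSolution n H I x t σ) (hb : b.1 ∈ I)
    (hb' : ‖b.2‖ = 1) {e : ℝ × EuclideanSpace ℂ (Fin n)} (he : inner ℝ b.2 e.2 = (0 : ℝ)) :
    Heis.metric (revolutionNormal n x σ b) (pushFrame (revolution n x t) b e) = 0 := by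
  have hω : inner ℝ b.2 b.2 = (1 : ℝ) := by rw [real_inner_self_eq_norm_sq, hb']; norm_num
  rw [h.pushFrame_revolution hb]
  simp only [Heis.metric, revolutionNormal, Prod.smul_mk, real_inner_smul_left,
    ← Complex.ofReal_mul, Heis.inner_complex_smul_left, inner_add_right, real_inner_smul_right,
    Heis.symp_self, hω, he, smul_eq_mul]
  simp only [Complex.mul_re, Complex.neg_re, Complex.neg_im, Complex.add_re,
      Complex.add_im, Complex.ofReal_re, Complex.ofReal_im, Complex.mul_im,
      Complex.I_re, Complex.I_im]
  ring

/-- The quadratic form `⟨D_E ν_H, E⟩` on unit tangent vectors `E`, in terms of the components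
`p = ⟨ω, E⟩`, `r = ⟨iω, E⟩`, `c = ⟨T, E⟩`; the other components enter through `|E| = 1` only.  It is
written as a combination of products of linear forms, to which Parseval's identity applies. -/
theorem metric_covDeriv_horizontalNormal (h : IsSolution n H I x t σ) (hb : b.1 ∈ I)
    (hb' : ‖b.2‖ = 1) {e : ℝ × EuclideanSpace ℂ (Fin n)} (he : inner ℝ b.2 e.2 = (0 : ℝ))
    {E : Heis n} (hE : pushFrame (revolution n x t) b e = E) (hE1 : Heis.metric E E = 1)
    {p r c s k U V W X : ℝ} (hp : Heis.metric (b.2, 0) E = p)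
    (hr : Heis.metric (Complex.I • b.2, 0) E = r)
    (hc : Heis.metric (0, 1) E = c) (hs : Real.sin (σ b.1) = s) (hk : Real.cos (σ b.1) = k)
    (hX : x b.1 = X) (hU : tiltCos (x b.1) (σ b.1) = U) (hV : tiltSin (x b.1) (σ b.1) = V)
    (hW : tiltSlope n H X U = W) :
    Heis.metric (Heis.covDeriv E (horizontalNormal (revolutionNormal n x σ) b)
        (fderiv ℝ (horizontalNormal (revolutionNormal n x σ)) b e)) E
      = (-(W * s ^ 2) + U / X) * (p * p) + (W * s * k * X + W * k * s / X + V / X) * (p * r)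
        - W * k ^ 2 * (r * r) + (2 * V - W * s * k) * (c * p) + (W * k ^ 2 / X - 2 * U) * (c * r)
        + U / X * (c * c) - U / X := by
  have hx := h.pos _ hb
  have hω : inner ℝ b.2 b.2 = (1 : ℝ) := by rw [real_inner_self_eq_norm_sq, hb']; norm_num
  have h1 := Real.sin_sq_add_cos_sq (σ b.1)
  rw [h.fderiv_horizontalNormal hb hb' he, horizontalNormal_revolutionNormal hx, hb']
  rw [h.pushFrame_revolution hb] at hE
  rw [hU, hV, hX, hW, hs, hk]
  rw [hX] at hx
  rw [hX, hs, hk] at hE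
  rw [hs, hk] at h1
  have hws : Heis.symp e.2 b.2 = -Heis.symp b.2 e.2 := Heis.symp_comm _ _
  have hwe : inner ℝ e.2 b.2 = (0 : ℝ) := by rw [real_inner_comm, he]
  subst hE
  have hp' : p = e.1 * s := by
    rw [← hp, metric_horizontal_left]
    simp [inner_add_right, real_inner_smul_right, he, hb']
  have hr' : r = -(X * Heis.symp b.2 e.2) := by
    rw [← hr, metric_horizontal_left]
    simp only [Heis.inner_I_smul_left, Heis.symp_add_right, Heis.symp_smul_right, Heis.symp_self]
    ring
  have hc' : c = e.1 * k - X ^ 2 * Heis.symp b.2 e.2 := by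
    rw [← hc]; simp [Heis.metric]
  have hn : e.1 ^ 2 * s ^ 2 + X ^ 2 * inner ℝ e.2 e.2 + c ^ 2 = 1 := by
    rw [← hE1, hc']
    simp only [Heis.metric, inner_add_left, inner_add_right, real_inner_smul_left,
      real_inner_smul_right, hω, he, hwe]
    ring
  simp only [Heis.metric, Heis.covDeriv, Heis.christoffel, Prod.mk_add_mk, zero_smul, zero_add,
    inv_one, one_smul]
  rw [← neg_neg (Heis.symp (_ + _) _), ← Heis.symp_comm, smul_comm Complex.I, inner_add_left,
    real_inner_smul_left, ← Heis.inner_I_smul_left, smul_smul]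
  simp only [inner_neg_left, inner_add_left, Heis.inner_complex_smul_left, inner_add_right,
    real_inner_smul_right, Heis.symp_self, hω, he, hws, hwe]
  simp only [Complex.mul_re, Complex.neg_re, Complex.neg_im, Complex.add_re, Complex.sub_re,
      Complex.sub_im, ← Complex.ofReal_div,
      Complex.add_im, Complex.ofReal_re, Complex.ofReal_im, Complex.mul_im,
      Complex.I_re, Complex.I_im]
  subst hp' hr' hc'
  generalize Heis.symp b.2 e.2 = j at *
  generalize inner ℝ e.2 e.2 = q at *
  field_simp
  linear_combination X * (W * (e.1 * s ^ 2 + k * j) * e.1) * h1 - U * hn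

theorem hasMeanCurvatureAt (h : IsSolution n H I x t σ) (hb : b.1 ∈ I) (hb' : ‖b.2‖ = 1) :
    HasMeanCurvatureAt (revolution n x t) (revolutionNormal n x σ) (revolutionTangent n b) b H := by
  intro e he hon
  have hx := h.pos _ hb
  have hω : inner ℝ b.2 b.2 = (1 : ℝ) := by rw [real_inner_self_eq_norm_sq, hb']; norm_num
  have he' : ∀ i, inner ℝ b.2 (e i).2 = (0 : ℝ) := fun i => mem_revolutionTangent.1 (he i)
  have key := fun i => h.metric_covDeriv_horizontalNormal hb hb' (he' i) rfl
    (by simpa using hon i i) rfl rfl rfl rfl rfl rfl rfl rfl rfl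
  -- the trace is computed by Parseval's identity, the value on the normal being subtracted
  have par := sum_metric_mul_metric hon (metric_revolutionNormal_self (x := x) (σ := σ) hb')
    (fun i => h.metric_revolutionNormal_pushFrame hb hb' (he' i))
  simp only [Finset.sum_congr rfl fun i _ => key i]
  simp only [Finset.sum_add_distrib, Finset.sum_sub_distrib, ← Finset.mul_sum, par]
  have hK : √(1 + x b.1 ^ 2 * Real.sin (σ b.1) ^ 2) ^ 2 = _ :=
    Real.sq_sqrt (by positivity : 0 ≤ 1 + x b.1 ^ 2 * Real.sin (σ b.1) ^ 2)
  have hK0 : 0 < √(1 + x b.1 ^ 2 * Real.sin (σ b.1) ^ 2) := Real.sqrt_pos.2 (by positivity)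
  have h1 := Real.sin_sq_add_cos_sq (σ b.1)
  have hN1 : Heis.metric (b.2, 0) (revolutionNormal n x σ b) = _ :=
    (metric_horizontal_left _ _).trans (inner_revolutionNormal hb')
  have hN2 : Heis.metric (Complex.I • b.2, 0) (revolutionNormal n x σ b) = _ :=
    (metric_horizontal_left _ _).trans (inner_I_revolutionNormal hb')
  have hN3 : Heis.metric (0, 1) (revolutionNormal n x σ b) =
      (√(1 + x b.1 ^ 2 * Real.sin (σ b.1) ^ 2))⁻¹ * Real.sin (σ b.1) := by
    simp [Heis.metric, revolutionNormal]
  have f1 : Heis.metric (b.2, 0) (b.2, 0) = 1 := by simp [Heis.metric, hb']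
  have f2 : Heis.metric (b.2, 0) (Complex.I • b.2, 0) = 0 := by
    rw [metric_horizontal_left, Heis.inner_I_smul_right, Heis.symp_self]
  have f3 : Heis.metric (Complex.I • b.2, 0) (Complex.I • b.2, 0) = 1 := by
    simp [Heis.metric, hb', norm_smul]
  have f4 : Heis.metric (0, 1) (b.2, 0) = 0 := by simp [Heis.metric]
  have f5 : Heis.metric (0, 1) (Complex.I • b.2, 0) = 0 := by simp [Heis.metric]
  have f6 : Heis.metric ((0, 1) : Heis n) (0, 1) = 1 := by simp [Heis.metric]
  rw [f1, f2, f3, f4, f5, f6, hN1, hN2, hN3]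
  have hVk : tiltSin (x b.1) (σ b.1) * Real.cos (σ b.1)
      = x b.1 * Real.sin (σ b.1) * tiltCos (x b.1) (σ b.1) := by
    rw [tiltSin, tiltCos]; ring
  rw [tiltSlope, Finset.sum_const, Finset.card_univ, Fintype.card_fin, nsmul_eq_mul]
  push_cast
  generalize √(1 + x b.1 ^ 2 * Real.sin (σ b.1) ^ 2) = K at *
  generalize tiltSin (x b.1) (σ b.1) = V at *
  generalize tiltCos (x b.1) (σ b.1) = U at *
  generalize Real.sin (σ b.1) = s at *
  generalize Real.cos (σ b.1) = k at *
  generalize x b.1 = X at *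
  field_simp
  linear_combination ((2 * n * H * X - (2 * n - 1) * U) * X * K ^ 2 + X * U) * h1
    - X ^ 2 * s * hVk - X * U * hK

/-- `x` and `t` are `C²`, and `σ` is `C¹`. -/
theorem contDiffAt (h : IsSolution n H I x t σ) {s : ℝ} (hs : s ∈ I) :
    ContDiffAt ℝ 2 x s ∧ ContDiffAt ℝ 2 t s ∧ ContDiffAt ℝ 1 σ s := by
  have c1 : ∀ {f f' : ℝ → ℝ} {m : ℕ}, (∀ r ∈ I, HasDerivAt f (f' r) r) → ContDiffOn ℝ m f' I →
      ContDiffOn ℝ (m + 1) f I := by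
    intro f f' m hf hf'
    rw [contDiffOn_succ_iff_deriv_of_isOpen h.isOpen]
    exact ⟨fun r hr => (hf r hr).differentiableAt.differentiableWithinAt, by simp,
      hf'.congr fun r hr => (hf r hr).deriv⟩
  have hσ : ContDiffOn ℝ 1 σ I := by
    have := c1 (m := 0) (fun r hr => h.deriv_σ r hr) (contDiffOn_zero.2 fun r hr => ?_)
    · simpa using this
    · exact ((contDiffAt_flowField n H (p := (x r, t r, σ r)) (h.pos r hr)).continuousAt.snd.snd.comp
        (f := fun r => (x r, t r, σ r)) (h.continuousAt hr)).continuousWithinAt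
  have hx := c1 (m := 1) (fun r hr => h.deriv_x r hr) hσ.sin
  have ht := c1 (m := 1) (fun r hr => h.deriv_t r hr) hσ.cos
  have hI := h.isOpen.mem_nhds hs
  refine ⟨?_, ?_, hσ.contDiffAt hI⟩
  · simpa [one_add_one_eq_two] using hx.contDiffAt hI
  · simpa [one_add_one_eq_two] using ht.contDiffAt hI

theorem revolutionNormal_fst_ne_zero (h : IsSolution n H I x t σ)
    (hb : b ∈ revolutionDomain n I) : (revolutionNormal n x σ b).1 ≠ 0 := by
  have hb' : ‖b.2‖ = 1 := by simpa using hb.2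
  have hx := h.pos _ hb.1
  intro h0
  have h1 := inner_revolutionNormal (x := x) (σ := σ) hb'
  have h2 := inner_I_revolutionNormal (x := x) (σ := σ) hb'
  have hK0 : 0 < √(1 + x b.1 ^ 2 * Real.sin (σ b.1) ^ 2) := Real.sqrt_pos.2 (by positivity)
  rw [h0, inner_zero_right, eq_comm, neg_eq_zero, mul_eq_zero] at h1 h2
  have h1 := h1.resolve_left (inv_ne_zero hK0.ne')
  have h2 := (mul_eq_zero.1 (h2.resolve_left (inv_ne_zero hK0.ne'))).resolve_left hx.ne'
  have := Real.sin_sq_add_cos_sq (σ b.1)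
  rw [h1, h2] at this
  norm_num at this

theorem isCMCImmersion (hn : 1 ≤ n) (h : IsSolution n H I x t σ) :
    IsCMCImmersion (revolution n x t) (revolutionNormal n x σ) (revolutionDomain n I)
      (revolutionTangent n) H where
  contDiffAt b hb := by
    obtain ⟨hx, ht, -⟩ := h.contDiffAt hb.1
    exact ((hx.comp b contDiffAt_fst).smul contDiffAt_snd).prodMk (ht.comp b contDiffAt_fst)
  finrank_eq b hb := finrank_revolutionTangent hn (by simpa using hb.2)
  immersion b hb e he h0 := by
    have hb' : ‖b.2‖ = 1 := by simpa using hb.2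
    have hx := h.pos _ hb.1
    rw [h.fderiv_revolution hb.1, Prod.mk_eq_zero] at h0
    have hi := congrArg (fun z => inner ℝ b.2 z) h0.1
    simp only [inner_add_right, real_inner_smul_right, mem_revolutionTangent.1 he,
      real_inner_self_eq_norm_sq, hb', inner_zero_right] at hi
    have h1 := Real.sin_sq_add_cos_sq (σ b.1)
    have he1 : e.1 = 0 := by
      have h2 : (e.1 * Real.sin (σ b.1)) ^ 2 + (e.1 * Real.cos (σ b.1)) ^ 2 = 0 := by
        rw [h0.2]; rw [show e.1 * Real.sin (σ b.1) = 0 by linarith]; ring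
      have : e.1 ^ 2 = 0 := by linear_combination h2 - e.1 ^ 2 * h1
      exact pow_eq_zero_iff (two_ne_zero) |>.1 this
    have h2 := h0.1
    rw [he1, zero_mul, zero_smul, zero_add, smul_eq_zero] at h2
    exact Prod.ext he1 (h2.resolve_left hx.ne')
  normal_contDiffAt b hb := by
    obtain ⟨hx, -, hσ⟩ := h.contDiffAt hb.1
    have hx := (hx.of_le one_le_two).comp b contDiffAt_fst
    have hσ := hσ.comp b contDiffAt_fst
    have hK : ContDiffAt ℝ 1 (fun b : ℝ × EuclideanSpace ℂ (Fin n) =>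
        (√(1 + x b.1 ^ 2 * Real.sin (σ b.1) ^ 2))⁻¹) b :=
      ((contDiffAt_const.add ((hx.pow 2).mul (hσ.sin.pow 2))).sqrt
        (by positivity)).inv (Real.sqrt_pos.2 (by positivity)).ne'
    have ho : ∀ {f : ℝ × EuclideanSpace ℂ (Fin n) → ℝ}, ContDiffAt ℝ 1 f b →
        ContDiffAt ℝ 1 (fun b => (f b : ℂ)) b := fun hf =>
      Complex.ofRealCLM.contDiff.contDiffAt.comp b hf
    exact hK.smul ((((ho hσ.cos).add (contDiffAt_const.mul ((ho hx).mul (ho hσ.sin)))).neg.smul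
      contDiffAt_snd).prodMk hσ.sin)
  normal_unit b hb := metric_revolutionNormal_self (by simpa using hb.2)
  normal_orthogonal b hb e he := h.metric_revolutionNormal_pushFrame hb.1 (by simpa using hb.2)
    (mem_revolutionTangent.1 he)
  meanCurvature b hb _ := h.hasMeanCurvatureAt hb.1 (by simpa using hb.2)

end IsSolution

/-! ### The generated hypersurface and graphs over the axis -/

/-- The generated hypersurface is the set of the points whose distance from the axis and height
are those of a point of the generating curve, or of one of its limit points on the axis. -/
theorem mem_generatedHypersurface {n : ℕ} {I : Set ℝ} {x t : ℝ → ℝ} (hpos : ∀ s ∈ I, 0 < x s)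
    {p : Heis n} : p ∈ generatedHypersurface n I x t ↔
      (‖p.1‖, p.2) ∈ generatingCurve I x t ∨
        p.1 = 0 ∧ ((0 : ℝ), p.2) ∈ closure (generatingCurve I x t) := by
  rw [generatedHypersurface, mem_union]
  refine or_congr ?_ Iff.rfl
  constructor
  · rintro ⟨⟨s, ω⟩, ⟨hs, hω⟩, rfl⟩
    have hω' : ‖ω‖ = 1 := by simpa using hω
    refine ⟨s, hs, ?_⟩
    simp [revolution, norm_smul, hω', abs_of_pos (hpos s hs)]
  · rintro ⟨s, hs, he⟩
    have h1 : x s = ‖p.1‖ := congrArg Prod.fst he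
    have h2 : t s = p.2 := congrArg Prod.snd he
    have h0 := hpos s hs
    refine ⟨(s, (x s)⁻¹ • p.1), ⟨hs, ?_⟩, ?_⟩
    · rw [mem_sphere_zero_iff_norm, norm_smul, ← h1, norm_inv, Real.norm_of_nonneg h0.le,
        inv_mul_cancel₀ h0.ne']
    · ext1
      · simp [revolution, h0.ne']
      · simpa [revolution] using h2

/-- Away from the axis only the generating curve itself matters. -/
theorem mem_generatedHypersurface_of_ne {n : ℕ} {I : Set ℝ} {x t : ℝ → ℝ}
    (hpos : ∀ s ∈ I, 0 < x s) {p : Heis n} (hp : p.1 ≠ 0) : p ∈ generatedHypersurface n I x t ↔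
      (‖p.1‖, p.2) ∈ generatingCurve I x t := by
  rw [mem_generatedHypersurface hpos, or_iff_left fun h => hp h.1]

theorem fst_ne_zero_of_mem_generatedHypersurface {n : ℕ} {I : Set ℝ} {x t : ℝ → ℝ} {m : ℝ}
    (hm : 0 < m) (hx : ∀ s ∈ I, m ≤ x s) {p : Heis n} (hp : p ∈ generatedHypersurface n I x t) :
    p.1 ≠ 0 := by
  intro h0
  have hsub : generatingCurve I x t ⊆ {q | m ≤ q.1} := by
    rintro _ ⟨s, hs, rfl⟩; exact hx s hs
  have hcl := closure_minimal hsub (isClosed_le continuous_const continuous_fst)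
  rcases (mem_generatedHypersurface fun s hs => hm.trans_le (hx s hs)).1 hp with h | h
  · have : m ≤ ‖p.1‖ := hsub h
    rw [h0, norm_zero] at this
    linarith
  · have : m ≤ 0 := hcl h.2
    linarith

namespace IsSolution

variable {n : ℕ} {H : ℝ} {I : Set ℝ} {x t σ : ℝ → ℝ} {s : ℝ}

/-- A solution of nonzero energy stays away from the axis. -/
theorem exists_le_of_energy_ne_zero (hn : 1 ≤ n) {E : ℝ} (h : IsSolution n H I x t σ)
    (hE : ∀ s ∈ I, energy n H (x s) (σ s) = E) (hE0 : E ≠ 0) :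
    ∃ m, 0 < m ∧ m ≤ 1 ∧ ∀ s ∈ I, m ≤ x s := by
  refine ⟨min 1 (|E| / (1 + |H|)), by positivity, min_le_left _ _, fun s hs => ?_⟩
  have hx := h.pos s hs
  rcases le_or_gt 1 (x s) with h1 | h1
  · exact (min_le_left _ _).trans h1
  refine (min_le_right _ _).trans ?_
  rw [div_le_iff₀ (by positivity), ← hE s hs, energy_eq_tiltCos]
  have hU : |tiltCos (x s) (σ s)| ≤ 1 := abs_le.2 ⟨neg_one_le_tiltCos hx _, tiltCos_le_one hx _⟩
  have p1 : x s ^ (2 * n - 1) ≤ x s := pow_le_of_le_one hx.le h1.le (by omega)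
  have p2 : x s ^ (2 * n) ≤ x s := pow_le_of_le_one hx.le h1.le (by omega)
  calc _ ≤ |x s ^ (2 * n - 1) * tiltCos (x s) (σ s)| + |H * x s ^ (2 * n)| := abs_sub _ _
    _ = x s ^ (2 * n - 1) * |tiltCos (x s) (σ s)| + |H| * x s ^ (2 * n) := by
        rw [abs_mul, abs_mul, abs_of_pos (pow_pos hx _), abs_of_pos (pow_pos hx (2 * n))]
    _ ≤ x s * 1 + |H| * x s := by gcongr
    _ = _ := by ring

theorem strictMonoOn_t (h : IsSolution n H I x t σ) {D : Set ℝ} (hDI : D ⊆ I) (hD : Convex ℝ D)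
    (hc : ∀ s ∈ interior D, 0 < Real.cos (σ s)) : StrictMonoOn t D :=
  strictMonoOn_of_deriv_pos hD
    (fun s hs => (h.deriv_t s (hDI hs)).continuousAt.continuousWithinAt)
    fun s hs => by rw [(h.deriv_t s (hDI (interior_subset hs))).deriv]; exact hc s hs

theorem strictAntiOn_t (h : IsSolution n H I x t σ) {D : Set ℝ} (hDI : D ⊆ I) (hD : Convex ℝ D)
    (hc : ∀ s ∈ interior D, Real.cos (σ s) < 0) : StrictAntiOn t D :=
  strictAntiOn_of_deriv_neg hD
    (fun s hs => (h.deriv_t s (hDI hs)).continuousAt.continuousWithinAt)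
    fun s hs => by rw [(h.deriv_t s (hDI (interior_subset hs))).deriv]; exact hc s hs

theorem cos_pos_or_neg (h : IsSolution n H I x t σ) (hc : ∀ s ∈ I, Real.cos (σ s) ≠ 0) :
    (∀ s ∈ I, 0 < Real.cos (σ s)) ∨ ∀ s ∈ I, Real.cos (σ s) < 0 := by
  have hcont : ContinuousOn (fun s => Real.cos (σ s)) I := fun s hs =>
    (h.deriv_σ s hs).cos.continuousAt.continuousWithinAt
  by_contra! hcon
  obtain ⟨⟨a, ha, ha'⟩, b, hb, hb'⟩ := hcon
  obtain ⟨r, hr, hr'⟩ := h.convex.isPreconnected.intermediate_value ha hb hcont ⟨ha', hb'⟩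
  exact hc r hr hr'

theorem injOn_t (h : IsSolution n H I x t σ) (hc : ∀ s ∈ I, Real.cos (σ s) ≠ 0) : InjOn t I := by
  rcases h.cos_pos_or_neg hc with h1 | h1
  · exact (h.strictMonoOn_t le_rfl h.convex fun s hs => h1 s (interior_subset hs)).injOn
  · exact (h.strictAntiOn_t le_rfl h.convex fun s hs => h1 s (interior_subset hs)).injOn

end IsSolution

/-- The function `f` with `x(s) = f(t(s))`, for a curve on which `t` is injective. -/
noncomputable def graphFun (I : Set ℝ) (x t : ℝ → ℝ) (τ : ℝ) : ℝ := x (Function.invFunOn t I τ)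

theorem graphFun_apply {I : Set ℝ} {x t : ℝ → ℝ} (ht : InjOn t I) {s : ℝ} (hs : s ∈ I) :
    graphFun I x t (t s) = x s := by
  rw [graphFun, ht.leftInvOn_invFunOn hs]

theorem generatingCurve_eq_graphOver {I : Set ℝ} {x t : ℝ → ℝ} (ht : InjOn t I) :
    generatingCurve I x t = graphOver (t '' I) (graphFun I x t) := by
  rw [generatingCurve, graphOver, image_image]
  exact image_congr fun s hs => by rw [graphFun_apply ht hs]

namespace IsSolution

variable {n : ℕ} {H : ℝ} {I : Set ℝ} {x t σ : ℝ → ℝ} {s : ℝ}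

theorem hasStrictDerivAt_t (h : IsSolution n H I x t σ) (hs : s ∈ I) :
    HasStrictDerivAt t (Real.cos (σ s)) s :=
  (h.contDiffAt hs).2.1.hasStrictDerivAt' (h.deriv_t s hs) two_ne_zero

theorem hasDerivAt_invFunOn (h : IsSolution n H I x t σ) (hc : ∀ s ∈ I, Real.cos (σ s) ≠ 0)
    (hs : s ∈ I) : HasDerivAt (Function.invFunOn t I) (Real.cos (σ s))⁻¹ (t s) := by
  refine ((h.hasStrictDerivAt_t hs).to_local_left_inverse (hc s hs) ?_).hasDerivAt
  filter_upwards [h.isOpen.mem_nhds hs] with r hr using (h.injOn_t hc).leftInvOn_invFunOn hr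

theorem hasDerivAt_graphFun (h : IsSolution n H I x t σ) (hc : ∀ s ∈ I, Real.cos (σ s) ≠ 0)
    (hs : s ∈ I) : HasDerivAt (graphFun I x t) (Real.tan (σ s)) (t s) := by
  have hi := (h.injOn_t hc).leftInvOn_invFunOn hs
  have := (by rw [hi]; exact h.deriv_x s hs :
    HasDerivAt x (Real.sin (σ s)) (Function.invFunOn t I (t s))).comp (t s)
    (h.hasDerivAt_invFunOn hc hs)
  rw [Real.tan_eq_sin_div_cos, div_eq_mul_inv]
  exact this

theorem isOpen_image_t (h : IsSolution n H I x t σ) (hc : ∀ s ∈ I, Real.cos (σ s) ≠ 0) :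
    IsOpen (t '' I) := by
  rw [isOpen_iff_mem_nhds]
  rintro _ ⟨s, hs, rfl⟩
  rw [← (h.hasStrictDerivAt_t hs).map_nhds_eq (hc s hs)]
  exact image_mem_map (h.isOpen.mem_nhds hs)

theorem contDiffOn_graphFun (h : IsSolution n H I x t σ) (hc : ∀ s ∈ I, Real.cos (σ s) ≠ 0) :
    ContDiffOn ℝ 2 (graphFun I x t) (t '' I) := by
  have hJ := h.isOpen_image_t hc
  have hi := (h.injOn_t hc).leftInvOn_invFunOn
  have hg : ContDiffOn ℝ 1 (Function.invFunOn t I) (t '' I) := by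
    rw [← zero_add (1 : WithTop ℕ∞), contDiffOn_succ_iff_deriv_of_isOpen hJ]
    refine ⟨?_, by simp, contDiffOn_zero.2 ?_⟩
    · rintro _ ⟨s, hs, rfl⟩
      exact (h.hasDerivAt_invFunOn hc hs).differentiableAt.differentiableWithinAt
    · have hcont : ContinuousOn (fun τ => (Real.cos (σ (Function.invFunOn t I τ)))⁻¹) (t '' I) := by
        rintro _ ⟨s, hs, rfl⟩
        refine ContinuousAt.continuousWithinAt (ContinuousAt.inv₀ ?_ (by rw [hi hs]; exact hc s hs))
        refine Real.continuous_cos.continuousAt.comp (ContinuousAt.comp ?_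
          (h.hasDerivAt_invFunOn hc hs).continuousAt)
        rw [hi hs]; exact (h.deriv_σ s hs).continuousAt
      refine hcont.congr ?_
      rintro _ ⟨s, hs, rfl⟩
      simp only [(h.hasDerivAt_invFunOn hc hs).deriv, hi hs]
  have h2 : (2 : WithTop ℕ∞) = 1 + 1 := one_add_one_eq_two.symm
  rw [h2, contDiffOn_succ_iff_deriv_of_isOpen hJ]
  refine ⟨?_, by simp, ?_⟩
  · rintro _ ⟨s, hs, rfl⟩
    exact (h.hasDerivAt_graphFun hc hs).differentiableAt.differentiableWithinAt
  · have hσ : ContDiffOn ℝ 1 (fun τ => σ (Function.invFunOn t I τ)) (t '' I) := by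
      refine ContDiffOn.comp (t := I) (fun s hs => (h.contDiffAt hs).2.2.contDiffWithinAt) hg ?_
      rintro _ ⟨s, hs, rfl⟩
      rw [hi hs]; exact hs
    refine (hσ.sin.div hσ.cos ?_).congr ?_
    · rintro _ ⟨s, hs, rfl⟩
      rw [hi hs]; exact hc s hs
    · rintro _ ⟨s, hs, rfl⟩
      simp only [(h.hasDerivAt_graphFun hc hs).deriv, hi hs, Real.tan_eq_sin_div_cos, Pi.div_apply]

/-- Off the axis, a graph `x = f(t)` generates an embedded hypersurface, with defining function
`|z|² - f(t)²`. -/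
theorem exists_isDefiningFunction (h : IsSolution n H I x t σ) (hc : ∀ s ∈ I, Real.cos (σ s) ≠ 0)
    {p : Heis n} (hp : p ∈ generatedHypersurface n I x t) (hp0 : p.1 ≠ 0) :
    ∃ U u, p ∈ U ∧ IsDefiningFunction (generatedHypersurface n I x t) U u := by
  have hJ := h.isOpen_image_t hc
  have hf := h.contDiffOn_graphFun hc
  have hinj := h.injOn_t hc
  set f := graphFun I x t with hfdef
  have hU : IsOpen {q : Heis n | q.2 ∈ t '' I ∧ q.1 ≠ 0} :=
    (hJ.preimage continuous_snd).inter (isOpen_ne.preimage continuous_fst)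
  have hmem : ∀ {q : Heis n}, q.1 ≠ 0 → (q ∈ generatedHypersurface n I x t ↔
      q.2 ∈ t '' I ∧ ‖q.1‖ = f q.2) := by
    intro q hq
    rw [mem_generatedHypersurface_of_ne h.pos hq, generatingCurve_eq_graphOver hinj]
    constructor
    · rintro ⟨τ, hτ, he⟩
      have h1 : f τ = ‖q.1‖ := congrArg Prod.fst he
      have h2 : τ = q.2 := congrArg Prod.snd he
      subst h2
      exact ⟨hτ, h1.symm⟩
    · rintro ⟨hτ, he⟩
      exact ⟨q.2, hτ, by rw [he]⟩
  have hcd : ContDiffOn ℝ 2 (fun q : Heis n => ‖q.1‖ ^ 2 - f q.2 ^ 2)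
      {q : Heis n | q.2 ∈ t '' I ∧ q.1 ≠ 0} :=
    (contDiff_fst.norm_sq ℝ).contDiffOn.sub
      ((hf.comp contDiff_snd.contDiffOn fun q hq => hq.1).pow 2)
  refine ⟨{q | q.2 ∈ t '' I ∧ q.1 ≠ 0}, fun q => ‖q.1‖ ^ 2 - f q.2 ^ 2,
    ⟨((hmem hp0).1 hp).1, hp0⟩, hU, hcd, ?_, ?_⟩
  · intro q hq h0
    have hd := ((hcd.contDiffAt (hU.mem_nhds hq)).differentiableAt two_ne_zero).hasFDerivAt
    rw [h0] at hd
    -- the radial derivative is `2 |z|² ≠ 0`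
    have hl : HasDerivAt (fun a : ℝ => ((a • q.1, q.2) : Heis n)) (q.1, 0) 1 := by
      simpa using ((hasDerivAt_id (1 : ℝ)).smul_const q.1).prodMk (hasDerivAt_const (1 : ℝ) q.2)
    have h1 := HasFDerivAt.comp_hasDerivAt (1 : ℝ) (by simpa using hd) hl
    have h2 : HasDerivAt (fun a : ℝ => a ^ 2 * ‖q.1‖ ^ 2 - f q.2 ^ 2) (2 * ‖q.1‖ ^ 2) 1 := by
      simpa using (((hasDerivAt_id (1 : ℝ)).pow 2).mul_const (‖q.1‖ ^ 2)).sub_const (f q.2 ^ 2)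
    have h3 := h1.unique (h2.congr_of_eventuallyEq (Eventually.of_forall fun a => by
      simp [norm_smul, mul_pow]))
    have := norm_pos_iff.2 hq.2
    simp at h3
    exact hq.2 h3
  · ext q
    constructor
    · rintro ⟨hq, hq'⟩
      refine ⟨hq', ?_⟩
      rw [((hmem hq'.2).1 hq).2, sub_self]
    · rintro ⟨hq', he⟩
      refine ⟨(hmem hq'.2).2 ⟨hq'.1, ?_⟩, hq'⟩
      obtain ⟨s, hs, hs'⟩ := hq'.1
      have hfpos : 0 < f q.2 := by
        rw [← hs', hfdef, graphFun_apply hinj hs]; exact h.pos s hs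
      exact (pow_left_inj₀ (norm_nonneg _) hfpos.le two_ne_zero).1 (sub_eq_zero.1 he)

theorem isEmbeddedHypersurface (h : IsSolution n H I x t σ) (hc : ∀ s ∈ I, Real.cos (σ s) ≠ 0)
    {m : ℝ} (hm : 0 < m) (hx : ∀ s ∈ I, m ≤ x s) :
    IsEmbeddedHypersurface (generatedHypersurface n I x t) := fun _ hp =>
  h.exists_isDefiningFunction hc hp (fst_ne_zero_of_mem_generatedHypersurface hm hx hp)

end IsSolution

/-! ### Hyperplanes -/

/-- The function `t - g(z)` defines the graph `t = g(z)`; on tangent vectors without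
`t`-component its differential is that of `-g`. -/
theorem isDefiningFunction_sub {n : ℕ} {S U : Set (Heis n)} {g : EuclideanSpace ℂ (Fin n) → ℝ}
    (hU : IsOpen U) (hg : ContDiffOn ℝ 2 g {z | ∃ τ, (z, τ) ∈ U})
    (hS : S ∩ U = {p ∈ U | p.2 = g p.1}) :
    IsDefiningFunction S U (fun p => p.2 - g p.1) ∧ ∀ p ∈ U, ∀ v : Heis n, v.2 = 0 →
      fderiv ℝ (fun p : Heis n => p.2 - g p.1) p v = - fderiv ℝ g p.1 v.1 := by
  have hV : IsOpen {z | ∃ τ, (z, τ) ∈ U} := by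
    have := isOpenMap_fst (X := EuclideanSpace ℂ (Fin n)) (Y := ℝ) U hU
    convert this using 1
    ext z; simp
  have hm : ∀ p ∈ U, p.1 ∈ {z | ∃ τ, (z, τ) ∈ U} := fun p hp => ⟨p.2, hp⟩
  have hd : ∀ p ∈ U, fderiv ℝ (fun p : Heis n => p.2 - g p.1) p
      = ContinuousLinearMap.snd ℝ _ ℝ
        - (fderiv ℝ g p.1).comp (ContinuousLinearMap.fst ℝ _ ℝ) := by
    intro p hp
    have h1 := ((hg.contDiffAt (hV.mem_nhds (hm p hp))).differentiableAt two_ne_zero).hasFDerivAt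
    exact (hasFDerivAt_snd.sub (h1.comp p hasFDerivAt_fst)).fderiv
  refine ⟨⟨hU, contDiff_snd.contDiffOn.sub (hg.comp contDiff_fst.contDiffOn hm), ?_, ?_⟩, ?_⟩
  · intro p hp h0
    have := congrArg (fun L => L ((0 : EuclideanSpace ℂ (Fin n)), (1 : ℝ))) ((hd p hp).symm.trans h0)
    simp at this
  · rw [hS]
    ext p
    exact and_congr_right fun _ => sub_eq_zero.symm
  · intro p hp v hv
    rw [hd p hp]
    simp [hv]

/-- Near a critical point `z = 0` of `g`, the graph `t = g(z)` has a singular point on the axis. -/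
theorem isSingularPoint_of_graph {n : ℕ} {S U : Set (Heis n)} {g : EuclideanSpace ℂ (Fin n) → ℝ}
    (hU : IsOpen U) (hg : ContDiffOn ℝ 2 g {z | ∃ τ, (z, τ) ∈ U})
    (hS : S ∩ U = {p ∈ U | p.2 = g p.1}) {τ : ℝ} (hτ : ((0, τ) : Heis n) ∈ U)
    (hτS : ((0, τ) : Heis n) ∈ S) (h0 : fderiv ℝ g 0 = 0) : IsSingularPoint S (0, τ) := by
  obtain ⟨h1, h2⟩ := isDefiningFunction_sub hU hg hS
  refine ⟨hτS, U, _, hτ, h1, fun v hv => ?_⟩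
  rw [h2 _ hτ v ?_, h0]
  · simp
  · simpa [Heis.IsHorizontal, Heis.toFrame, Heis.symp] using hv

namespace IsCompleteSolution

variable {n : ℕ} {H : ℝ} {I : Set ℝ} {x t σ : ℝ → ℝ}

theorem generatingCurve_of_energy_zero (hn : 1 ≤ n) (h : IsCompleteSolution n 0 I x t σ)
    (hE : ∀ s ∈ I, energy n 0 (x s) (σ s) = 0) :
    ∃ t₀ : ℝ, generatingCurve I x t = {q | 0 < q.1 ∧ q.2 = t₀} := by
  have hcos : ∀ s ∈ I, Real.cos (σ s) = 0 := fun s hs => by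
    have := tiltCos_eq_of_energy hn (h.pos s hs) (hE s hs)
    rw [cos_eq_tiltCos_mul (h.pos s hs), this]; simp
  obtain ⟨s₀, hs₀⟩ := h.nonempty
  have hσ : ∀ s ∈ I, σ s = σ s₀ := fun s hs =>
    h.isOpen.is_const_of_deriv_eq_zero h.convex.isPreconnected
      (fun r hr => (h.deriv_σ r hr).differentiableAt.differentiableWithinAt)
      (fun r hr => by rw [(h.deriv_σ r hr).deriv, hcos r hr]; simp) hs hs₀
  have ht : ∀ s ∈ I, t s = t s₀ := fun s hs =>
    h.isOpen.is_const_of_deriv_eq_zero h.convex.isPreconnected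
      (fun r hr => (h.deriv_t r hr).differentiableAt.differentiableWithinAt)
      (fun r hr => by rw [(h.deriv_t r hr).deriv, hcos r hr]; simp) hs hs₀
  set ε := Real.sin (σ s₀) with hε
  have hε2 : ε * ε = 1 := by
    have := Real.sin_sq_add_cos_sq (σ s₀)
    rw [hcos s₀ hs₀] at this
    linarith
  -- the line with the same initial values is a solution as long as it stays in `{x > 0}`
  set I' : Set ℝ := {s | 0 < x s₀ + ε * (s - s₀)} with hI'
  have hd : ∀ s, HasDerivAt (fun s => x s₀ + ε * (s - s₀)) ε s := fun s => by
    simpa using (((hasDerivAt_id s).sub_const s₀).const_mul ε).const_add (x s₀)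
  have hx : ∀ s ∈ I, x s = x s₀ + ε * (s - s₀) := fun s hs => by
    have := h.isOpen.is_const_of_deriv_eq_zero h.convex.isPreconnected
      (f := fun s => x s - (x s₀ + ε * (s - s₀)))
      (fun r hr => ((h.deriv_x r hr).sub (hd r)).differentiableAt.differentiableWithinAt)
      (fun r hr => by
        rw [((h.deriv_x r hr).fun_sub (hd r)).deriv, hσ r hr, sub_self]; simp) hs hs₀
    simp at this
    linarith
  have hsol : IsSolution n 0 I' (fun s => x s₀ + ε * (s - s₀)) (fun _ => t s₀)
      (fun _ => σ s₀) := by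
    refine ⟨isOpen_lt continuous_const (by fun_prop), ?_, ⟨s₀, by simpa [hI'] using h.pos s₀ hs₀⟩,
      fun s hs => hs, fun s _ => hd s, fun s _ => ?_, fun s _ => ?_⟩
    · refine ⟨fun a ha b hb c hc => ?_⟩
      have ha : 0 < x s₀ + ε * (a - s₀) := ha
      have hb : 0 < x s₀ + ε * (b - s₀) := hb
      change 0 < x s₀ + ε * (c - s₀)
      rcases le_total 0 ε with h0 | h0 <;> nlinarith [hc.1, hc.2]
    · rw [hcos s₀ hs₀]; exact hasDerivAt_const _ _
    · rw [hcos s₀ hs₀]; simpa using hasDerivAt_const s (σ s₀)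
  have hII : I' = I := h.maximal I' _ _ _ hsol (fun s hs => by
      change 0 < x s₀ + ε * (s - s₀); rw [← hx s hs]; exact h.pos s hs)
    (fun s hs => (hx s hs).symm) (fun s hs => (ht s hs).symm) (fun s hs => (hσ s hs).symm)
  refine ⟨t s₀, ?_⟩
  ext ⟨a, b⟩
  constructor
  · rintro ⟨s, hs, he⟩
    rw [← he]
    exact ⟨h.pos s hs, ht s hs⟩
  · rintro ⟨ha, hb⟩
    have ha : 0 < a := ha
    have hb : b = t s₀ := hb
    have hm : x s₀ + ε * (s₀ + ε * (a - x s₀) - s₀) = a := by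
      linear_combination (a - x s₀) * hε2
    have hI : s₀ + ε * (a - x s₀) ∈ I := by
      rw [← hII]; change 0 < x s₀ + ε * (s₀ + ε * (a - x s₀) - s₀); rw [hm]; exact ha
    refine ⟨_, hI, ?_⟩
    simp only [hx _ hI, hm, ht _ hI, hb]

theorem generatedHypersurface_of_energy_zero (hn : 1 ≤ n) (h : IsCompleteSolution n 0 I x t σ)
    (hE : ∀ s ∈ I, energy n 0 (x s) (σ s) = 0) :
    ∃ t₀ : ℝ, generatingCurve I x t = {q | 0 < q.1 ∧ q.2 = t₀} ∧
      generatedHypersurface n I x t = {p | p.2 = t₀} := by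
  obtain ⟨t₀, hC⟩ := h.generatingCurve_of_energy_zero hn hE
  refine ⟨t₀, hC, ?_⟩
  ext p
  rw [mem_generatedHypersurface h.pos, hC]
  have hset : {q : ℝ × ℝ | 0 < q.1 ∧ q.2 = t₀} = Ioi 0 ×ˢ {t₀} := rfl
  rw [hset, closure_prod_eq, closure_Ioi, closure_singleton]
  simp only [mem_prod, mem_Ioi, norm_pos_iff, mem_singleton_iff, mem_Ici, le_refl, true_and,
    ← or_and_right]
  exact and_iff_right (ne_or_eq _ _)

end IsCompleteSolution

theorem isSingularPoint_hyperplane (n : ℕ) (τ : ℝ) :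
    IsSingularPoint {p : Heis n | p.2 = τ} (0, τ) :=
  isSingularPoint_of_graph (U := univ) (g := fun _ => τ) isOpen_univ contDiffOn_const
    (by ext p; simp) trivial rfl (by simp)

/-! ### Spheres -/

/-- The height profile of the spheres `S_h`: a point of `S_h` at distance `√(1 - a²) / h` from the
axis, `-1 ≤ a ≤ 1`, has height `Ψ(a) / h²`. -/
noncomputable def sphereProfile (a : ℝ) : ℝ := (Real.arcsin a + a * √(1 - a ^ 2)) / 2

theorem hasDerivAt_sphereProfile {a : ℝ} (ha : a ∈ Ioo (-1 : ℝ) 1) :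
    HasDerivAt sphereProfile √(1 - a ^ 2) a := by
  have h0 : 0 < 1 - a ^ 2 := by nlinarith [ha.1, ha.2]
  have hs : 0 < √(1 - a ^ 2) := Real.sqrt_pos.2 h0
  have h1 := Real.hasDerivAt_arcsin ha.1.ne' ha.2.ne
  have h2 : HasDerivAt (fun a : ℝ => √(1 - a ^ 2)) _ a :=
    (((hasDerivAt_id a).pow 2).const_sub 1).sqrt h0.ne'
  refine ((h1.add ((hasDerivAt_id a).mul h2)).div_const 2).congr_deriv ?_
  have hsq : √(1 - a ^ 2) ^ 2 = 1 - a ^ 2 := Real.sq_sqrt h0.le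
  simp
  field_simp
  rw [hsq]
  ring

theorem continuous_sphereProfile : Continuous sphereProfile := by
  unfold sphereProfile
  have := Real.continuous_arcsin
  fun_prop

theorem sphereProfile_neg (a : ℝ) : sphereProfile (-a) = -sphereProfile a := by
  rw [sphereProfile, sphereProfile, Real.arcsin_neg, neg_sq]; ring

theorem strictMonoOn_sphereProfile : StrictMonoOn sphereProfile (Icc (-1) 1) := by
  refine strictMonoOn_of_deriv_pos (convex_Icc _ _) continuous_sphereProfile.continuousOn ?_
  intro a ha
  rw [interior_Icc] at ha
  rw [(hasDerivAt_sphereProfile ha).deriv]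
  exact Real.sqrt_pos.2 (by nlinarith [ha.1, ha.2])

theorem abs_sphereProfile {a : ℝ} (ha : a ∈ Icc (-1 : ℝ) 1) :
    |sphereProfile a| = (|a| * √(1 - a ^ 2) + Real.arccos √(1 - a ^ 2)) / 2 := by
  have h0 : sphereProfile 0 = 0 := by simp [sphereProfile]
  rcases le_total 0 a with h | h
  · have : 0 ≤ sphereProfile a := by
      rw [← h0]; exact strictMonoOn_sphereProfile.monotoneOn (by simp) ha h
    rw [abs_of_nonneg this, abs_of_nonneg h, ← Real.arcsin_eq_arccos h, sphereProfile]
    ring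
  · have : sphereProfile a ≤ 0 := by
      rw [← h0]; exact strictMonoOn_sphereProfile.monotoneOn ha (by simp) h
    have h' : 0 ≤ -a := by linarith
    rw [abs_of_nonpos this, abs_of_nonpos h, ← neg_sq a, ← Real.arcsin_eq_arccos h',
      ← sphereProfile_neg, sphereProfile]
    ring

/-- Parametrization of a half meridian of `S_h`. -/
noncomputable def sphereMeridian (h a : ℝ) : ℝ × ℝ := (√(1 - a ^ 2) / h, sphereProfile a / h ^ 2)

theorem continuous_sphereMeridian (h : ℝ) : Continuous (sphereMeridian h) := by
  unfold sphereMeridian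
  have := continuous_sphereProfile
  fun_prop

theorem mem_sphereS_iff {n : ℕ} {h : ℝ} (hh : 0 < h) {p : Heis n} :
    p ∈ sphereS n h ↔ (‖p.1‖, p.2) ∈ sphereMeridian h '' Icc (-1) 1 := by
  constructor
  · rintro ⟨h1, h2⟩
    have hr : h * ‖p.1‖ ≤ 1 := by rwa [le_div_iff₀ hh, mul_comm] at h1
    have hr0 : 0 ≤ h * ‖p.1‖ := by positivity
    have hnn : 0 ≤ 1 - (h * ‖p.1‖) ^ 2 := by nlinarith
    -- the parameter is `√(1 - h²|z|²)`, with the sign of the height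
    obtain ⟨a, ha, hat⟩ : ∃ a, |a| = √(1 - (h * ‖p.1‖) ^ 2) ∧
        sphereProfile a * p.2 = |sphereProfile a| * |p.2| := by
      have h0 : 0 ≤ √(1 - (h * ‖p.1‖) ^ 2) := Real.sqrt_nonneg _
      have hP : 0 ≤ sphereProfile √(1 - (h * ‖p.1‖) ^ 2) := by
        rw [sphereProfile]
        have := Real.arcsin_nonneg.2 h0
        positivity
      rcases le_total 0 p.2 with hp | hp
      · exact ⟨_, abs_of_nonneg h0, by rw [abs_of_nonneg hP, abs_of_nonneg hp]⟩
      · refine ⟨-√(1 - (h * ‖p.1‖) ^ 2), by rw [abs_neg, abs_of_nonneg h0], ?_⟩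
        rw [sphereProfile_neg, abs_neg, abs_of_nonneg hP, abs_of_nonpos hp]; ring
    have ha2 : 1 - a ^ 2 = (h * ‖p.1‖) ^ 2 := by
      rw [← sq_abs, ha, Real.sq_sqrt hnn]; ring
    have hamem : a ∈ Icc (-1 : ℝ) 1 := by
      exact abs_le.1 (abs_le_one_iff_mul_self_le_one.2 (by nlinarith))
    have hsq : √(1 - a ^ 2) = h * ‖p.1‖ := by rw [ha2, Real.sqrt_sq hr0]
    have habs : |p.2| = |sphereProfile a| / h ^ 2 := by
      rw [abs_sphereProfile hamem, hsq, h2, ha, mul_pow]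
      field_simp
    have hval : p.2 = sphereProfile a / h ^ 2 := by
      rw [eq_div_iff (by positivity)]
      rw [habs] at hat
      have h3 : |p.2| * h ^ 2 = |sphereProfile a| := by rw [habs]; field_simp
      rcases eq_or_ne (sphereProfile a) 0 with h0 | h0
      · rw [h0, abs_zero] at h3
        rw [h0]
        rcases mul_eq_zero.1 h3 with h4 | h4
        · rw [abs_eq_zero.1 h4, zero_mul]
        · rw [h4, mul_zero]
      · refine mul_left_cancel₀ h0 ?_
        rw [← mul_assoc, hat, mul_div_assoc', div_mul_cancel₀ _ (by positivity), abs_mul_abs_self]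
    refine ⟨a, hamem, ?_⟩
    rw [sphereMeridian, hsq, ← hval, mul_div_cancel_left₀ _ hh.ne']
  · rintro ⟨a, ha, he⟩
    have h1 : √(1 - a ^ 2) / h = ‖p.1‖ := congrArg Prod.fst he
    have h2 : sphereProfile a / h ^ 2 = p.2 := congrArg Prod.snd he
    have h3 : h * ‖p.1‖ = √(1 - a ^ 2) := by rw [← h1, mul_div_cancel₀ _ hh.ne']
    have hnn : 0 ≤ 1 - a ^ 2 := by nlinarith [ha.1, ha.2]
    refine ⟨?_, ?_⟩
    · rw [← h1]
      gcongr
      exact Real.sqrt_le_one.2 (by nlinarith)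
    · rw [← mul_pow, h3, ← h2, abs_div, abs_of_pos (by positivity : 0 < h ^ 2),
        abs_sphereProfile ha, Real.sq_sqrt hnn, show 1 - (1 - a ^ 2) = a ^ 2 by ring,
        Real.sqrt_sq_eq_abs]
      field_simp

theorem mul_zero_left {n : ℕ} (t₀ : ℝ) (p : Heis n) : Heis.mul (0, t₀) p = (p.1, t₀ + p.2) := by
  simp [Heis.mul, Heis.symp]

/-- A translate of `S_h` is a continuous injective image of the unit sphere of `ℂⁿ × ℝ`. -/
theorem nonempty_homeomorph_sphereS (n : ℕ) {h : ℝ} (hh : 0 < h) (t₀ : ℝ) :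
    Nonempty (↥(Heis.mul (0, t₀) '' sphereS n h) ≃ₜ
        Metric.sphere (0 : EuclideanSpace ℝ (Fin (2 * n + 1))) 1) := by
  let V := WithLp 2 (EuclideanSpace ℂ (Fin n) × ℝ)
  have hnorm : ∀ v : V, ‖v‖ = 1 → ‖v.fst‖ ^ 2 + v.snd ^ 2 = 1 := fun v hv => by
    have := WithLp.prod_norm_sq_eq_of_L2 v
    rw [hv, Real.norm_eq_abs, sq_abs] at this
    linarith
  let F : V → Heis n := fun v => (h⁻¹ • v.fst, t₀ + sphereProfile v.snd / h ^ 2)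
  have hF : Continuous F := by
    have := continuous_sphereProfile
    have h1 : Continuous fun v : V => v.fst := by fun_prop
    have h2 : Continuous fun v : V => v.snd := by fun_prop
    fun_prop
  have hmem1 : ∀ v : V, ‖v‖ = 1 → v.snd ∈ Icc (-1 : ℝ) 1 := fun v hv => by
    exact abs_le.1 (abs_le_one_iff_mul_self_le_one.2 (by nlinarith [hnorm v hv, sq_nonneg ‖v.fst‖]))
  have hmem : ∀ v : V, ‖v‖ = 1 → F v ∈ Heis.mul (0, t₀) '' sphereS n h := fun v hv => by
    refine ⟨(h⁻¹ • v.fst, sphereProfile v.snd / h ^ 2), ?_, by rw [mul_zero_left]⟩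
    rw [mem_sphereS_iff hh]
    refine ⟨v.snd, hmem1 v hv, ?_⟩
    rw [sphereMeridian, ← hnorm v hv, add_sub_cancel_right, Real.sqrt_sq (norm_nonneg _), norm_smul,
      norm_inv, Real.norm_of_nonneg hh.le, div_eq_inv_mul]
  let f : Metric.sphere (0 : V) 1 → ↥(Heis.mul (0, t₀) '' sphereS n h) :=
    fun v => ⟨F v, hmem v (by simp)⟩
  have hf : Continuous f := (hF.comp continuous_subtype_val).subtype_mk _
  have hbij : Function.Bijective f := by
    constructor
    · rintro ⟨v, hv⟩ ⟨w, hw⟩ he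
      have he : F v = F w := congrArg Subtype.val he
      have e1 : h⁻¹ • v.fst = h⁻¹ • w.fst := congrArg Prod.fst he
      have e2 : t₀ + sphereProfile v.snd / h ^ 2 = t₀ + sphereProfile w.snd / h ^ 2 :=
        congrArg Prod.snd he
      have e1 := (smul_right_injective _ (inv_ne_zero hh.ne')) e1
      have e2 := strictMonoOn_sphereProfile.injOn (hmem1 v (by simpa using hv))
        (hmem1 w (by simpa using hw)) ((div_left_inj' (by positivity)).1 (add_left_cancel e2))
      exact Subtype.ext (WithLp.ofLp_injective 2 (Prod.ext e1 e2))
    · rintro ⟨_, ⟨p, hp, rfl⟩⟩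
      obtain ⟨a, ha, he⟩ := (mem_sphereS_iff hh).1 hp
      have h1 : √(1 - a ^ 2) / h = ‖p.1‖ := congrArg Prod.fst he
      have h2 : sphereProfile a / h ^ 2 = p.2 := congrArg Prod.snd he
      have hnn : 0 ≤ 1 - a ^ 2 := by nlinarith [ha.1, ha.2]
      refine ⟨⟨WithLp.toLp 2 (h • p.1, a), ?_⟩, ?_⟩
      · rw [mem_sphere_zero_iff_norm, ← sq_eq_sq₀ (norm_nonneg _) zero_le_one,
          WithLp.prod_norm_sq_eq_of_L2]
        change ‖h • p.1‖ ^ 2 + ‖a‖ ^ 2 = 1 ^ 2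
        rw [norm_smul, Real.norm_of_nonneg hh.le, ← h1, mul_div_cancel₀ _ hh.ne',
          Real.sq_sqrt hnn, Real.norm_eq_abs, sq_abs]
        ring
      · refine Subtype.ext ?_
        change (h⁻¹ • h • p.1, t₀ + sphereProfile a / h ^ 2) = Heis.mul (0, t₀) p
        rw [mul_zero_left, h2, smul_smul, inv_mul_cancel₀ hh.ne', one_smul]
  let e₁ : Metric.sphere (0 : V) 1 ≃ₜ ↥(Heis.mul (0, t₀) '' sphereS n h) :=
    Continuous.homeoOfEquivCompactToT2 (f := Equiv.ofBijective f hbij) hf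
  let L : V ≃ₗᵢ[ℝ] EuclideanSpace ℝ (Fin (2 * n + 1)) :=
    (stdOrthonormalBasis ℝ V).repr.trans
      (LinearIsometryEquiv.piLpCongrLeft 2 ℝ ℝ (finCongr (finrank_withLp_heis n)))
  let e₂ : Metric.sphere (0 : V) 1 ≃ₜ
      Metric.sphere (0 : EuclideanSpace ℝ (Fin (2 * n + 1))) 1 :=
    L.toHomeomorph.subtype fun v => by simp [L.norm_map]
  exact ⟨e₁.symm.trans e₂⟩

/-- The differential `‖z‖ id + ⟨z, ·⟩ z / ‖z‖` of `z ↦ ‖z‖ z` has norm at most `2 ‖z‖`, and so is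
continuous at the origin as well. -/
theorem contDiff_norm_smul_self {V : Type*} [NormedAddCommGroup V] [InnerProductSpace ℝ V] :
    ContDiff ℝ 1 (fun z : V => ‖z‖ • z) := by
  have hd : ∀ z : V, HasFDerivAt (fun z : V => ‖z‖ • z)
      (‖z‖ • ContinuousLinearMap.id ℝ V + (‖z‖⁻¹ • innerSL ℝ z).smulRight z) z := by
    intro z
    rcases eq_or_ne z 0 with rfl | hz
    · rw [hasFDerivAt_iff_isLittleO_nhds_zero]
      simp only [norm_zero, zero_smul, zero_add, smul_zero, ContinuousLinearMap.smulRight_zero,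
        add_zero, zero_apply, sub_zero]
      refine Asymptotics.isLittleO_iff.2 fun c hc => ?_
      filter_upwards [Metric.ball_mem_nhds (0 : V) hc] with v hv
      rw [norm_smul, norm_norm]
      have : ‖v‖ < c := by simpa using hv
      gcongr
    · have h1 : HasFDerivAt (fun y : V => ‖y‖ ^ 2) (2 • innerSL ℝ z) z :=
        (hasStrictFDerivAt_norm_sq z).hasFDerivAt
      have h2 : HasFDerivAt (fun y : V => √(‖y‖ ^ 2)) _ z := h1.sqrt (by simpa using hz)
      simp only [Real.sqrt_sq (norm_nonneg _)] at h2
      refine (h2.smul (hasFDerivAt_id z)).congr_fderiv ?_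
      have hz' := norm_ne_zero_iff.2 hz
      ext v
      simp
      congr 1
      field_simp
  rw [contDiff_one_iff_fderiv]
  refine ⟨fun z => (hd z).differentiableAt, ?_⟩
  rw [show fderiv ℝ (fun z : V => ‖z‖ • z) = _ from funext fun z => (hd z).fderiv]
  refine (continuous_norm.smul continuous_const).add ?_
  rw [continuous_iff_continuousAt]
  intro z
  rcases eq_or_ne z 0 with rfl | hz
  · have hb : ∀ z : V, ‖(‖z‖⁻¹ • innerSL ℝ z).smulRight z‖ ≤ ‖z‖ := fun z => by
      rw [ContinuousLinearMap.norm_smulRight_apply, norm_smul, norm_inv, norm_norm,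
        innerSL_apply_norm]
      rcases eq_or_ne z 0 with rfl | hz
      · simp
      · rw [inv_mul_cancel₀ (norm_ne_zero_iff.2 hz), one_mul]
    rw [ContinuousAt]
    simp only [ContinuousLinearMap.smulRight_zero]
    exact squeeze_zero_norm hb (by simpa using (continuous_norm.tendsto (0 : V)))
  · have h1 : ContinuousAt (fun z : V => ‖z‖⁻¹ • innerSL ℝ z) z :=
      (continuous_norm.continuousAt.inv₀ (norm_ne_zero_iff.2 hz)).smul
        (innerSL ℝ (E := V)).continuous.continuousAt
    have h2 := ((ContinuousLinearMap.smulRightL ℝ V V).continuous.continuousAt.comp h1).clm_apply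
      continuousAt_id
    exact h2

/-- The upper half of `S_h` as a function of `z`. -/
noncomputable def sphereHeight {n : ℕ} (h : ℝ) (z : EuclideanSpace ℂ (Fin n)) : ℝ :=
  1 / (2 * h ^ 2) * (h * ‖z‖ * √(1 - h ^ 2 * ‖z‖ ^ 2) + Real.arccos (h * ‖z‖))

theorem sphereHeight_nonneg {n : ℕ} {h : ℝ} (hh : 0 < h) (z : EuclideanSpace ℂ (Fin n)) :
    0 ≤ sphereHeight h z := by
  have := Real.arccos_nonneg (h * ‖z‖)
  rw [sphereHeight]; positivity

theorem hasFDerivAt_sphereHeight {n : ℕ} {h : ℝ} (hh : 0 < h) {z : EuclideanSpace ℂ (Fin n)}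
    (hz : ‖z‖ < 1 / h) :
    HasFDerivAt (sphereHeight h)
      ((-(h / √(1 - h ^ 2 * ‖z‖ ^ 2))) • innerSL ℝ (‖z‖ • z)) z := by
  have hr : h * ‖z‖ < 1 := by rwa [lt_div_iff₀ hh, mul_comm] at hz
  have hr0 : 0 ≤ h * ‖z‖ := by positivity
  have hpos : 0 < 1 - h ^ 2 * ‖z‖ ^ 2 := by nlinarith
  have hsq := Real.sq_sqrt hpos.le
  have hs := Real.sqrt_pos.2 hpos
  -- the height as a function of `r = |z|`
  have hk : HasDerivAt (fun r : ℝ => 1 / (2 * h ^ 2) * (h * r * √(1 - h ^ 2 * r ^ 2)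
      + Real.arccos (h * r))) (-(h * ‖z‖ ^ 2 / √(1 - h ^ 2 * ‖z‖ ^ 2))) ‖z‖ := by
    have h1 : HasDerivAt (fun r : ℝ => h * r) h ‖z‖ := by
      simpa using (hasDerivAt_id ‖z‖).const_mul h
    have h2 : HasDerivAt (fun r : ℝ => √(1 - h ^ 2 * r ^ 2)) _ ‖z‖ :=
      ((((hasDerivAt_id ‖z‖).pow 2).const_mul (h ^ 2)).const_sub 1).sqrt hpos.ne'
    have h3 := (Real.hasDerivAt_arccos (x := h * ‖z‖) (by linarith) hr.ne).comp ‖z‖ h1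
    refine (((h1.mul h2).add h3).const_mul (1 / (2 * h ^ 2))).congr_deriv ?_
    rw [mul_pow]
    simp
    field_simp
    rw [hsq]
    ring
  rcases eq_or_ne z 0 with rfl | hz0
  · have := hk.isLittleO
    simp only [norm_zero, sub_zero, ne_eq, OfNat.ofNat_ne_zero, not_false_eq_true, zero_pow,
      mul_zero, zero_div, neg_zero, smul_zero] at this
    rw [hasFDerivAt_iff_isLittleO_nhds_zero]
    have hc : Tendsto (fun v : EuclideanSpace ℂ (Fin n) => ‖v‖) (𝓝 0) (𝓝 0) := by
      simpa using continuous_norm.tendsto (0 : EuclideanSpace ℂ (Fin n))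
    have h2 := (this.comp_tendsto hc).norm_right
    simp only [Function.comp_def, norm_norm] at h2
    refine (h2.of_norm_right).congr_left fun v => ?_
    simp [sphereHeight]
  · have h1 : HasFDerivAt (fun y : EuclideanSpace ℂ (Fin n) => ‖y‖ ^ 2) (2 • innerSL ℝ z) z :=
      (hasStrictFDerivAt_norm_sq z).hasFDerivAt
    have h2 : HasFDerivAt (fun y : EuclideanSpace ℂ (Fin n) => √(‖y‖ ^ 2)) _ z :=
      h1.sqrt (by simpa using hz0)
    simp only [Real.sqrt_sq (norm_nonneg _)] at h2
    have := hk.comp_hasFDerivAt z h2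
    refine this.congr_fderiv ?_
    have hz' := norm_ne_zero_iff.2 hz0
    ext v
    simp
    field_simp

/-- The height is of class `C²` across the pole although `|z|` is not differentiable there, since its
gradient is a smooth multiple of `|z| z`. -/
theorem contDiffOn_sphereHeight (n : ℕ) {h : ℝ} (hh : 0 < h) :
    ContDiffOn ℝ 2 (sphereHeight h) (Metric.ball (0 : EuclideanSpace ℂ (Fin n)) (1 / h)) := by
  have h2 : (2 : WithTop ℕ∞) = 1 + 1 := one_add_one_eq_two.symm
  have hd : ∀ z ∈ Metric.ball (0 : EuclideanSpace ℂ (Fin n)) (1 / h), _ := fun z hz =>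
    hasFDerivAt_sphereHeight hh (by simpa using hz)
  rw [h2, contDiffOn_succ_iff_fderiv_of_isOpen Metric.isOpen_ball]
  refine ⟨fun z hz => (hd z hz).differentiableAt.differentiableWithinAt, by simp, ?_⟩
  refine ContDiffOn.congr (f := fun z => (-(h / √(1 - h ^ 2 * ‖z‖ ^ 2))) • innerSL ℝ (‖z‖ • z)) ?_
    fun z hz => (hd z hz).fderiv
  refine ContDiffOn.smul (f := fun z => -(h / √(1 - h ^ 2 * ‖z‖ ^ 2))) (fun z hz => ?_)
    ((innerSL ℝ (E := EuclideanSpace ℂ (Fin n))).contDiff.comp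
      contDiff_norm_smul_self).contDiffOn
  have hz : ‖z‖ < 1 / h := by simpa using hz
  have hr : h * ‖z‖ < 1 := by rwa [lt_div_iff₀ hh, mul_comm] at hz
  have hpos : 0 < 1 - h ^ 2 * ‖z‖ ^ 2 := by nlinarith [norm_nonneg z, mul_nonneg hh.le (norm_nonneg z)]
  exact (contDiffAt_const.div ((contDiffAt_const.sub (contDiffAt_const.mul
    (contDiff_norm_sq ℝ).contDiffAt)).sqrt hpos.ne') (Real.sqrt_pos.2 hpos).ne').neg.contDiffWithinAt

/-- The poles of a translate of `S_h` are singular points. -/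
theorem isSingularPoint_sphereS {n : ℕ} {h : ℝ} (hh : 0 < h) {t₀ τ : ℝ}
    (hτ : ((0, τ) : Heis n) ∈ Heis.mul (0, t₀) '' sphereS n h) :
    IsSingularPoint (Heis.mul (0, t₀) '' sphereS n h) (0, τ) := by
  have hmem : ∀ {p : Heis n}, p ∈ Heis.mul (0, t₀) '' sphereS n h ↔
      ‖p.1‖ ≤ 1 / h ∧ |p.2 - t₀| = sphereHeight h p.1 := by
    intro p
    constructor
    · rintro ⟨q, hq, rfl⟩
      rw [mul_zero_left]
      simp only [add_sub_cancel_left]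
      exact hq
    · intro hp
      exact ⟨(p.1, p.2 - t₀), hp, by rw [mul_zero_left]; simp⟩
  have hτ' := (hmem.1 hτ).2
  have hpole : 0 < sphereHeight h (0 : EuclideanSpace ℂ (Fin n)) := by
    simp only [sphereHeight, norm_zero, mul_zero, zero_mul, Real.arccos_zero]
    positivity
  have hne : τ - t₀ ≠ 0 := by
    intro h0
    have : |τ - t₀| = sphereHeight h (0 : EuclideanSpace ℂ (Fin n)) := hτ'
    rw [h0, abs_zero] at this
    exact hpole.ne this
  obtain ⟨ε, hε, hε0⟩ : ∃ ε : ℝ, ε * ε = 1 ∧ 0 < ε * (τ - t₀) := by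
    rcases hne.lt_or_gt with h0 | h0
    · exact ⟨-1, by norm_num, by linarith⟩
    · exact ⟨1, by norm_num, by linarith⟩
  have hU : IsOpen {p : Heis n | ‖p.1‖ < 1 / h ∧ 0 < ε * (p.2 - t₀)} :=
    (isOpen_lt continuous_fst.norm continuous_const).inter
      (isOpen_lt (continuous_const (y := (0 : ℝ)))
        ((continuous_snd.sub (continuous_const (y := t₀))).const_mul ε))
  have hsub : {z : EuclideanSpace ℂ (Fin n) | ∃ s : ℝ,
      (z, s) ∈ {p : Heis n | ‖p.1‖ < 1 / h ∧ 0 < ε * (p.2 - t₀)}} ⊆ Metric.ball 0 (1 / h) := by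
    rintro z ⟨s, hs⟩
    simpa using hs.1
  refine isSingularPoint_of_graph (g := fun z => t₀ + ε * sphereHeight h z) hU
    ((contDiffOn_const.add (contDiffOn_const.mul (contDiffOn_sphereHeight n hh))).mono hsub) ?_
    ⟨by simpa using hh, hε0⟩ hτ ?_
  · ext p
    constructor
    · rintro ⟨hp, hp'⟩
      refine ⟨hp', ?_⟩
      have h1 := (hmem.1 hp).2
      have h2 : |p.2 - t₀| = ε * (p.2 - t₀) := by
        rcases mul_self_eq_one_iff.1 hε with rfl | rfl
        · rw [abs_of_pos (by simpa using hp'.2)]; ring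
        · rw [abs_of_neg (by linarith [hp'.2])]; ring
      rw [← h1, h2, ← mul_assoc, hε]; ring
    · rintro ⟨hp', he⟩
      refine ⟨hmem.2 ⟨hp'.1.le, ?_⟩, hp'⟩
      rw [he, add_sub_cancel_left, abs_mul, abs_of_nonneg (sphereHeight_nonneg hh _)]
      rcases mul_self_eq_one_iff.1 hε with rfl | rfl <;> simp
  · have := ((hasFDerivAt_sphereHeight (z := (0 : EuclideanSpace ℂ (Fin n))) hh
      (by simpa using hh)).const_mul ε).const_add t₀
    rw [this.fderiv]
    simp

namespace IsCompleteSolution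

variable {n : ℕ} {H : ℝ} {I : Set ℝ} {x t σ : ℝ → ℝ}

/-- The values of the tilt sine on a solution of energy zero fill the interval `(-1, 1)`. -/
theorem image_tiltSin_of_energy_zero (h : IsCompleteSolution n H I x t σ) (hH : H ≠ 0)
    (hU : ∀ s ∈ I, tiltCos (x s) (σ s) = H * x s) :
    (fun s => tiltSin (x s) (σ s)) '' I = Ioo (-1) 1 := by
  have hV2 : ∀ s ∈ I, tiltSin (x s) (σ s) ^ 2 = 1 - H ^ 2 * x s ^ 2 := fun s hs => by
    have := tiltCos_sq_add_tiltSin_sq (h.pos s hs) (σ s)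
    rw [hU s hs] at this
    linarith
  have hHx : ∀ s ∈ I, 0 < H ^ 2 * x s ^ 2 := fun s hs => by
    have := h.pos s hs
    positivity
  have hmaps : ∀ s ∈ I, tiltSin (x s) (σ s) ∈ Ioo (-1 : ℝ) 1 := fun s hs => by
    exact abs_lt.1 ((sq_lt_one_iff_abs_lt_one _).1 (by linarith [hV2 s hs, hHx s hs]))
  have hVd : ∀ s ∈ I, HasDerivAt (fun s => tiltSin (x s) (σ s))
      (-(H ^ 2 * tiltNorm (x s) (σ s))) s := fun s hs => by
    refine (h.hasDerivAt_tiltSin hs).congr_deriv ?_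
    have := h.pos s hs
    rw [cos_eq_tiltCos_mul this, hU s hs, tiltSlope]
    field_simp
    ring
  have hVc : ContinuousOn (fun s => tiltSin (x s) (σ s)) I := fun s hs =>
    (hVd s hs).continuousAt.continuousWithinAt
  have hanti : StrictAntiOn (fun s => tiltSin (x s) (σ s)) I :=
    strictAntiOn_of_deriv_neg h.convex hVc fun s hs => by
      have hs := interior_subset hs
      have := tiltNorm_pos (h.pos s hs) (σ s)
      rw [(hVd s hs).deriv, neg_lt_zero]
      positivity
  -- the tilt angle `arcsin V` is bounded and has derivative at most `-c`
  set c := |H| * min 1 |H| with hc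
  have hc0 : 0 < c := by have := abs_pos.2 hH; positivity
  have hbd : ∀ a ∈ I, ∀ b ∈ I, a ≤ b → c * (b - a) ≤ Real.pi := by
    intro a ha b hb hab
    have hd : ∀ s ∈ I, HasDerivAt (fun s => Real.arcsin (tiltSin (x s) (σ s)))
        (-(|H| * (tiltNorm (x s) (σ s) / x s))) s := fun s hs => by
      have hx := h.pos s hs
      refine ((Real.hasDerivAt_arcsin (hmaps s hs).1.ne' (hmaps s hs).2.ne).comp s
        (hVd s hs)).congr_deriv ?_
      rw [hV2 s hs, show 1 - (1 - H ^ 2 * x s ^ 2) = (|H| * x s) ^ 2 by rw [mul_pow, sq_abs]; ring,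
        Real.sqrt_sq (by positivity), ← sq_abs H]
      have := abs_pos.2 hH
      field_simp
    have hle := h.convex.image_sub_le_mul_sub_of_deriv_le (C := -c)
      (fun s hs => (hd s hs).continuousAt.continuousWithinAt)
      (fun s hs => (hd s (interior_subset hs)).differentiableAt.differentiableWithinAt)
      (fun s hs => by
        have hs := interior_subset hs
        have hx := h.pos s hs
        rw [(hd s hs).deriv, neg_le_neg_iff, hc]
        have hHx1 : |H| * x s ≤ 1 := by
          have h2 : (|H| * x s) ^ 2 ≤ 1 := by
            rw [mul_pow, sq_abs]; linarith [hV2 s hs, sq_nonneg (tiltSin (x s) (σ s))]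
          exact (sq_le_one_iff₀ (by positivity)).1 h2
        have hQ := le_tiltNorm (m := min 1 |H| * x s) (mul_pos (by simpa using hH) hx)
          (le_trans (by gcongr; exact min_le_right _ _) hHx1)
          (mul_le_of_le_one_left hx.le (min_le_left _ _)) (σ s)
        rw [← le_div_iff₀ hx] at hQ
        gcongr) a ha b hb hab
    have h1 := Real.arcsin_le_pi_div_two (tiltSin (x a) (σ a))
    have h2 := Real.neg_pi_div_two_le_arcsin (tiltSin (x b) (σ b))
    linarith
  obtain ⟨s₀, hs₀⟩ := h.nonempty
  -- `V² = 1 - H²x²` exceeds any number below `1` close to the axis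
  have hsmall : ∀ v ∈ Ioo (-1 : ℝ) 1, ∃ δ > 0, ∀ s ∈ I, x s < δ →
      v ^ 2 < tiltSin (x s) (σ s) ^ 2 ∧
        tiltSin (x s₀) (σ s₀) ^ 2 < tiltSin (x s) (σ s) ^ 2 := by
    intro v hv
    have h1 : v ^ 2 < 1 := by nlinarith [hv.1, hv.2]
    have h2 := hV2 s₀ hs₀
    have h3 := hHx s₀ hs₀
    have hH2 : 0 < H ^ 2 := by positivity
    obtain ⟨r, hr, hr'⟩ := exists_between (max_lt h1 (by linarith :
      tiltSin (x s₀) (σ s₀) ^ 2 < 1))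
    refine ⟨√((1 - r) / H ^ 2), Real.sqrt_pos.2 (div_pos (by linarith) hH2), fun s hs hxs => ?_⟩
    rw [Real.lt_sqrt (h.pos s hs).le, lt_div_iff₀ hH2] at hxs
    rw [hV2 s hs]
    exact ⟨by linarith [le_max_left (v ^ 2) (tiltSin (x s₀) (σ s₀) ^ 2)],
      by linarith [le_max_right (v ^ 2) (tiltSin (x s₀) (σ s₀) ^ 2)]⟩
  refine Subset.antisymm (image_subset_iff.2 hmaps) fun v hv => ?_
  obtain ⟨δ, hδ, hδ'⟩ := hsmall v hv
  -- at the upper end of `I` the tilt sine tends to `-1`, at the lower end to `1`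
  obtain ⟨b, hb, hbv⟩ : ∃ b ∈ I, tiltSin (x b) (σ b) < v := by
    have hbdd : BddAbove I := ⟨s₀ + Real.pi / c, fun s hs => by
      rcases le_total s s₀ with h1 | h1
      · have : 0 ≤ Real.pi / c := by positivity
        linarith
      · have := hbd s₀ hs₀ s hs h1
        rw [← sub_le_iff_le_add', le_div_iff₀ hc0]; linarith⟩
    have hl := isLUB_csSup h.nonempty hbdd
    have hne := hl.notMem_of_isOpen h.isOpen
    have hlt : s₀ < sSup I := lt_of_le_of_ne (hl.1 hs₀) fun e => hne (e ▸ hs₀)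
    obtain ⟨s, hs, hs'⟩ := (((h.tendsto_zero_of_isLUB hl).eventually_lt_const hδ).and
      (Ioo_mem_nhdsLT hlt)).exists
    obtain ⟨r, hr, hr'⟩ := (lt_isLUB_iff hl).1 hs'.2
    have hsI := h.ordConnected.out hs₀ hr ⟨hs'.1.le, hr'.le⟩
    refine ⟨s, hsI, ?_⟩
    obtain ⟨h1, h2⟩ := hδ' s hsI hs
    have h3 : tiltSin (x s) (σ s) < tiltSin (x s₀) (σ s₀) := hanti hs₀ hsI hs'.1
    have h4 := sq_lt_sq.1 h1
    have h5 := sq_lt_sq.1 h2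
    rcases abs_cases (tiltSin (x s) (σ s)) with ⟨h6, -⟩ | ⟨h6, -⟩
    · linarith [le_abs_self (tiltSin (x s₀) (σ s₀))]
    · linarith [neg_abs_le v]
  obtain ⟨a, ha, hav⟩ : ∃ a ∈ I, v < tiltSin (x a) (σ a) := by
    have hbdd : BddBelow I := ⟨s₀ - Real.pi / c, fun s hs => by
      rcases le_total s₀ s with h1 | h1
      · have : 0 ≤ Real.pi / c := by positivity
        linarith
      · have := hbd s hs s₀ hs₀ h1
        rw [sub_le_iff_le_add, ← sub_le_iff_le_add', le_div_iff₀ hc0]; linarith⟩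
    have hl := isGLB_csInf h.nonempty hbdd
    have hne : sInf I ∉ I := fun hm => by
      have hev : ∀ᶠ c in 𝓝[<] (sInf I), c ∈ I := mem_nhdsWithin_of_mem_nhds (h.isOpen.mem_nhds hm)
      obtain ⟨c, hc, hc'⟩ := (hev.and self_mem_nhdsWithin).exists
      exact absurd (hl.1 hc) (not_le.2 hc')
    have hlt : sInf I < s₀ := lt_of_le_of_ne (hl.1 hs₀) fun e => hne (e ▸ hs₀)
    obtain ⟨s, hs, hs'⟩ := (((h.tendsto_zero_of_isGLB hl).eventually_lt_const hδ).and
      (Ioo_mem_nhdsGT hlt)).exists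
    obtain ⟨r, hr, hr'⟩ := (isGLB_lt_iff hl).1 hs'.1
    have hsI := h.ordConnected.out hr hs₀ ⟨hr'.le, hs'.2.le⟩
    refine ⟨s, hsI, ?_⟩
    obtain ⟨h1, h2⟩ := hδ' s hsI hs
    have h3 : tiltSin (x s₀) (σ s₀) < tiltSin (x s) (σ s) := hanti hsI hs₀ hs'.2
    have h4 := sq_lt_sq.1 h1
    have h5 := sq_lt_sq.1 h2
    rcases abs_cases (tiltSin (x s) (σ s)) with ⟨h6, -⟩ | ⟨h6, -⟩
    · linarith [le_abs_self v]
    · linarith [neg_abs_le (tiltSin (x s₀) (σ s₀))]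
  exact h.convex.isPreconnected.intermediate_value hb ha hVc ⟨hbv.le, hav.le⟩

/-- The generating curve of energy zero is an open half meridian of `S_{|H|}`. -/
theorem generatingCurve_eq_sphereMeridian (h : IsCompleteSolution n H I x t σ)
    (hH : H ≠ 0) (hU : ∀ s ∈ I, tiltCos (x s) (σ s) = H * x s) :
    ∃ t₀ : ℝ, generatingCurve I x t
      = (fun a => ((sphereMeridian |H| a).1, t₀ + (sphereMeridian |H| a).2)) '' Ioo (-1) 1 := by
  have himg := h.image_tiltSin_of_energy_zero hH hU
  have hH' := abs_pos.2 hH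
  have hV : ∀ s ∈ I, tiltSin (x s) (σ s) ∈ Ioo (-1 : ℝ) 1 := fun s hs =>
    himg ▸ mem_image_of_mem _ hs
  have hx : ∀ s ∈ I, √(1 - tiltSin (x s) (σ s) ^ 2) = |H| * x s := fun s hs => by
    have hx := h.pos s hs
    have := tiltCos_sq_add_tiltSin_sq hx (σ s)
    rw [hU s hs] at this
    rw [show 1 - tiltSin (x s) (σ s) ^ 2 = (|H| * x s) ^ 2 by rw [mul_pow, sq_abs]; linarith,
      Real.sqrt_sq (by positivity)]
  -- `ε = ±1` is the sign of `-H`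
  obtain ⟨ε, hε, hεH⟩ : ∃ ε : ℝ, ε * ε = 1 ∧ H = -(ε * |H|) := by
    rcases hH.lt_or_gt with h0 | h0
    · exact ⟨1, by norm_num, by rw [abs_of_neg h0]; ring⟩
    · exact ⟨-1, by norm_num, by rw [abs_of_pos h0]; ring⟩
  obtain ⟨s₀, hs₀⟩ := h.nonempty
  have hd : ∀ s ∈ I, HasDerivAt
      (fun s => t s - ε * (sphereProfile (tiltSin (x s) (σ s)) / |H| ^ 2)) 0 s := fun s hs => by
    have hxs := h.pos s hs
    refine ((h.deriv_t s hs).sub ((((hasDerivAt_sphereProfile (hV s hs)).comp s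
      (h.hasDerivAt_tiltSin hs)).div_const _).const_mul ε)).congr_deriv ?_
    rw [hx s hs, cos_eq_tiltCos_mul hxs, hU s hs, tiltSlope]
    have h2 : H * ε = -|H| := by linear_combination ε * hεH - |H| * hε
    field_simp
    linear_combination (H * x s * tiltNorm (x s) (σ s)) * h2
  set t₀ := t s₀ - ε * (sphereProfile (tiltSin (x s₀) (σ s₀)) / |H| ^ 2) with ht₀
  have ht : ∀ s ∈ I, t s = t₀ + ε * (sphereProfile (tiltSin (x s) (σ s)) / |H| ^ 2) := fun s hs => by
    have := h.isOpen.is_const_of_deriv_eq_zero h.convex.isPreconnected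
      (fun r hr => (hd r hr).differentiableAt.differentiableWithinAt)
      (fun r hr => (hd r hr).deriv) hs hs₀
    linarith
  have hpt : ∀ s ∈ I, (x s, t s) = ((sphereMeridian |H| (ε * tiltSin (x s) (σ s))).1,
      t₀ + (sphereMeridian |H| (ε * tiltSin (x s) (σ s))).2) := fun s hs => by
    rw [sphereMeridian, mul_pow, sq ε, hε, one_mul, hx s hs, mul_div_cancel_left₀ _ hH'.ne', ht s hs]
    rcases mul_self_eq_one_iff.1 hε with rfl | rfl
    · simp
    · rw [neg_one_mul (tiltSin _ _), sphereProfile_neg]; ring_nf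
  have hεm : ∀ a ∈ Ioo (-1 : ℝ) 1, ε * a ∈ Ioo (-1 : ℝ) 1 := fun a ha => by
    rcases mul_self_eq_one_iff.1 hε with rfl | rfl
    · simpa using ha
    · exact ⟨by linarith [ha.2], by linarith [ha.1]⟩
  refine ⟨t₀, ?_⟩
  ext q
  constructor
  · rintro ⟨s, hs, rfl⟩
    exact ⟨_, hεm _ (hV s hs), (hpt s hs).symm⟩
  · rintro ⟨a, ha, rfl⟩
    have h1 := hεm a ha
    rw [← himg] at h1
    obtain ⟨s, hs, he⟩ := h1
    refine ⟨s, hs, ?_⟩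
    have he : tiltSin (x s) (σ s) = ε * a := he
    simp only [hpt s hs, he, ← mul_assoc, hε, one_mul]

theorem generatedHypersurface_eq_sphereS (hn : 1 ≤ n) (h : IsCompleteSolution n H I x t σ)
    (hH : H ≠ 0) (hE : ∀ s ∈ I, energy n H (x s) (σ s) = 0) :
    ∃ t₀ : ℝ, generatedHypersurface n I x t = Heis.mul (0, t₀) '' sphereS n |H| := by
  have hU : ∀ s ∈ I, tiltCos (x s) (σ s) = H * x s := fun s hs => by
    have := tiltCos_eq_of_energy hn (h.pos s hs) (hE s hs)
    rw [this]; ring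
  have hH' := abs_pos.2 hH
  obtain ⟨t₀, hC⟩ := h.generatingCurve_eq_sphereMeridian hH hU
  set F : ℝ → ℝ × ℝ := fun a => ((sphereMeridian |H| a).1, t₀ + (sphereMeridian |H| a).2) with hF
  have hFc : Continuous F := by
    have := continuous_sphereMeridian |H|
    exact (continuous_fst.comp this).prodMk (continuous_const.add (continuous_snd.comp this))
  have hcl : closure (generatingCurve I x t) = F '' Icc (-1) 1 := by
    have h1 : closure (Ioo (-1 : ℝ) 1) = Icc (-1) 1 := closure_Ioo (by norm_num)
    rw [hC, ← h1, image_closure_of_isCompact (by rw [h1]; exact isCompact_Icc) hFc.continuousOn]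
  have hmemF : ∀ {p : Heis n}, p ∈ Heis.mul (0, t₀) '' sphereS n |H| ↔
      (‖p.1‖, p.2) ∈ F '' Icc (-1) 1 := by
    intro p
    constructor
    · rintro ⟨q, hq, rfl⟩
      obtain ⟨a, ha, he⟩ := (mem_sphereS_iff hH').1 hq
      refine ⟨a, ha, ?_⟩
      rw [mul_zero_left, hF]
      simp only [he]
    · rintro ⟨a, ha, he⟩
      have h1 : (sphereMeridian |H| a).1 = ‖p.1‖ := congrArg Prod.fst he
      have h2 : t₀ + (sphereMeridian |H| a).2 = p.2 := congrArg Prod.snd he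
      refine ⟨(p.1, p.2 - t₀), (mem_sphereS_iff hH').2 ⟨a, ha, ?_⟩, ?_⟩
      · exact Prod.ext h1 (by simp [← h2])
      · rw [mul_zero_left]; simp
  refine ⟨t₀, ?_⟩
  ext p
  rw [mem_generatedHypersurface h.pos, hmemF, hcl]
  constructor
  · rintro (h1 | ⟨h0, h1⟩)
    · rw [← hcl]; exact subset_closure h1
    · rwa [h0, norm_zero]
  · intro h1
    rcases eq_or_ne p.1 0 with h0 | h0
    · right
      rw [h0, norm_zero] at h1
      exact ⟨h0, h1⟩
    · left
      obtain ⟨a, ha, he⟩ := h1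
      have h1 : √(1 - a ^ 2) / |H| = ‖p.1‖ := congrArg Prod.fst he
      rw [hC]
      refine ⟨a, ?_, he⟩
      have h2 : 0 < √(1 - a ^ 2) := by
        by_contra! hcon
        have := le_antisymm hcon (Real.sqrt_nonneg _)
        rw [this, zero_div] at h1
        exact h0 (norm_eq_zero.1 h1.symm)
      have h3 := Real.sqrt_pos.1 h2
      exact abs_lt.1 ((sq_lt_one_iff_abs_lt_one _).1 (by linarith))

theorem cos_ne_zero_of_energy_zero (hn : 1 ≤ n) (h : IsCompleteSolution n H I x t σ)
    (hH : H ≠ 0) (hE : ∀ s ∈ I, energy n H (x s) (σ s) = 0) :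
    ∀ s ∈ I, Real.cos (σ s) ≠ 0 := fun s hs => by
  have hx := h.pos s hs
  have hQ := tiltNorm_pos hx (σ s)
  rw [cos_eq_tiltCos_mul hx, tiltCos_eq_of_energy hn hx (hE s hs), zero_div, zero_add]
  positivity

theorem isSingularPoint_of_energy_zero (hn : 1 ≤ n) (h : IsCompleteSolution n H I x t σ)
    (hE : ∀ s ∈ I, energy n H (x s) (σ s) = 0) {τ : ℝ}
    (hτ : ((0, τ) : Heis n) ∈ generatedHypersurface n I x t) :
    IsSingularPoint (generatedHypersurface n I x t) (0, τ) := by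
  rcases eq_or_ne H 0 with rfl | hH
  · obtain ⟨t₀, -, hS⟩ := h.generatedHypersurface_of_energy_zero hn hE
    rw [hS] at hτ ⊢
    obtain rfl : τ = t₀ := hτ
    exact isSingularPoint_hyperplane n τ
  · obtain ⟨t₀, hS⟩ := h.generatedHypersurface_eq_sphereS hn hH hE
    rw [hS] at hτ ⊢
    exact isSingularPoint_sphereS (abs_pos.2 hH) hτ

theorem isEmbeddedHypersurface_of_energy_zero (hn : 1 ≤ n) (h : IsCompleteSolution n H I x t σ)
    (hH : H ≠ 0) (hE : ∀ s ∈ I, energy n H (x s) (σ s) = 0) :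
    IsEmbeddedHypersurface (generatedHypersurface n I x t) := by
  intro p hp
  rcases eq_or_ne p.1 0 with h0 | h0
  · have hp' : p = (0, p.2) := Prod.ext h0 rfl
    obtain ⟨-, U, u, hU, hu, -⟩ := h.isSingularPoint_of_energy_zero hn hE (τ := p.2) (hp' ▸ hp)
    exact ⟨U, u, hp' ▸ hU, hu⟩
  · exact h.exists_isDefiningFunction (h.cos_ne_zero_of_energy_zero hn hH hE) hp h0

end IsCompleteSolution

/-! ### Symmetries of solutions on the whole line -/

theorem energy_add_pi (n : ℕ) (H x σ : ℝ) :
    energy n (-H) x (σ + Real.pi) = -energy n H x σ := by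
  simp only [energy, Real.cos_add_pi, Real.sin_add_pi, neg_sq]
  ring

theorem generatingCurve_reverse (I : Set ℝ) (x t : ℝ → ℝ) :
    generatingCurve (Neg.neg ⁻¹' I) (fun s => x (-s)) (fun s => t (-s)) = generatingCurve I x t := by
  ext q
  constructor
  · rintro ⟨s, hs, rfl⟩
    exact ⟨-s, hs, rfl⟩
  · rintro ⟨s, hs, rfl⟩
    exact ⟨-s, by simpa using hs, by simp⟩

theorem generatedHypersurface_reverse {n : ℕ} {I : Set ℝ} {x t : ℝ → ℝ} (hpos : ∀ s ∈ I, 0 < x s) :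
    generatedHypersurface n (Neg.neg ⁻¹' I) (fun s => x (-s)) (fun s => t (-s))
      = generatedHypersurface n I x t := by
  ext p
  rw [mem_generatedHypersurface hpos,
    mem_generatedHypersurface (I := Neg.neg ⁻¹' I) fun s hs => hpos (-s) hs,
    generatingCurve_reverse]

/-- A function on `ℝ` whose derivative is bounded below by a positive constant is onto. -/
theorem surjective_of_le_deriv {f f' : ℝ → ℝ} {δ : ℝ} (hδ : 0 < δ)
    (hf : ∀ s, HasDerivAt f (f' s) s) (hf' : ∀ s, δ ≤ f' s) : Function.Surjective f := by
  have hd : Differentiable ℝ f := fun s => (hf s).differentiableAt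
  have hle : ∀ a b, a ≤ b → δ * (b - a) ≤ f b - f a := fun a b hab =>
    mul_sub_le_image_sub_of_le_deriv hd (fun s => by rw [(hf s).deriv]; exact hf' s) hab
  refine hd.continuous.surjective ?_ ?_
  · refine tendsto_atTop_mono' _ (f₁ := fun s => f 0 + δ * s) ?_
      (tendsto_atTop_add_const_left _ _ (tendsto_id.const_mul_atTop hδ))
    filter_upwards [eventually_ge_atTop 0] with s hs
    linarith [hle 0 s hs]
  · refine tendsto_atBot_mono' _ (f₂ := f) (f₁ := fun s => f 0 + δ * s) ?_
      (tendsto_atBot_add_const_left _ _ (tendsto_id.const_mul_atBot hδ))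
    filter_upwards [eventually_le_atBot 0] with s hs
    linarith [hle s 0 hs]

theorem interior_image_subset_of_strictMono {t : ℝ → ℝ} (ht : StrictMono t) (hc : Continuous t) (A : Set ℝ) :
    interior (t '' A) ⊆ t '' interior A := fun τ hτ => by
  obtain ⟨s, -, rfl⟩ := interior_subset hτ
  refine ⟨s, mem_interior.2 ⟨t ⁻¹' interior (t '' A), fun r hr => ?_,
    isOpen_interior.preimage hc, hτ⟩, rfl⟩
  exact (ht.injective.mem_set_image).1 (interior_subset hr)

namespace IsSolution

variable {n : ℕ} {H : ℝ} {x t σ : ℝ → ℝ}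

/-- A solution on `ℝ` is symmetric about each parameter at which `x' = 0`. -/
theorem symmetric (h : IsSolution n H univ x t σ) {c : ℝ} (hc : Real.sin (σ c) = 0) (s : ℝ) :
    x (2 * c - s) = x s ∧ t (2 * c - s) = 2 * t c - t s ∧ σ (2 * c - s) = 2 * σ c - σ s := by
  have hcc : 2 * c - c = c := by ring
  obtain ⟨h1, h2, h3⟩ := (h.reflectAbout hc).unique h (mem_univ c) (by rw [hcc])
    (by rw [hcc]; ring) (by rw [hcc]; ring) s trivial
  exact ⟨h1, by linarith, by linarith⟩

/-- Two symmetries compose to a translation. -/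
theorem periodic (h : IsSolution n H univ x t σ) {c c' : ℝ} (hc : Real.sin (σ c) = 0)
    (hc' : Real.sin (σ c') = 0) (s : ℝ) :
    x (s + 2 * (c' - c)) = x s ∧ t (s + 2 * (c' - c)) = t s + 2 * (t c' - t c) ∧
      σ (s + 2 * (c' - c)) = σ s + 2 * (σ c' - σ c) := by
  obtain ⟨h1, h2, h3⟩ := h.symmetric hc s
  obtain ⟨h1', h2', h3'⟩ := h.symmetric hc' (2 * c - s)
  rw [show s + 2 * (c' - c) = 2 * c' - (2 * c - s) by ring]
  exact ⟨by rw [h1', h1], by rw [h2', h2]; ring, by rw [h3', h3]; ring⟩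

theorem hasDerivAt_tan (h : IsSolution n H univ x t σ) {s : ℝ} (hc : Real.cos (σ s) ≠ 0) :
    HasDerivAt (fun s => Real.tan (σ s)) (1 / Real.cos (σ s) ^ 2 *
      ((tiltNorm (x s) (σ s) / x s) ^ 3 *
      curvatureFactor n H (x s) (tiltCos (x s) (σ s)))) s :=
  (Real.hasDerivAt_tan hc).comp s (h.deriv_σ' trivial)

theorem continuous_t (h : IsSolution n H univ x t σ) : Continuous t :=
  continuous_iff_continuousAt.2 fun s => (h.deriv_t s trivial).continuousAt

theorem strictMono_t (h : IsSolution n H univ x t σ) (hc : ∀ s, 0 < Real.cos (σ s)) :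
    StrictMono t :=
  strictMonoOn_univ.1 (h.strictMonoOn_t le_rfl convex_univ fun s _ => hc s)

theorem convex_image_t (h : IsSolution n H univ x t σ) {A : Set ℝ} (hA : Convex ℝ A) :
    Convex ℝ (t '' A) :=
  ((hA.isPreconnected.image t h.continuous_t.continuousOn).ordConnected).convex

theorem continuous_graphFun (h : IsSolution n H univ x t σ) (hc : ∀ s, 0 < Real.cos (σ s))
    (A : Set ℝ) : ContinuousOn (graphFun univ x t) (t '' A) := by
  rintro _ ⟨s, -, rfl⟩
  exact (h.hasDerivAt_graphFun (fun s _ => (hc s).ne') (mem_univ s)).continuousAt.continuousWithinAt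

/-- The generating curve is convex as a graph over the `t`-axis where its curvature is positive. -/
theorem strictConvexOn_graphFun (h : IsSolution n H univ x t σ) (hc : ∀ s, 0 < Real.cos (σ s))
    {A : Set ℝ} (hA : Convex ℝ A)
    (hG : ∀ s ∈ interior A, 0 < curvatureFactor n H (x s) (tiltCos (x s) (σ s))) :
    StrictConvexOn ℝ (t '' A) (graphFun univ x t) := by
  have hmono : StrictMonoOn (fun s => Real.tan (σ s)) (interior A) := by
    refine strictMonoOn_of_deriv_pos hA.interior
      (fun s _ => (h.hasDerivAt_tan (hc s).ne').continuousAt.continuousWithinAt) fun s hs => ?_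
    rw [interior_interior] at hs
    rw [(h.hasDerivAt_tan (hc s).ne').deriv]
    have := hc s
    have := tiltNorm_pos (h.pos s trivial) (σ s)
    have := h.pos s trivial
    have := hG s hs
    positivity
  refine StrictMonoOn.strictConvexOn_of_deriv (h.convex_image_t hA) (h.continuous_graphFun hc A) ?_
  intro a ha b hb hab
  obtain ⟨r, hr, rfl⟩ := interior_image_subset_of_strictMono (h.strictMono_t hc) h.continuous_t A ha
  obtain ⟨s, hs, rfl⟩ := interior_image_subset_of_strictMono (h.strictMono_t hc) h.continuous_t A hb
  rw [(h.hasDerivAt_graphFun (fun s _ => (hc s).ne') (mem_univ r)).deriv,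
    (h.hasDerivAt_graphFun (fun s _ => (hc s).ne') (mem_univ s)).deriv]
  exact hmono hr hs ((h.strictMono_t hc).lt_iff_lt.1 hab)

theorem strictConcaveOn_graphFun (h : IsSolution n H univ x t σ) (hc : ∀ s, 0 < Real.cos (σ s))
    {A : Set ℝ} (hA : Convex ℝ A)
    (hG : ∀ s ∈ interior A, curvatureFactor n H (x s) (tiltCos (x s) (σ s)) < 0) :
    StrictConcaveOn ℝ (t '' A) (graphFun univ x t) := by
  have hanti : StrictAntiOn (fun s => Real.tan (σ s)) (interior A) := by
    refine strictAntiOn_of_deriv_neg hA.interior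
      (fun s _ => (h.hasDerivAt_tan (hc s).ne').continuousAt.continuousWithinAt) fun s hs => ?_
    rw [interior_interior] at hs
    rw [(h.hasDerivAt_tan (hc s).ne').deriv]
    have := hc s
    have := tiltNorm_pos (h.pos s trivial) (σ s)
    have := h.pos s trivial
    exact mul_neg_of_pos_of_neg (by positivity) (mul_neg_of_pos_of_neg (by positivity) (hG s hs))
  refine StrictAntiOn.strictConcaveOn_of_deriv (h.convex_image_t hA)
    (h.continuous_graphFun hc A) ?_
  intro a ha b hb hab
  obtain ⟨r, hr, rfl⟩ := interior_image_subset_of_strictMono (h.strictMono_t hc) h.continuous_t A ha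
  obtain ⟨s, hs, rfl⟩ := interior_image_subset_of_strictMono (h.strictMono_t hc) h.continuous_t A hb
  rw [(h.hasDerivAt_graphFun (fun s _ => (hc s).ne') (mem_univ r)).deriv,
    (h.hasDerivAt_graphFun (fun s _ => (hc s).ne') (mem_univ s)).deriv]
  exact hanti hr hs ((h.strictMono_t hc).lt_iff_lt.1 hab)

end IsSolution

/-! ### Catenoids -/

theorem curvatureFactor_zero_ge {n : ℕ} (hn : 1 ≤ n) {x U : ℝ} (hU : 0 < U) :
    U ^ 3 ≤ curvatureFactor n 0 x U := by
  have : (0 : ℝ) ≤ n - 1 := by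
    have : (1 : ℝ) ≤ n := by exact_mod_cast hn
    linarith
  have : 0 ≤ 2 * ((n : ℝ) - 1) * U := by positivity
  rw [curvatureFactor]
  linarith

/-- If `x''` is bounded below by a positive constant wherever `x` is bounded, then `x` is not
increasing on all of `ℝ`: otherwise `x ≤ x(0)` on `(-∞, 0]`, and `x'` would become negative there. -/
theorem exists_nonpos_of_convex {x y z : ℝ → ℝ} (hx : ∀ s, HasDerivAt x (y s) s)
    (hy : ∀ s, HasDerivAt y (z s) s) (hz : ∀ M, ∃ δ > 0, ∀ s, x s ≤ M → δ ≤ z s) :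
    ∃ s, y s ≤ 0 := by
  by_contra! hpos
  obtain ⟨δ, hδ, hδ'⟩ := hz (x 0)
  have hmono : StrictMono x := strictMono_of_deriv_pos fun s => by rw [(hx s).deriv]; exact hpos s
  have hle := (convex_Iic (0 : ℝ)).mul_sub_le_image_sub_of_le_deriv (f := y) (C := δ)
    (fun s _ => (hy s).continuousAt.continuousWithinAt)
    (fun s _ => (hy s).differentiableAt.differentiableWithinAt)
    (fun s hs => by
      rw [(hy s).deriv]
      exact hδ' s (hmono.monotone (interior_subset hs : s ∈ Iic 0)))
  have h0 := hpos 0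
  have h1 := hle (-(y 0 / δ)) (by simp only [mem_Iic, Left.neg_nonpos_iff]; positivity) 0 (by simp)
    (by simp only [Left.neg_nonpos_iff]; positivity)
  have h2 := hpos (-(y 0 / δ))
  have h3 : δ * (0 - -(y 0 / δ)) = y 0 := by field_simp; ring
  linarith

theorem exists_critical_of_convex {x y z : ℝ → ℝ} (hx : ∀ s, HasDerivAt x (y s) s)
    (hy : ∀ s, HasDerivAt y (z s) s) (hz : ∀ M, ∃ δ > 0, ∀ s, x s ≤ M → δ ≤ z s) :
    ∃ s, y s = 0 := by
  obtain ⟨a, ha⟩ := exists_nonpos_of_convex hx hy hz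
  obtain ⟨b, hb⟩ := exists_nonpos_of_convex (x := fun s => x (-s)) (y := fun s => -y (-s))
    (z := fun s => z (-s))
    (fun s => ((hx (-s)).comp s (hasDerivAt_neg s)).congr_deriv (by simp))
    (fun s => ((hy (-s)).comp s (hasDerivAt_neg s)).fun_neg.congr_deriv (by simp))
    (fun M => by
      obtain ⟨δ, hδ, hδ'⟩ := hz M
      exact ⟨δ, hδ, fun s hs => hδ' _ hs⟩)
  have hc : Continuous y := continuous_iff_continuousAt.2 fun s => (hy s).continuousAt
  exact mem_range_of_exists_le_of_exists_ge hc ⟨a, ha⟩ ⟨-b, by simpa using hb⟩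

namespace IsSolution

variable {n : ℕ} {E : ℝ} {x t σ : ℝ → ℝ}

theorem tiltCos_pos_of_energy_pos (hn : 1 ≤ n) {H : ℝ} (hH : 0 ≤ H)
    (h : IsSolution n H univ x t σ) (hE : ∀ s, energy n H (x s) (σ s) = E) (hE0 : 0 < E) (s : ℝ) :
    0 < tiltCos (x s) (σ s) := by
  have hx := h.pos s trivial
  rw [tiltCos_eq_of_energy hn hx (hE s)]
  positivity

/-- `x'' = cos σ · σ'` is bounded below wherever `x` is bounded. -/
theorem exists_le_deriv_sin_catenoid (hn : 1 ≤ n) (h : IsSolution n 0 univ x t σ)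
    (hE : ∀ s, energy n 0 (x s) (σ s) = E) (hE0 : 0 < E) (M : ℝ) :
    ∃ δ > 0, ∀ s, x s ≤ M → δ ≤ Real.cos (σ s) * ((tiltNorm (x s) (σ s) / x s) ^ 3 *
      curvatureFactor n 0 (x s) (tiltCos (x s) (σ s))) := by
  obtain ⟨m, hm, hm1, hmx⟩ := h.exists_le_of_energy_ne_zero hn (fun s _ => hE s) hE0.ne'
  rcases lt_or_ge M m with hM | hM
  · exact ⟨1, one_pos, fun s hs => absurd (hmx s trivial) (by linarith)⟩
  have hM0 : 0 < M := hm.trans_le hM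
  set u := E / M ^ (2 * n - 1) with hu
  have hu0 : 0 < u := by positivity
  refine ⟨(u * m) * ((m / M) ^ 3 * u ^ 3), by positivity, fun s hs => ?_⟩
  have hx := h.pos s trivial
  have hU : u ≤ tiltCos (x s) (σ s) := by
    rw [tiltCos_eq_of_energy hn hx (hE s), zero_mul, add_zero, hu]
    gcongr
  have hQ := le_tiltNorm hm hm1 (hmx s trivial) (σ s)
  have hG := curvatureFactor_zero_ge hn (x := x s) (hu0.trans_le hU)
  rw [cos_eq_tiltCos_mul hx]
  have : u ^ 3 ≤ curvatureFactor n 0 (x s) (tiltCos (x s) (σ s)) :=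
    (pow_le_pow_left₀ hu0.le hU 3).trans hG
  have hQ0 := hm.trans_le hQ
  have hU0 := hu0.trans_le hU
  gcongr

/-- `t' ≤ C / x²` on catenoids of dimension at least four. -/
theorem exists_cos_le_catenoid (hn : 2 ≤ n) (h : IsSolution n 0 univ x t σ)
    (hE : ∀ s, energy n 0 (x s) (σ s) = E) (hE0 : 0 < E) :
    ∃ C > 0, ∀ s, Real.cos (σ s) ≤ C / x s ^ 2 := by
  obtain ⟨m, hm, hm1, hmx⟩ := h.exists_le_of_energy_ne_zero (by omega) (fun s _ => hE s) hE0.ne'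
  obtain ⟨k, hk⟩ : ∃ k, 2 * n - 1 = k + 3 := ⟨2 * n - 4, by omega⟩
  refine ⟨E / m ^ (k + 1), by positivity, fun s => ?_⟩
  have hx := h.pos s trivial
  have hmx := hmx s trivial
  have hQ : tiltNorm (x s) (σ s) ≤ x s / m :=
    tiltNorm_le hx ((one_le_div hm).2 hmx) (le_div_self hx.le hm hm1) _
  rw [cos_eq_tiltCos_mul hx, tiltCos_eq_of_energy (by omega) hx (hE s), zero_mul, add_zero, hk]
  calc E / x s ^ (k + 3) * tiltNorm (x s) (σ s)
      ≤ E / (m ^ k * x s ^ 3) * (x s / m) := by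
        rw [pow_add]
        have := (tiltNorm_pos hx (σ s)).le
        gcongr
    _ = E / m ^ (k + 1) / x s ^ 2 := by field_simp; ring

/-- The generating curve of a catenoid has a point closest to the axis, about which it is
symmetric; away from it, the distance to the axis grows at least linearly. -/
theorem exists_symmetric_catenoid (hn : 1 ≤ n) (h : IsSolution n 0 univ x t σ)
    (hE : ∀ s, energy n 0 (x s) (σ s) = E) (hE0 : 0 < E) :
    ∃ c η : ℝ, Real.sin (σ c) = 0 ∧ 0 < η ∧ ∀ s, c + 1 ≤ s →
      η ≤ Real.sin (σ s) := by
  have hsin : ∀ s, HasDerivAt (fun s => Real.sin (σ s)) _ s := fun s => (h.deriv_σ' trivial).sin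
  have hδ := h.exists_le_deriv_sin_catenoid hn hE hE0
  have hmono : StrictMono fun s => Real.sin (σ s) := strictMono_of_deriv_pos fun s => by
    rw [(hsin s).deriv]
    obtain ⟨δ, hδ0, hδ'⟩ := hδ (x s)
    exact hδ0.trans_le (hδ' s le_rfl)
  obtain ⟨c, hc⟩ := exists_critical_of_convex (fun s => h.deriv_x s trivial) hsin hδ
  refine ⟨c, Real.sin (σ (c + 1)), hc, ?_, fun s hs => hmono.monotone hs⟩
  rw [← hc]
  exact hmono (by linarith)

theorem isCatenoidCurve (hn : 1 ≤ n) (h : IsSolution n 0 univ x t σ)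
    (hE : ∀ s, energy n 0 (x s) (σ s) = E) (hE0 : 0 < E) :
    IsCatenoidCurve (generatingCurve univ x t) := by
  have hU := h.tiltCos_pos_of_energy_pos hn le_rfl hE hE0
  have hcos : ∀ s, 0 < Real.cos (σ s) := fun s => (tiltCos_pos_iff (h.pos s trivial) _).1 (hU s)
  have hcos0 : ∀ s ∈ univ, Real.cos (σ s) ≠ 0 := fun s _ => (hcos s).ne'
  have hinj := h.injOn_t hcos0
  have hf : ∀ s, graphFun univ x t (t s) = x s := fun s => graphFun_apply hinj trivial
  obtain ⟨c, η, hc, hη, hη'⟩ := h.exists_symmetric_catenoid hn hE hE0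
  have hsym := h.symmetric hc
  refine ⟨t '' univ, t c, graphFun univ x t, h.isOpen_image_t hcos0, mem_image_of_mem _ trivial,
    ?_, h.strictConvexOn_graphFun hcos convex_univ fun s _ => ?_, ?_, fun R => ?_,
    generatingCurve_eq_graphOver hinj⟩
  · rintro _ ⟨s, -, rfl⟩
    rw [hf]; exact h.pos s trivial
  · have := hU s
    exact lt_of_lt_of_le (by positivity) (curvatureFactor_zero_ge hn this)
  · rintro _ ⟨s, -, rfl⟩
    rw [← (hsym s).2.1, hf, hf]
    exact ⟨mem_image_of_mem _ trivial, (hsym s).1⟩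
  · -- `x` exceeds `R` outside the parameter interval of half length `S` about `c`
    have hgrow : ∀ s, c + 1 ≤ s → η * (s - (c + 1)) ≤ x s := fun s hs => by
      have := (convex_Ici (c + 1)).mul_sub_le_image_sub_of_le_deriv (f := x) (C := η)
        (fun s _ => (h.deriv_x s trivial).continuousAt.continuousWithinAt)
        (fun s _ => (h.deriv_x s trivial).differentiableAt.differentiableWithinAt)
        (fun s hs => by
          rw [(h.deriv_x s trivial).deriv]
          exact hη' s (interior_subset hs : s ∈ Ici (c + 1))) (c + 1) self_mem_Ici s hs hs
      linarith [h.pos (c + 1) trivial]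
    set S := 1 + |R| / η with hS
    have hS1 : 1 ≤ S := by rw [hS]; have := abs_nonneg R; have : 0 ≤ |R| / η := by positivity
                           linarith
    have hlarge : ∀ s, c + S < s → R < x s := fun s hs => by
      have h1 := hgrow s (by linarith)
      have h2 : |R| < η * (s - (c + 1)) := by
        rw [← div_lt_iff₀' hη]; linarith
      linarith [le_abs_self R]
    refine ⟨t '' Icc (c - S) (c + S), image_mono (subset_univ _),
      isCompact_Icc.image h.continuous_t, ?_⟩
    rintro _ ⟨⟨s, -, rfl⟩, hs⟩
    rw [hf]
    rcases lt_or_ge (c + S) s with h1 | h1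
    · exact hlarge s h1
    · rcases lt_or_ge s (c - S) with h2 | h2
      · rw [← (hsym s).1]
        exact hlarge _ (by linarith)
      · exact absurd (mem_image_of_mem t (mem_Icc.2 ⟨h2, h1⟩)) hs

/-- The generating curves of catenoids are bounded in the direction of the axis when `n ≥ 2`. -/
theorem exists_bounds_t_catenoid (hn : 2 ≤ n) (h : IsSolution n 0 univ x t σ)
    (hE : ∀ s, energy n 0 (x s) (σ s) = E) (hE0 : 0 < E) :
    ∃ a b : ℝ, ∀ s, a < t s ∧ t s < b := by
  have hn1 : 1 ≤ n := by omega
  have hU := h.tiltCos_pos_of_energy_pos hn1 le_rfl hE hE0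
  have hcos : ∀ s, 0 < Real.cos (σ s) := fun s => (tiltCos_pos_iff (h.pos s trivial) _).1 (hU s)
  obtain ⟨c, η, hc, hη, hη'⟩ := h.exists_symmetric_catenoid hn1 hE hE0
  have hsym := h.symmetric hc
  obtain ⟨C, hC, hC'⟩ := h.exists_cos_le_catenoid hn hE hE0
  -- `t + (C / η) / x` decreases on `[c + 1, ∞)`
  have hd : ∀ s, HasDerivAt (fun s => t s + C / η * (x s)⁻¹) _ s := fun s =>
    (h.deriv_t s trivial).add (((h.deriv_x s trivial).inv (h.pos s trivial).ne').const_mul (C / η))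
  have hanti : AntitoneOn (fun s => t s + C / η * (x s)⁻¹) (Ici (c + 1)) := by
    refine antitoneOn_of_deriv_nonpos (convex_Ici _)
      (fun s _ => (hd s).continuousAt.continuousWithinAt)
      (fun s _ => (hd s).differentiableAt.differentiableWithinAt) fun s hs => ?_
    rw [(hd s).deriv]
    have hx := h.pos s trivial
    have h1 := hη' s (interior_subset hs : s ∈ Ici (c + 1))
    have h2 := hC' s
    have h3 : C / x s ^ 2 ≤ C / η * (Real.sin (σ s) / x s ^ 2) := by
      rw [div_mul_div_comm, div_le_div_iff₀ (by positivity) (by positivity)]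
      have : C * η * x s ^ 2 ≤ C * Real.sin (σ s) * x s ^ 2 := by gcongr
      linarith
    have h4 : C / η * (-Real.sin (σ s) / x s ^ 2) = -(C / η * (Real.sin (σ s) / x s ^ 2)) := by ring
    linarith
  set B := t (c + 1) + C / η * (x (c + 1))⁻¹ + 1 with hB
  have hub : ∀ s, t s < B := fun s => by
    have hx := h.pos s trivial
    have hx1 := h.pos (c + 1) trivial
    have h0 : 0 < C / η * (x s)⁻¹ := by positivity
    have h1 : 0 < C / η * (x (c + 1))⁻¹ := by positivity
    rcases le_total (c + 1) s with hs | hs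
    · have : t s + C / η * (x s)⁻¹ ≤ t (c + 1) + C / η * (x (c + 1))⁻¹ :=
        hanti self_mem_Ici hs hs
      linarith
    · have := (h.strictMono_t hcos).monotone hs
      linarith
  refine ⟨2 * t c - B, B, fun s => ⟨?_, hub s⟩⟩
  have := hub (2 * c - s)
  rw [(hsym s).2.1] at this
  linarith

end IsSolution

namespace IsCompleteSolution

variable {n : ℕ} {H E : ℝ} {I : Set ℝ} {x t σ : ℝ → ℝ}

theorem eq_univ_of_energy_ne_zero (hn : 1 ≤ n) (h : IsCompleteSolution n H I x t σ)
    (hE : ∀ s ∈ I, energy n H (x s) (σ s) = E) (hE0 : E ≠ 0) : I = univ := by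
  obtain ⟨m, hm, -, hmx⟩ := h.exists_le_of_energy_ne_zero hn hE hE0
  exact h.eq_univ hm hmx

theorem catenoid_of_pos (hn : 1 ≤ n) (h : IsCompleteSolution n 0 I x t σ)
    (hE : ∀ s ∈ I, energy n 0 (x s) (σ s) = E) (hE0 : 0 < E) :
    IsCatenoidCurve (generatingCurve I x t) ∧
      (2 ≤ n → ∃ a b : ℝ, ∀ q ∈ generatingCurve I x t, a < q.2 ∧ q.2 < b) := by
  obtain rfl := h.eq_univ_of_energy_ne_zero hn hE hE0.ne'
  have hE' := fun s => hE s (mem_univ s)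
  refine ⟨h.isCatenoidCurve hn hE' hE0, fun hn2 => ?_⟩
  obtain ⟨a, b, hab⟩ := h.exists_bounds_t_catenoid hn2 hE' hE0
  refine ⟨a, b, ?_⟩
  rintro _ ⟨s, -, rfl⟩
  exact hab s

theorem catenoid (hn : 1 ≤ n) (h : IsCompleteSolution n 0 I x t σ)
    (hE : ∀ s ∈ I, energy n 0 (x s) (σ s) = E) (hE0 : E ≠ 0) :
    IsCatenoidCurve (generatingCurve I x t) ∧
      (2 ≤ n → ∃ a b : ℝ, ∀ q ∈ generatingCurve I x t, a < q.2 ∧ q.2 < b) := by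
  rcases hE0.lt_or_gt with h0 | h0
  · have hr := h.reverse
    rw [neg_zero] at hr
    rw [← generatingCurve_reverse]
    refine hr.catenoid_of_pos (E := -E) hn (fun s hs => ?_) (by linarith)
    have := energy_add_pi n 0 (x (-s)) (σ (-s))
    rwa [neg_zero, hE _ hs] at this
  · exact h.catenoid_of_pos hn hE h0

end IsCompleteSolution

/-! ### Cylinders and unduloids -/

/-- A function bounded above on `ℝ` cannot eventually have a derivative bounded below by a positive
constant. -/
theorem false_of_le_deriv_of_bounded {f f' : ℝ → ℝ} {a δ B : ℝ} (hδ : 0 < δ)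
    (hf : ∀ s, HasDerivAt f (f' s) s) (hf' : ∀ s, a ≤ s → δ ≤ f' s) (hB : ∀ s, f s ≤ B) :
    False := by
  have h0 : 0 ≤ (B - f a) / δ := div_nonneg (by linarith [hB a]) hδ.le
  have h1 := (convex_Ici a).mul_sub_le_image_sub_of_le_deriv (f := f) (C := δ)
    (fun s _ => (hf s).continuousAt.continuousWithinAt)
    (fun s _ => (hf s).differentiableAt.differentiableWithinAt)
    (fun s hs => by rw [(hf s).deriv]; exact hf' s (interior_subset hs : s ∈ Ici a))
    a self_mem_Ici (a + (B - f a) / δ + 1) (by simp only [mem_Ici]; linarith) (by linarith)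
  have h2 := hB (a + (B - f a) / δ + 1)
  have h3 : δ * (a + (B - f a) / δ + 1 - a) = B - f a + δ := by field_simp; ring
  linarith

theorem curvatureFactor_eq (n : ℕ) (H U : ℝ) {x : ℝ} (hx : 0 < x) :
    curvatureFactor n H x U = U ^ 3 - U - x * tiltSlope n H x U := by
  rw [curvatureFactor, tiltSlope, mul_div_cancel₀ _ hx.ne']
  ring

theorem two_mul_sub_one_pos {n : ℕ} (hn : 1 ≤ n) : (0 : ℝ) < 2 * n - 1 := by
  have : (1 : ℝ) ≤ n := by exact_mod_cast hn
  linarith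

theorem image_Icc_of_strictMono {t : ℝ → ℝ} (ht : StrictMono t) (hs : Function.Surjective t) (a b : ℝ) :
    t '' Icc a b = Icc (t a) (t b) := by
  ext τ
  obtain ⟨s, rfl⟩ := hs τ
  rw [ht.injective.mem_set_image]
  simp only [mem_Icc, ht.le_iff_le]

theorem tiltCos_eq_one {x σ : ℝ} (hx : 0 < x) (hs : Real.sin σ = 0) (hU : 0 < tiltCos x σ) :
    tiltCos x σ = 1 := by
  have h1 := tiltCos_sq_add_tiltSin_sq hx σ
  rw [(tiltSin_eq_zero_iff hx σ).2 hs] at h1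
  nlinarith

namespace IsSolution

variable {n : ℕ} {H E : ℝ} {x t σ : ℝ → ℝ}

/-- The slope `W` is the derivative of `x ↦ E / x^{2n-1} + H x`. -/
theorem tiltSlope_eq (hn : 1 ≤ n) (h : IsSolution n H univ x t σ)
    (hE : ∀ s, energy n H (x s) (σ s) = E) (s : ℝ) :
    tiltSlope n H (x s) (tiltCos (x s) (σ s)) = H - (2 * n - 1) * E / x s ^ (2 * n) := by
  have hx := h.pos s trivial
  rw [tiltCos_eq_of_energy hn hx (hE s), tiltSlope]
  obtain ⟨k, hk⟩ : ∃ k, 2 * n = k + 1 := ⟨2 * n - 1, by omega⟩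
  have hkR : (2 * n : ℝ) = k + 1 := by exact_mod_cast hk
  rw [hk, Nat.add_sub_cancel, hkR]
  field_simp
  ring

theorem tiltSlope_le (hn : 1 ≤ n) (h : IsSolution n H univ x t σ)
    (hE : ∀ s, energy n H (x s) (σ s) = E) (hE0 : 0 < E) {r s : ℝ} (hrs : x r ≤ x s) :
    tiltSlope n H (x r) (tiltCos (x r) (σ r)) ≤ tiltSlope n H (x s) (tiltCos (x s) (σ s)) := by
  have hr := h.pos r trivial
  have hn' := two_mul_sub_one_pos hn
  rw [h.tiltSlope_eq hn hE, h.tiltSlope_eq hn hE]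
  gcongr

theorem tiltSlope_lt (hn : 1 ≤ n) (h : IsSolution n H univ x t σ)
    (hE : ∀ s, energy n H (x s) (σ s) = E) (hE0 : 0 < E) {r s : ℝ} (hrs : x r < x s) :
    tiltSlope n H (x r) (tiltCos (x r) (σ r)) < tiltSlope n H (x s) (tiltCos (x s) (σ s)) := by
  have hr := h.pos r trivial
  have hn' := two_mul_sub_one_pos hn
  rw [h.tiltSlope_eq hn hE, h.tiltSlope_eq hn hE]
  have : 2 * n ≠ 0 := by omega
  gcongr

theorem sin_symmetric (h : IsSolution n H univ x t σ) {c : ℝ} (hc : Real.sin (σ c) = 0) (s : ℝ) :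
    Real.sin (σ (2 * c - s)) = -Real.sin (σ s) := by
  have hs2 : Real.sin (2 * σ c) = 0 := by rw [Real.sin_two_mul, hc]; ring
  have hc2 : Real.cos (2 * σ c) = 1 := by
    rw [Real.cos_two_mul']; nlinarith [Real.sin_sq_add_cos_sq (σ c)]
  rw [(h.symmetric hc s).2.2, Real.sin_sub, hs2, hc2]
  ring

theorem le_inv_of_energy_pos (hn : 1 ≤ n) (hH : 0 < H) (h : IsSolution n H univ x t σ)
    (hE : ∀ s, energy n H (x s) (σ s) = E) (hE0 : 0 < E) (s : ℝ) : x s ≤ 1 / H := by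
  have hx := h.pos s trivial
  have h1 := tiltCos_le_one hx (σ s)
  rw [tiltCos_eq_of_energy hn hx (hE s)] at h1
  have : 0 < E / x s ^ (2 * n - 1) := by positivity
  rw [le_div_iff₀ hH]
  linarith

theorem exists_le_cos (hn : 1 ≤ n) (hH : 0 < H) (h : IsSolution n H univ x t σ)
    (hE : ∀ s, energy n H (x s) (σ s) = E) (hE0 : 0 < E) :
    ∃ δ > 0, ∀ s, δ ≤ Real.cos (σ s) := by
  obtain ⟨m, hm, hm1, hmx⟩ := h.exists_le_of_energy_ne_zero hn (fun s _ => hE s) hE0.ne'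
  refine ⟨E / (1 / H) ^ (2 * n - 1) * m, by positivity, fun s => ?_⟩
  have hx := h.pos s trivial
  have hxM := h.le_inv_of_energy_pos hn hH hE hE0 s
  have hQ := le_tiltNorm hm hm1 (hmx s trivial) (σ s)
  have hU : E / (1 / H) ^ (2 * n - 1) ≤ tiltCos (x s) (σ s) := by
    rw [tiltCos_eq_of_energy hn hx (hE s)]
    have : E / (1 / H) ^ (2 * n - 1) ≤ E / x s ^ (2 * n - 1) := by gcongr
    have : 0 < H * x s := by positivity
    linarith
  have hU0 : 0 < tiltCos (x s) (σ s) := lt_of_lt_of_le (by positivity) hU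
  rw [cos_eq_tiltCos_mul hx]
  gcongr

/-- Along a solution with `H > 0` and `E > 0` the distance to the axis oscillates forever. -/
theorem exists_sin_eq_zero (hn : 1 ≤ n) (hH : 0 < H) (h : IsSolution n H univ x t σ)
    (hE : ∀ s, energy n H (x s) (σ s) = E) (hE0 : 0 < E) (a : ℝ) :
    ∃ s, a < s ∧ Real.sin (σ s) = 0 := by
  by_contra! hne
  obtain ⟨m, hm, hm1, hmx⟩ := h.exists_le_of_energy_ne_zero hn (fun s _ => hE s) hE0.ne'
  obtain ⟨κ, hκ, hcos⟩ := h.exists_le_cos hn hH hE hE0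
  have hxM := h.le_inv_of_energy_pos hn hH hE hE0
  set M := 1 / H with hM
  have hM0 : 0 < M := by positivity
  -- `ε = ±1` is the sign of `x'` on `(a, ∞)`
  obtain ⟨ε, hε, hpos⟩ : ∃ ε : ℝ, (ε = 1 ∨ ε = -1) ∧ ∀ s, a < s → 0 < ε * Real.sin (σ s) := by
    have hcont : ContinuousOn (fun s => Real.sin (σ s)) (Ioi a) := fun s _ =>
      (h.deriv_σ s trivial).sin.continuousAt.continuousWithinAt
    by_contra! hcon
    obtain ⟨r, hr, hr'⟩ := hcon 1 (Or.inl rfl)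
    obtain ⟨s, hs, hs'⟩ := hcon (-1) (Or.inr rfl)
    obtain ⟨q, hq, hq'⟩ := (convex_Ioi a).isPreconnected.intermediate_value hr hs hcont
      (⟨by linarith, by linarith⟩ : (0 : ℝ) ∈ Icc _ _)
    exact hne q hq hq'
  have hmono : StrictMonoOn (fun s => ε * x s) (Ioi a) := by
    have hd : ∀ s, HasDerivAt (fun s => ε * x s) _ s := fun s =>
      (h.deriv_x s trivial).const_mul ε
    refine strictMonoOn_of_deriv_pos (convex_Ioi a)
      (fun s _ => (hd s).continuousAt.continuousWithinAt) fun s hs => ?_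
    rw [(hd s).deriv]
    exact hpos s (interior_subset hs)
  set W := fun s => tiltSlope n H (x s) (tiltCos (x s) (σ s)) with hW
  have hWmono : ∀ r s, a < r → r ≤ s → ε * W r ≤ ε * W s := fun r s hr hrs => by
    have h1 : ε * x r ≤ ε * x s := hmono.monotoneOn hr (hr.trans_le hrs) hrs
    rcases hε with rfl | rfl
    · have := h.tiltSlope_le hn hE hE0 (r := r) (s := s) (by linarith)
      simpa [hW] using this
    · have := h.tiltSlope_le hn hE hE0 (r := s) (s := r) (by linarith)
      simpa [hW] using this
  have hV : ∀ s, HasDerivAt (fun s => tiltSin (x s) (σ s)) (-(Real.cos (σ s) / x s * W s)) s :=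
    fun s => h.hasDerivAt_tiltSin trivial
  have habs : ∀ y B : ℝ, |y| ≤ B → ε * y ≤ B ∧ -ε * y ≤ B := fun y B hy => by
    rcases hε with rfl | rfl <;> constructor <;> linarith [abs_le.1 hy]
  by_cases hcase : ∀ s, a + 1 ≤ s → ε * W s ≤ 0
  · -- the tilt does not decrease, so `x` moves at a definite speed
    have hd : ∀ s, HasDerivAt (fun s => ε * tiltSin (x s) (σ s)) _ s := fun s =>
      (hV s).const_mul ε
    have hVmono : MonotoneOn (fun s => ε * tiltSin (x s) (σ s)) (Ici (a + 1)) := by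
      refine monotoneOn_of_deriv_nonneg (convex_Ici _)
        (fun s _ => (hd s).continuousAt.continuousWithinAt)
        (fun s _ => (hd s).differentiableAt.differentiableWithinAt) fun s hs => ?_
      rw [(hd s).deriv]
      have h1 := hcase s (interior_subset hs : s ∈ Ici (a + 1))
      have h2 : 0 < Real.cos (σ s) / x s := div_pos (hκ.trans_le (hcos s)) (h.pos s trivial)
      nlinarith
    set v := ε * tiltSin (x (a + 1)) (σ (a + 1)) with hv
    have hv0 : 0 < v := by
      have h1 := hpos (a + 1) (by linarith)
      have hx := h.pos (a + 1) trivial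
      rw [hv, tiltSin]
      have h2 := tiltNorm_pos hx (σ (a + 1))
      have : ε * (x (a + 1) * Real.sin (σ (a + 1)) / tiltNorm (x (a + 1)) (σ (a + 1)))
        = (ε * Real.sin (σ (a + 1))) * x (a + 1) / tiltNorm (x (a + 1)) (σ (a + 1)) := by ring
      rw [this]
      positivity
    refine false_of_le_deriv_of_bounded (f := fun s => ε * x s) (a := a + 1) (B := M)
      (δ := v * m / M) (by positivity) (fun s => (h.deriv_x s trivial).const_mul ε)
      (fun s hs => ?_) (fun s => (habs _ _ ?_).1)
    · have hx := h.pos s trivial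
      have h1 : v ≤ ε * tiltSin (x s) (σ s) := hVmono self_mem_Ici hs hs
      have h2 := le_tiltNorm hm hm1 (hmx s trivial) (σ s)
      have h3 := hxM s
      rw [sin_eq_tiltSin_mul hx, ← mul_div_assoc, ← mul_assoc]
      have h4 := hv0.trans_le h1
      have h5 := hm.trans_le h2
      gcongr
    · rw [abs_of_pos (h.pos s trivial)]; exact hxM s
  · -- the tilt changes at a definite rate
    push Not at hcase
    obtain ⟨b, hb, hWb⟩ := hcase
    refine false_of_le_deriv_of_bounded (f := fun s => -ε * tiltSin (x s) (σ s)) (a := b) (B := 1)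
      (δ := κ / M * (ε * W b)) (by positivity) (fun s => (hV s).const_mul (-ε))
      (fun s hs => ?_) (fun s => (habs _ _ ?_).2)
    · have hx := h.pos s trivial
      have h1 := hWmono b s (by linarith) hs
      have h2 := hcos s
      have h3 := hxM s
      have h4 : -ε * -(Real.cos (σ s) / x s * W s) = Real.cos (σ s) / x s * (ε * W s) := by ring
      rw [h4]
      have h5 := hκ.trans_le h2
      gcongr
    · exact abs_tiltSin_le_one (h.pos s trivial) _

/-- A solution which at some point has the radius of the cylinder and a tangent parallel to the axis
generates the cylinder. -/
theorem eq_cylinder (hn : 1 ≤ n) (hH : 0 < H) (h : IsSolution n H univ x t σ) {c : ℝ}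
    (hc : Real.sin (σ c) = 0) (hc' : 0 < Real.cos (σ c)) (hx : x c = (2 * n - 1) / (2 * n * H))
    (s : ℝ) : x s = (2 * n - 1) / (2 * n * H) := by
  have hcos : Real.cos (σ c) = 1 := by
    have := Real.sin_sq_add_cos_sq (σ c)
    rw [hc] at this
    nlinarith
  have hn0 : (0 : ℝ) < n := by exact_mod_cast hn
  have hn' := two_mul_sub_one_pos hn
  set R : ℝ := (2 * n - 1) / (2 * n * H) with hR
  have hR0 : 0 < R := by positivity
  have hsol : IsSolution n H univ (fun _ => R) (fun s => t c + (s - c)) (fun _ => σ c) := by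
    refine ⟨isOpen_univ, ordConnected_univ, univ_nonempty, fun s _ => hR0, fun s _ => ?_,
      fun s _ => ?_, fun s _ => ?_⟩
    · rw [hc]; exact hasDerivAt_const _ _
    · rw [hcos]; simpa using ((hasDerivAt_id s).sub_const c).const_add (t c)
    · refine (hasDerivAt_const s (σ c)).congr_deriv ?_
      have : 2 * n * H * R = 2 * n - 1 := by rw [hR]; field_simp
      simp only [hc, hcos]
      norm_num
      field_simp
      linarith
  exact ((h.unique hsol (mem_univ c) hx (by ring) rfl) s trivial).1

/-- Unless it is a cylinder, a solution with `H > 0` and `E > 0` has two consecutive critical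
points of `x`, the first a minimum and the second a maximum. -/
theorem exists_half_period (hn : 1 ≤ n) (hH : 0 < H) (h : IsSolution n H univ x t σ)
    (hE : ∀ s, energy n H (x s) (σ s) = E) (hE0 : 0 < E) :
    (∀ s, x s = (2 * n - 1) / (2 * n * H)) ∨
      ∃ c c', c < c' ∧ Real.sin (σ c) = 0 ∧ Real.sin (σ c') = 0 ∧
        ∀ s ∈ Ioo c c', 0 < Real.sin (σ s) := by
  have hn0 : (0 : ℝ) < n := by exact_mod_cast hn
  have hU := h.tiltCos_pos_of_energy_pos hn hH.le hE hE0
  have hcos : ∀ s, 0 < Real.cos (σ s) := fun s => (tiltCos_pos_iff (h.pos s trivial) _).1 (hU s)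
  have hzero := h.exists_sin_eq_zero hn hH hE hE0
  have hcont : Continuous fun s => Real.sin (σ s) :=
    continuous_iff_continuousAt.2 fun s => (h.deriv_σ s trivial).sin.continuousAt
  obtain ⟨c, -, hc⟩ := hzero 0
  have hxc := h.pos c trivial
  by_cases hW : tiltSlope n H (x c) (tiltCos (x c) (σ c)) = 0
  · left
    refine h.eq_cylinder hn hH hc (hcos c) ?_
    rw [tiltCos_eq_one hxc hc (hU c), tiltSlope, div_eq_zero_iff, or_iff_left hxc.ne'] at hW
    rw [eq_div_iff (by positivity)]
    linarith
  right
  -- the zeros of `sin σ` are isolated, so there is a next one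
  have hne : ∀ᶠ s in 𝓝[≠] c, tiltSin (x s) (σ s) ≠ 0 := by
    refine (h.hasDerivAt_tiltSin (mem_univ c)).eventually_ne ?_
    exact neg_ne_zero.2 (mul_ne_zero (div_ne_zero (hcos c).ne' hxc.ne') hW)
  obtain ⟨d, hd, hd'⟩ := mem_nhdsGT_iff_exists_Ioo_subset.1
    (hne.filter_mono (nhdsWithin_mono c fun s (hs : c < s) => hs.ne'))
  have hd : c < d := hd
  set Z := {s | (c + d) / 2 ≤ s ∧ Real.sin (σ s) = 0} with hZ
  have hZc : IsClosed Z := isClosed_Ici.inter (isClosed_eq hcont continuous_const)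
  have hZne : Z.Nonempty := by
    obtain ⟨s, hs, hs'⟩ := hzero ((c + d) / 2)
    exact ⟨s, hs.le, hs'⟩
  have hZb : BddBelow Z := ⟨(c + d) / 2, fun s hs => hs.1⟩
  obtain ⟨h1, hc'⟩ := hZc.csInf_mem hZne hZb
  set c' := sInf Z with hc'def
  have hcc' : c < c' := by linarith
  have hno : ∀ s ∈ Ioo c c', Real.sin (σ s) ≠ 0 := fun s hs h0 => by
    rcases lt_or_ge s ((c + d) / 2) with h2 | h2
    · exact hd' ⟨hs.1, by linarith⟩ ((tiltSin_eq_zero_iff (h.pos s trivial) _).2 h0)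
    · exact absurd (csInf_le hZb (⟨h2, h0⟩ : s ∈ Z)) (not_le.2 hs.2)
  by_cases hp : ∀ s ∈ Ioo c c', 0 < Real.sin (σ s)
  · exact ⟨c, c', hcc', hc, hc', hp⟩
  · push Not at hp
    obtain ⟨r, hr, hr'⟩ := hp
    have hneg : ∀ s ∈ Ioo c c', Real.sin (σ s) < 0 := fun s hs => by
      by_contra! hs'
      obtain ⟨q, hq, hq'⟩ := (convex_Ioo c c').isPreconnected.intermediate_value hr hs
        hcont.continuousOn (⟨hr', hs'⟩ : (0 : ℝ) ∈ Icc _ _)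
      exact hno q hq hq'
    refine ⟨c', 2 * c' - c, by linarith, hc', by rw [h.sin_symmetric hc', hc, neg_zero],
      fun s hs => ?_⟩
    have := hneg (2 * c' - s) ⟨by linarith [hs.2], by linarith [hs.1]⟩
    rw [h.sin_symmetric hc'] at this
    linarith

theorem hasDerivAt_curvatureFactor (h : IsSolution n H univ x t σ) (s : ℝ) :
    HasDerivAt (fun s => curvatureFactor n H (x s) (tiltCos (x s) (σ s)))
      (Real.sin (σ s) * ((3 * tiltCos (x s) (σ s) ^ 2 + 2 * (n - 1)) *
        tiltSlope n H (x s) (tiltCos (x s) (σ s)) - 2 * n * H)) s := by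
  have hU := h.hasDerivAt_tiltCos (mem_univ s)
  refine (((hU.pow 3).add (hU.const_mul (2 * ((n : ℝ) - 1)))).sub
    ((h.deriv_x s trivial).const_mul (2 * n * H))).congr_deriv ?_
  push_cast
  ring

/-- Between a minimum and the next maximum of `x` the curvature changes sign exactly once: as long as
`W < 0` the factor `G` decreases, and where `W ≥ 0` it is negative. -/
theorem exists_inflection (hn : 1 ≤ n) (hH : 0 < H) (h : IsSolution n H univ x t σ)
    (hE : ∀ s, energy n H (x s) (σ s) = E) (hE0 : 0 < E) {c c' : ℝ} (hcc' : c < c')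
    (hc : Real.sin (σ c) = 0) (hc' : Real.sin (σ c') = 0)
    (hpos : ∀ s ∈ Ioo c c', 0 < Real.sin (σ s)) :
    ∃ l ∈ Ioo c c',
      (∀ s ∈ Ioo c l, 0 < curvatureFactor n H (x s) (tiltCos (x s) (σ s))) ∧
      ∀ s ∈ Ioo l c', curvatureFactor n H (x s) (tiltCos (x s) (σ s)) < 0 := by
  have hn1 : (1 : ℝ) ≤ n := by exact_mod_cast hn
  have hU := h.tiltCos_pos_of_energy_pos hn hH.le hE hE0
  have hcos : ∀ s, 0 < Real.cos (σ s) := fun s => (tiltCos_pos_iff (h.pos s trivial) _).1 (hU s)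
  have hxmono : StrictMonoOn x (Icc c c') := by
    refine strictMonoOn_of_deriv_pos (convex_Icc _ _)
      (fun s _ => (h.deriv_x s trivial).continuousAt.continuousWithinAt) fun s hs => ?_
    rw [interior_Icc] at hs
    rw [(h.deriv_x s trivial).deriv]
    exact hpos s hs
  set W := fun s => tiltSlope n H (x s) (tiltCos (x s) (σ s)) with hW
  have hWmono : StrictMonoOn W (Icc c c') := fun r hr s hs hrs =>
    h.tiltSlope_lt hn hE hE0 (hxmono hr hs hrs)
  have hl : c ∈ Icc c c' := left_mem_Icc.2 hcc'.le
  have hr : c' ∈ Icc c c' := right_mem_Icc.2 hcc'.le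
  have hV : ∀ s, HasDerivAt (fun s => tiltSin (x s) (σ s)) (-(Real.cos (σ s) / x s * W s)) s :=
    fun s => h.hasDerivAt_tiltSin trivial
  have hVc : tiltSin (x c) (σ c) = 0 := (tiltSin_eq_zero_iff (h.pos c trivial) _).2 hc
  have hVc' : tiltSin (x c') (σ c') = 0 := (tiltSin_eq_zero_iff (h.pos c' trivial) _).2 hc'
  have hq : ∀ s, 0 < Real.cos (σ s) / x s := fun s => div_pos (hcos s) (h.pos s trivial)
  -- `W` increases, and changes sign since `V' = -(cos σ / x) W` and `V` returns to `0`
  have hWc : W c < 0 := by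
    by_contra! hcon
    have : StrictAntiOn (fun s => tiltSin (x s) (σ s)) (Icc c c') := by
      refine strictAntiOn_of_deriv_neg (convex_Icc _ _)
        (fun s _ => (hV s).continuousAt.continuousWithinAt) fun s hs => ?_
      rw [interior_Icc] at hs
      rw [(hV s).deriv, neg_lt_zero]
      exact mul_pos (hq s) (hcon.trans_lt (hWmono hl (Ioo_subset_Icc_self hs) hs.1))
    have := this hl hr hcc'
    simp only [hVc, hVc', lt_irrefl] at this
  have hWc' : 0 < W c' := by
    by_contra! hcon
    have : StrictMonoOn (fun s => tiltSin (x s) (σ s)) (Icc c c') := by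
      refine strictMonoOn_of_deriv_pos (convex_Icc _ _)
        (fun s _ => (hV s).continuousAt.continuousWithinAt) fun s hs => ?_
      rw [interior_Icc] at hs
      rw [(hV s).deriv, neg_pos]
      exact mul_neg_of_pos_of_neg (hq s)
        ((hWmono (Ioo_subset_Icc_self hs) hr hs.2).trans_le hcon)
    have := this hl hr hcc'
    simp only [hVc, hVc', lt_irrefl] at this
  set g := fun s => curvatureFactor n H (x s) (tiltCos (x s) (σ s)) with hg
  have hgeq : ∀ s, g s = tiltCos (x s) (σ s) ^ 3 - tiltCos (x s) (σ s) - x s * W s := fun s =>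
    curvatureFactor_eq n H _ (h.pos s trivial)
  have hgc : 0 < g c := by
    rw [hgeq, tiltCos_eq_one (h.pos c trivial) hc (hU c)]
    nlinarith [h.pos c trivial]
  have hgneg : ∀ s ∈ Ioc c c', 0 ≤ W s → g s < 0 := fun s hs hWs => by
    have hx := h.pos s trivial
    rw [hgeq]
    rcases hs.2.eq_or_lt with rfl | hlt
    · rw [tiltCos_eq_one hx hc' (hU _)]
      nlinarith
    · have h1 := hU s
      have h2 := (tiltSin_pos_iff hx _).2 (hpos s ⟨hs.1, hlt⟩)
      have h3 := tiltCos_sq_add_tiltSin_sq hx (σ s)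
      have h4 : tiltCos (x s) (σ s) ^ 2 < 1 := by nlinarith
      have h5 : 0 ≤ x s * W s := by positivity
      nlinarith
  have hgd : ∀ s, HasDerivAt g _ s := h.hasDerivAt_curvatureFactor
  have hganti : ∀ a b, c ≤ a → b ≤ c' → W b < 0 → StrictAntiOn g (Icc a b) :=
    fun a b ha hb hWb => by
      refine strictAntiOn_of_deriv_neg (convex_Icc _ _)
        (fun s _ => (hgd s).continuousAt.continuousWithinAt) fun s hs => ?_
      rw [interior_Icc] at hs
      have hs1 : s ∈ Ioo c c' := ⟨ha.trans_lt hs.1, hs.2.trans_le hb⟩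
      have h1 : W s < 0 := (hWmono (Ioo_subset_Icc_self hs1)
        ⟨(hs1.1.trans hs.2).le, hb⟩ hs.2).trans hWb
      rw [(hgd s).deriv]
      refine mul_neg_of_pos_of_neg (hpos s hs1) ?_
      have h2 : 0 ≤ 3 * tiltCos (x s) (σ s) ^ 2 + 2 * ((n : ℝ) - 1) := by
        have : (0 : ℝ) ≤ n - 1 := by linarith
        positivity
      have h3 : 0 < 2 * n * H := by positivity
      have h4 := mul_nonpos_of_nonneg_of_nonpos h2 h1.le
      change _ * W s - _ < 0
      linarith
  obtain ⟨l, hlm, hgl⟩ := (convex_Icc c c').isPreconnected.intermediate_value hr hl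
    (fun s _ => (hgd s).continuousAt.continuousWithinAt)
    (⟨(hgneg c' ⟨hcc', le_rfl⟩ hWc'.le).le, hgc.le⟩ : (0 : ℝ) ∈ Icc _ _)
  have hgl : g l = 0 := hgl
  have hcl : c < l := lt_of_le_of_ne hlm.1 fun e => by rw [e] at hgc; linarith
  have hlc : l < c' := lt_of_le_of_ne hlm.2 fun e => by
    have := hgneg c' ⟨hcc', le_rfl⟩ hWc'.le
    rw [← e] at this; linarith
  have hWl : W l < 0 := by
    by_contra! hcon
    linarith [hgneg l ⟨hcl, hlm.2⟩ hcon]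
  refine ⟨l, ⟨hcl, hlc⟩, fun s hs => ?_, fun s hs => ?_⟩
  · have := hganti c l le_rfl hlm.2 hWl ⟨hs.1.le, hs.2.le⟩ (right_mem_Icc.2 hcl.le) hs.2
    linarith
  · rcases lt_or_ge (W s) 0 with h1 | h1
    · have := hganti l s hlm.1 hs.2.le h1 (left_mem_Icc.2 hs.1.le) (right_mem_Icc.2 hs.1.le) hs.1
      change g s < 0
      linarith
    · exact hgneg s ⟨hcl.trans hs.1, hs.2.le⟩ h1

theorem cylinder_or_unduloid (hn : 1 ≤ n) (hH : 0 < H) (h : IsSolution n H univ x t σ)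
    (hE : ∀ s, energy n H (x s) (σ s) = E) (hE0 : 0 < E) :
    (∃ (f : ℝ → ℝ) (P : ℝ), 0 < P ∧ Function.Periodic f P ∧
        generatingCurve univ x t = graphOver univ f) ∧
      (generatingCurve univ x t = graphOver univ (fun _ => (2 * n - 1) / (2 * n * H)) ∨
        IsUnduloidCurve (generatingCurve univ x t)) := by
  obtain ⟨δ, hδ, hcosδ⟩ := h.exists_le_cos hn hH hE hE0
  have hcos : ∀ s, 0 < Real.cos (σ s) := fun s => hδ.trans_le (hcosδ s)
  have hcos0 : ∀ s ∈ univ, Real.cos (σ s) ≠ 0 := fun s _ => (hcos s).ne'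
  have hinj := h.injOn_t hcos0
  have htmono := h.strictMono_t hcos
  have hsurj : Function.Surjective t := surjective_of_le_deriv hδ (fun s => h.deriv_t s trivial) hcosδ
  set f := graphFun univ x t with hfdef
  have hf : ∀ s, f (t s) = x s := fun s => graphFun_apply hinj trivial
  have hC : generatingCurve univ x t = graphOver univ f := by
    rw [generatingCurve_eq_graphOver hinj, image_univ_of_surjective hsurj]
  rcases h.exists_half_period hn hH hE hE0 with hcyl | ⟨c, c', hcc', hc, hc', hpos⟩
  · have hC' : generatingCurve univ x t = graphOver univ (fun _ => (2 * n - 1) / (2 * n * H)) := by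
      rw [hC, show f = fun _ => (2 * n - 1) / (2 * n * H) from funext fun τ => by
        obtain ⟨s, rfl⟩ := hsurj τ
        rw [hf, hcyl]]
    exact ⟨⟨_, 1, one_pos, fun _ => rfl, hC'⟩, Or.inl hC'⟩
  · obtain ⟨l, hl, hl1, hl2⟩ := h.exists_inflection hn hH hE hE0 hcc' hc hc' hpos
    have hper : Function.Periodic f (2 * (t c' - t c)) := fun τ => by
      obtain ⟨s, rfl⟩ := hsurj τ
      obtain ⟨h1, h2, -⟩ := h.periodic hc hc' s
      rw [← h2, hf, hf, h1]
    have hP : 0 < 2 * (t c' - t c) := by linarith [htmono hcc']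
    have hend : t c + 2 * (t c' - t c) / 2 = t c' := by ring
    refine ⟨⟨f, _, hP, hper, hC⟩, Or.inr ⟨f, 2 * (t c' - t c), t c, t l - t c,
      by linarith [htmono hl.1], by linarith [htmono hl.2], fun τ => ?_, hper, fun τ => ?_, ?_, ?_,
      ?_, hC⟩⟩
    · obtain ⟨s, rfl⟩ := hsurj τ
      rw [hf]; exact h.pos s trivial
    · obtain ⟨s, rfl⟩ := hsurj τ
      obtain ⟨h1, h2, -⟩ := h.symmetric hc s
      rw [← h2, hf, hf, h1]
    · rw [hend, ← image_Icc_of_strictMono htmono hsurj]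
      rintro _ ⟨r, hr, rfl⟩ _ ⟨s, hs, rfl⟩ hrs
      rw [hf, hf]
      refine strictMonoOn_of_deriv_pos (convex_Icc c c')
        (fun s _ => (h.deriv_x s trivial).continuousAt.continuousWithinAt) (fun s hs => ?_) hr hs
        (htmono.lt_iff_lt.1 hrs)
      rw [interior_Icc] at hs
      rw [(h.deriv_x s trivial).deriv]
      exact hpos s hs
    · rw [add_sub_cancel, ← image_Icc_of_strictMono htmono hsurj]
      refine h.strictConvexOn_graphFun hcos (convex_Icc _ _) ?_
      rwa [interior_Icc]
    · rw [add_sub_cancel, hend, ← image_Icc_of_strictMono htmono hsurj]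
      refine h.strictConcaveOn_graphFun hcos (convex_Icc _ _) ?_
      rwa [interior_Icc]

end IsSolution

/-- The rotation of a line parallel to the axis is a cylinder. -/
theorem generatedHypersurface_of_graphOver_const {n : ℕ} {I : Set ℝ} {x t : ℝ → ℝ} {R : ℝ}
    (hR : 0 < R) (hC : generatingCurve I x t = graphOver univ fun _ => R) :
    generatedHypersurface n I x t = {p | ‖p.1‖ = R} := by
  have hmem : ∀ a b, (a, b) ∈ generatingCurve I x t ↔ a = R := fun a b => by
    rw [hC]
    constructor
    · rintro ⟨τ, -, he⟩
      exact (congrArg Prod.fst he).symm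
    · rintro rfl
      exact ⟨b, trivial, rfl⟩
  have hx : ∀ s ∈ I, R ≤ x s := fun s hs => ((hmem _ _).1 (mem_image_of_mem _ hs)).ge
  ext p
  constructor
  · intro hp
    have h0 := fst_ne_zero_of_mem_generatedHypersurface hR hx hp
    exact (hmem _ _).1 ((mem_generatedHypersurface_of_ne (fun s hs => hR.trans_le (hx s hs)) h0).1 hp)
  · intro hp
    exact (mem_generatedHypersurface fun s hs => hR.trans_le (hx s hs)).2 (Or.inl ((hmem _ _).2 hp))

namespace IsCompleteSolution

variable {n : ℕ} {H E : ℝ} {I : Set ℝ} {x t σ : ℝ → ℝ}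

theorem cylinder_or_unduloid_of_pos (hn : 1 ≤ n) (hH : 0 < H) (h : IsCompleteSolution n H I x t σ)
    (hE : ∀ s ∈ I, energy n H (x s) (σ s) = E) (hE0 : 0 < E) :
    (∀ s ∈ I, Real.cos (σ s) ≠ 0) ∧
    (∃ (f : ℝ → ℝ) (P : ℝ), 0 < P ∧ Function.Periodic f P ∧
        generatingCurve I x t = graphOver univ f) ∧
      (generatedHypersurface n I x t = {p | ‖p.1‖ = (2 * n - 1) / (2 * n * |H|)} ∨
        IsUnduloidCurve (generatingCurve I x t)) := by
  obtain rfl := h.eq_univ_of_energy_ne_zero hn hE hE0.ne'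
  have hE' := fun s => hE s (mem_univ s)
  have hn0 : (0 : ℝ) < n := by exact_mod_cast hn
  have hn' := two_mul_sub_one_pos hn
  obtain ⟨δ, hδ, hcosδ⟩ := h.exists_le_cos hn hH hE' hE0
  refine ⟨fun s _ => (hδ.trans_le (hcosδ s)).ne', ?_⟩
  refine (h.cylinder_or_unduloid hn hH hE' hE0).imp id (Or.imp_left fun hC => ?_)
  rw [abs_of_pos hH]
  exact generatedHypersurface_of_graphOver_const (by positivity) hC

theorem cylinder_or_unduloid (hn : 1 ≤ n) (h : IsCompleteSolution n H I x t σ)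
    (hE : ∀ s ∈ I, energy n H (x s) (σ s) = E) (hEH : 0 < E * H) :
    (∀ s ∈ I, Real.cos (σ s) ≠ 0) ∧
    (∃ (f : ℝ → ℝ) (P : ℝ), 0 < P ∧ Function.Periodic f P ∧
        generatingCurve I x t = graphOver univ f) ∧
      (generatedHypersurface n I x t = {p | ‖p.1‖ = (2 * n - 1) / (2 * n * |H|)} ∨
        IsUnduloidCurve (generatingCurve I x t)) := by
  rcases pos_and_pos_or_neg_and_neg_of_mul_pos hEH with ⟨hE0, hH⟩ | ⟨hE0, hH⟩
  · exact h.cylinder_or_unduloid_of_pos hn hH hE hE0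
  · have := h.reverse.cylinder_or_unduloid_of_pos (E := -E) hn (neg_pos.2 hH)
      (fun s hs => by rw [energy_add_pi, hE _ hs]) (neg_pos.2 hE0)
    rw [generatingCurve_reverse, generatedHypersurface_reverse h.pos, abs_neg] at this
    refine ⟨fun s hs h0 => ?_, this.2⟩
    have h1 := this.1 (-s) (by simpa using hs)
    rw [neg_neg, Real.cos_add_pi, h0, neg_zero] at h1
    exact h1 rfl

end IsCompleteSolution

/-! ### Nodoids -/

theorem energy_pi_sub (n : ℕ) (H x σ : ℝ) :
    energy n (-H) x (Real.pi - σ) = -energy n H x σ := by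
  simp only [energy, Real.cos_pi_sub, Real.sin_pi_sub, neg_sq]
  ring

namespace IsSolution

variable {n : ℕ} {H E : ℝ} {x t σ : ℝ → ℝ}

/-- For `H > 0 > E` one has `G ≤ -Hx`, and `σ' < 0` is bounded away from zero. -/
theorem exists_deriv_σ_le (hn : 1 ≤ n) (hH : 0 < H) (h : IsSolution n H univ x t σ)
    (hE : ∀ s, energy n H (x s) (σ s) = E) (hE0 : E < 0) :
    ∃ δ > 0, ∀ s, (tiltNorm (x s) (σ s) / x s) ^ 3 *
      curvatureFactor n H (x s) (tiltCos (x s) (σ s)) ≤ -δ := by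
  obtain ⟨m, hm, hm1, hmx⟩ := h.exists_le_of_energy_ne_zero hn (fun s _ => hE s) hE0.ne
  have hn1 : (0 : ℝ) ≤ n - 1 := by
    have : (1 : ℝ) ≤ n := by exact_mod_cast hn
    linarith
  set M := (1 + -E / m ^ (2 * n - 1)) / H with hM
  have hE1 : 0 < -E := by linarith
  have hM0 : 0 < M := by positivity
  refine ⟨(m / M) ^ 3 * (H * m), by positivity, fun s => ?_⟩
  have hx := h.pos s trivial
  have hmx := hmx s trivial
  have hU := tiltCos_eq_of_energy hn hx (hE s)
  have hU1 := tiltCos_le_one hx (σ s)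
  have hU2 := neg_one_le_tiltCos hx (σ s)
  have hEx : E / x s ^ (2 * n - 1) = -(-E / x s ^ (2 * n - 1)) := by ring
  have hq : 0 < -E / x s ^ (2 * n - 1) := by positivity
  have hxM : x s ≤ M := by
    rw [hM, le_div_iff₀ hH]
    have : -E / x s ^ (2 * n - 1) ≤ -E / m ^ (2 * n - 1) := by gcongr
    linarith
  have hQ := le_tiltNorm hm hm1 hmx (σ s)
  set U := tiltCos (x s) (σ s)
  have hUH : U ≤ H * x s := by linarith
  have hHx : 0 < H * x s := by positivity
  have hG : H * x s ≤ -curvatureFactor n H (x s) U := by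
    rw [curvatureFactor]
    have hprod : (n - 1) * U ≤ (n - 1) * (H * x s) := by gcongr
    rcases le_total U 0 with h0 | h0
    · have h1 : U ^ 3 ≤ 0 := Odd.pow_nonpos (by decide) h0
      have h2 : (n - 1) * U ≤ 0 := mul_nonpos_of_nonneg_of_nonpos hn1 h0
      have h3 : 0 ≤ (n - 1) * (H * x s) := by positivity
      linarith
    · have h1 : U ^ 3 ≤ U := by nlinarith [mul_nonneg h0 (sub_nonneg.2 hU1)]
      linarith
  have h1 : (m / M) ^ 3 * (H * m) ≤
      (tiltNorm (x s) (σ s) / x s) ^ 3 * -curvatureFactor n H (x s) U := by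
    have : H * m ≤ -curvatureFactor n H (x s) U := le_trans (by gcongr) hG
    have h0 := hm.trans_le hQ
    gcongr
  linarith

/-- Let `x` decrease on `[c, c']` from a maximum to a minimum, the tangent turning clockwise. The
derivative of `t + K V` is `cos σ (1 - K W / x)`. If `K` is chosen so that the second factor
vanishes where `cos σ` does, both factors change sign there, hence `t(c) < t(c')`. -/
theorem t_lt_t_of_half_turn (hn : 1 ≤ n) (hH : 0 < H) (h : IsSolution n H univ x t σ)
    (hE : ∀ s, energy n H (x s) (σ s) = E) (hE0 : E < 0) {c c₀ c' : ℝ} (hc₀ : c₀ ∈ Ioo c c')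
    (hc : Real.sin (σ c) = 0) (hc' : Real.sin (σ c') = 0) (hx : StrictAntiOn x (Icc c c'))
    (h1 : ∀ s ∈ Ioo c c₀, 0 < Real.cos (σ s)) (h2 : ∀ s ∈ Ioo c₀ c', Real.cos (σ s) < 0) :
    t c < t c' := by
  have hE1 : 0 < -E := by linarith
  have hn' := two_mul_sub_one_pos hn
  set w : ℝ → ℝ := fun y => (H + (2 * n - 1) * -E / y ^ (2 * n)) / y with hw
  have hwlt : ∀ a b : ℝ, 0 < a → a < b → w b < w a := fun a b ha hab => by
    simp only [hw]
    have hb := ha.trans hab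
    gcongr
  have hwpos : ∀ a : ℝ, 0 < a → 0 < w a := fun a ha => by
    simp only [hw]
    positivity
  have hV : ∀ s, HasDerivAt (fun s => tiltSin (x s) (σ s)) (-(Real.cos (σ s) * w (x s))) s :=
    fun s => (h.hasDerivAt_tiltSin trivial).congr_deriv (by
      rw [h.tiltSlope_eq hn hE s, hw]
      ring)
  have hx₀ := hwpos _ (h.pos c₀ trivial)
  set K := (w (x c₀))⁻¹ with hK
  have hKpos : 0 < K := inv_pos.2 hx₀
  have hK1 : K * w (x c₀) = 1 := inv_mul_cancel₀ hx₀.ne'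
  have hd : ∀ s, HasDerivAt (fun s => t s + K * tiltSin (x s) (σ s))
      (Real.cos (σ s) * (1 - K * w (x s))) s := fun s =>
    ((h.deriv_t s trivial).add ((hV s).const_mul K)).congr_deriv (by ring)
  have hcont : ∀ A : Set ℝ, ContinuousOn (fun s => t s + K * tiltSin (x s) (σ s)) A := fun A s _ =>
    (hd s).continuousAt.continuousWithinAt
  have hm1 : StrictMonoOn (fun s => t s + K * tiltSin (x s) (σ s)) (Icc c c₀) := by
    refine strictMonoOn_of_deriv_pos (convex_Icc _ _) (hcont _) fun s hs => ?_
    rw [interior_Icc] at hs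
    rw [(hd s).deriv]
    have h3 := hx (Icc_subset_Icc_right hc₀.2.le (Ioo_subset_Icc_self hs))
      (Ioo_subset_Icc_self hc₀) hs.2
    have h4 := mul_lt_mul_of_pos_left (hwlt _ _ (h.pos c₀ trivial) h3) hKpos
    exact mul_pos (h1 s hs) (by linarith)
  have hm2 : StrictMonoOn (fun s => t s + K * tiltSin (x s) (σ s)) (Icc c₀ c') := by
    refine strictMonoOn_of_deriv_pos (convex_Icc _ _) (hcont _) fun s hs => ?_
    rw [interior_Icc] at hs
    rw [(hd s).deriv]
    have h3 := hx (Ioo_subset_Icc_self hc₀)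
      (Icc_subset_Icc_left hc₀.1.le (Ioo_subset_Icc_self hs)) hs.1
    have h4 := mul_lt_mul_of_pos_left (hwlt _ _ (h.pos s trivial) h3) hKpos
    exact mul_pos_of_neg_of_neg (h2 s hs) (by linarith)
  have h3 := hm1 (left_mem_Icc.2 hc₀.1.le) (right_mem_Icc.2 hc₀.1.le) hc₀.1
  have h4 := hm2 (left_mem_Icc.2 hc₀.2.le) (right_mem_Icc.2 hc₀.2.le) hc₀.2
  simp only [(tiltSin_eq_zero_iff (h.pos c trivial) _).2 hc] at h3
  simp only [(tiltSin_eq_zero_iff (h.pos c' trivial) _).2 hc'] at h4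
  linarith

theorem isNodoidCurve_of_pos (hn : 1 ≤ n) (hH : 0 < H) (h : IsSolution n H univ x t σ)
    (hE : ∀ s, energy n H (x s) (σ s) = E) (hE0 : E < 0) :
    IsNodoidCurve univ x t σ ∧ HasSelfIntersection univ x t σ := by
  obtain ⟨δ, hδ, hσδ⟩ := h.exists_deriv_σ_le hn hH hE hE0
  have hσ : ∀ s, HasDerivAt σ _ s := fun s => h.deriv_σ' trivial
  have hanti : StrictAnti σ := strictAnti_of_deriv_neg fun s => by
    rw [(hσ s).deriv]; linarith [hσδ s]
  have hsurj : ∀ y, ∃ s, σ s = y := fun y => by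
    obtain ⟨s, hs⟩ := surjective_of_le_deriv (f := fun s => -σ s) hδ (fun s => (hσ s).fun_neg)
      (fun s => by linarith [hσδ s]) (-y)
    exact ⟨s, neg_injective hs⟩
  have hπ := Real.pi_pos
  obtain ⟨c, hc⟩ := hsurj 0
  obtain ⟨c₀, hc₀⟩ := hsurj (-(Real.pi / 2))
  obtain ⟨c', hc'⟩ := hsurj (-Real.pi)
  have hcc₀ : c < c₀ := hanti.lt_iff_gt.1 (by rw [hc, hc₀]; linarith)
  have hc₀c' : c₀ < c' := hanti.lt_iff_gt.1 (by rw [hc', hc₀]; linarith)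
  have hcc' := hcc₀.trans hc₀c'
  have hsc : Real.sin (σ c) = 0 := by rw [hc, Real.sin_zero]
  have hsc' : Real.sin (σ c') = 0 := by rw [hc', Real.sin_neg, Real.sin_pi, neg_zero]
  have hx : StrictAntiOn x (Icc c c') := by
    refine strictAntiOn_of_deriv_neg (convex_Icc _ _)
      (fun s _ => (h.deriv_x s trivial).continuousAt.continuousWithinAt) fun s hs => ?_
    rw [interior_Icc] at hs
    rw [(h.deriv_x s trivial).deriv]
    have h1 := hanti hs.1
    have h2 := hanti hs.2
    exact Real.sin_neg_of_neg_of_neg_pi_lt (by linarith) (by linarith)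
  have hcos1 : ∀ s ∈ Ioo c c₀, 0 < Real.cos (σ s) := fun s hs => by
    have h1 := hanti hs.1
    have h2 := hanti hs.2
    exact Real.cos_pos_of_mem_Ioo ⟨by linarith, by linarith⟩
  have hcos2 : ∀ s ∈ Ioo c₀ c', Real.cos (σ s) < 0 := fun s hs => by
    have h1 := hanti hs.1
    have h2 := hanti hs.2
    rw [← Real.cos_neg]
    exact Real.cos_neg_of_pi_div_two_lt_of_lt (by linarith) (by linarith)
  have ht := h.t_lt_t_of_half_turn hn hH hE hE0 ⟨hcc₀, hc₀c'⟩ hsc hsc' hx hcos1 hcos2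
  have hend : c + 2 * (c' - c) / 2 = c' := by ring
  refine ⟨⟨rfl, Or.inr fun s _ => ?_, 2 * (c' - c), 2 * (t c' - t c), c, by linarith,
    by linarith, fun s => ?_, fun s => ?_, by rwa [hend], ?_⟩, ?_⟩
  · rw [(hσ s).deriv]; linarith [hσδ s]
  · obtain ⟨h1, h2, h3⟩ := h.periodic hsc hsc' s
    refine ⟨h1, h2, ?_⟩
    rw [h3, hc, hc', add_sub_cancel_left, sub_zero, abs_mul, abs_neg, abs_of_pos hπ]
    norm_num
  · exact ⟨(h.symmetric hsc s).1, (h.symmetric hsc s).2.1⟩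
  · rw [hc, Real.cos_zero]; linarith
  · -- before `c₀` the curve crosses the line `t = t(c')`, and there it meets its reflection in it
    have ht' : t c' < t c₀ := h.strictAntiOn_t (subset_univ _) (convex_Icc c₀ c')
      (fun s hs => hcos2 s (by rwa [interior_Icc] at hs)) (left_mem_Icc.2 hc₀c'.le)
      (right_mem_Icc.2 hc₀c'.le) hc₀c'
    obtain ⟨s, hs, hst⟩ := intermediate_value_Ioo hcc₀.le h.continuous_t.continuousOn ⟨ht, ht'⟩
    obtain ⟨h1, h2, h3⟩ := h.symmetric hsc' s
    refine ⟨s, trivial, 2 * c' - s, trivial, h1.symm, by rw [h2, hst]; ring, ?_⟩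
    have h4 := hanti hs.1
    have h5 := hanti hs.2
    rw [h3, hc', show σ s - (2 * -Real.pi - σ s) = 2 * σ s + 2 * Real.pi by ring,
      Real.sin_add_two_pi]
    exact (Real.sin_neg_of_neg_of_neg_pi_lt (by linarith) (by linarith)).ne

theorem isNodoidCurve (hn : 1 ≤ n) (h : IsSolution n H univ x t σ)
    (hE : ∀ s, energy n H (x s) (σ s) = E) (hEH : E * H < 0) :
    IsNodoidCurve univ x t σ ∧ HasSelfIntersection univ x t σ := by
  rcases mul_neg_iff.1 hEH with ⟨hE0, hH⟩ | ⟨hE0, hH⟩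
  · obtain ⟨⟨-, hconv, L, d, c, hL, hd, hper, hsym, hx, hdir⟩, s₁, -, s₂, -, hx', ht', hσ'⟩ :=
      h.reflect.isNodoidCurve_of_pos (E := -E) hn (neg_pos.2 hH)
        (fun s => by rw [energy_pi_sub, hE]) (neg_neg_of_pos hE0)
    refine ⟨⟨rfl, ?_, L, -d, c, hL, neg_ne_zero.2 hd, fun s => ?_, fun s => ?_, hx, ?_⟩,
      s₁, trivial, s₂, trivial, hx', neg_injective ht', ?_⟩
    · have hder : ∀ s, deriv (fun s => Real.pi - σ s) s = -deriv σ s := fun s => deriv_const_sub _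
      simp only [IsLocallyConvexCurve, hder, neg_pos, neg_neg_iff_pos] at hconv
      exact hconv.symm
    · obtain ⟨h1, h2, h3⟩ := hper s
      refine ⟨h1, by linarith, ?_⟩
      rwa [sub_sub_sub_cancel_left, abs_sub_comm] at h3
    · obtain ⟨h1, h2⟩ := hsym s
      exact ⟨h1, by linarith⟩
    · rw [Real.cos_pi_sub] at hdir
      linarith
    · rw [sub_sub_sub_cancel_left, ← neg_sub, Real.sin_neg] at hσ'
      exact neg_ne_zero.1 hσ'
  · exact h.isNodoidCurve_of_pos hn hH hE hE0

end IsSolution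

/-- The differential of a defining function vanishes on the velocity of a curve in the set. -/
theorem IsDefiningFunction.fderiv_apply_eq_zero {n : ℕ} {S U : Set (Heis n)} {u : Heis n → ℝ}
    (hu : IsDefiningFunction S U u) {γ : ℝ → Heis n} {v : Heis n} {r : ℝ}
    (hγ : HasDerivAt γ v r) (hr : γ r ∈ U) (hS : ∀ᶠ s in 𝓝 r, γ s ∈ S) :
    fderiv ℝ u (γ r) v = 0 := by
  have hd := ((hu.contDiffOn.contDiffAt (hu.isOpen.mem_nhds hr)).differentiableAt
    two_ne_zero).hasFDerivAt.comp_hasDerivAt r hγ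
  have h0 : u ∘ γ =ᶠ[𝓝 r] fun _ => 0 := by
    filter_upwards [hS, hγ.continuousAt.eventually_mem (hu.isOpen.mem_nhds hr)] with s h1 h2
    exact (hu.inter_eq.subset ⟨h1, h2⟩).2
  exact (hd.congr_of_eventuallyEq h0.symm).unique (hasDerivAt_const r 0)

namespace IsSolution

variable {n : ℕ} {H : ℝ} {I : Set ℝ} {x t σ : ℝ → ℝ}

/-- At a transversal self-intersection of the generating curve the tangent hyperplanes of the two
branches span the whole tangent space. -/
theorem not_isEmbeddedHypersurface (hn : 1 ≤ n) (h : IsSolution n H I x t σ)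
    (hself : HasSelfIntersection I x t σ) :
    ¬ IsEmbeddedHypersurface (generatedHypersurface n I x t) := by
  obtain ⟨s₁, hs₁, s₂, hs₂, hx, ht, hσ⟩ := hself
  intro hemb
  set ω : EuclideanSpace ℂ (Fin n) := EuclideanSpace.single ⟨0, hn⟩ 1 with hω
  have hω1 : ‖ω‖ = 1 := by simp [hω]
  have hmem : ∀ s ∈ I, ∀ ξ : EuclideanSpace ℂ (Fin n), ‖ξ‖ = 1 →
      ((x s • ξ, t s) : Heis n) ∈ generatedHypersurface n I x t := fun s hs ξ hξ =>
    Or.inl ⟨(s, ξ), ⟨hs, by simpa using hξ⟩, rfl⟩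
  obtain ⟨U, u, hp, hu⟩ := hemb _ (hmem s₁ hs₁ ω hω1)
  set D := fderiv ℝ u ((x s₁ • ω, t s₁) : Heis n) with hD
  have hmer : ∀ s ∈ I, HasDerivAt (fun s => ((x s • ω, t s) : Heis n))
      (Real.sin (σ s) • ω, Real.cos (σ s)) s := fun s hs =>
    ((h.deriv_x s hs).smul_const ω).prodMk (h.deriv_t s hs)
  have hev : ∀ s ∈ I, ∀ᶠ r in 𝓝 s, ((x r • ω, t r) : Heis n) ∈ generatedHypersurface n I x t :=
    fun s hs => by
      filter_upwards [h.isOpen.mem_nhds hs] with r hr using hmem r hr ω hω1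
  have e1 : D (Real.sin (σ s₁) • ω, Real.cos (σ s₁)) = 0 :=
    hu.fderiv_apply_eq_zero (γ := fun s => (x s • ω, t s)) (hmer s₁ hs₁) hp (hev s₁ hs₁)
  have e2 : D (Real.sin (σ s₂) • ω, Real.cos (σ s₂)) = 0 := by
    have := hu.fderiv_apply_eq_zero (γ := fun s => (x s • ω, t s)) (hmer s₂ hs₂)
      (by simpa only [← hx, ← ht] using hp) (hev s₂ hs₂)
    simpa only [← hx, ← ht] using this
  have hsplit : ∀ a b : ℝ, D (a • ω, b) = a * D (ω, 0) + b * D (0, 1) := fun a b => by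
    have : ((a • ω, b) : Heis n) = a • ((ω, 0) : Heis n) + b • ((0, 1) : Heis n) := by
      ext <;> simp
    rw [this, map_add, map_smul, map_smul, smul_eq_mul, smul_eq_mul]
  rw [hsplit] at e1 e2
  rw [Real.sin_sub] at hσ
  have hD1 : D (ω, 0) = 0 := by
    refine (mul_eq_zero.1 ?_).resolve_left hσ
    linear_combination Real.cos (σ s₂) * e1 - Real.cos (σ s₁) * e2
  have hD2 : D (0, 1) = 0 := by
    refine (mul_eq_zero.1 ?_).resolve_left hσ
    linear_combination Real.sin (σ s₁) * e2 - Real.sin (σ s₂) * e1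
  have hunit : ∀ e : EuclideanSpace ℂ (Fin n), ‖e‖ = 1 → inner ℝ ω e = 0 → D (e, 0) = 0 := by
    intro e he hωe
    have hcirc : HasDerivAt (fun θ : ℝ => ((x s₁ • (Real.cos θ • ω + Real.sin θ • e), t s₁) : Heis n))
        (x s₁ • (-Real.sin 0 • ω + Real.cos 0 • e), 0) 0 :=
      ((((Real.hasDerivAt_cos 0).smul_const ω).add
        ((Real.hasDerivAt_sin 0).smul_const e)).const_smul (x s₁)).prodMk (hasDerivAt_const _ _)
    have hn1 : ∀ θ : ℝ, ‖Real.cos θ • ω + Real.sin θ • e‖ = 1 := fun θ => by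
      rw [← sq_eq_sq₀ (norm_nonneg _) zero_le_one, norm_add_sq_real, inner_smul_left,
        inner_smul_right, hωe, norm_smul, norm_smul, hω1, he]
      simp
    have h1 := hu.fderiv_apply_eq_zero
      (γ := fun θ => (x s₁ • (Real.cos θ • ω + Real.sin θ • e), t s₁)) hcirc (by simpa using hp)
      (Eventually.of_forall fun θ => hmem s₁ hs₁ _ (hn1 θ))
    simp only [Real.cos_zero, Real.sin_zero, one_smul, zero_smul, add_zero, neg_zero, zero_add]
      at h1
    have h2 : ((x s₁ • e, 0) : Heis n) = x s₁ • ((e, 0) : Heis n) := by ext <;> simp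
    rw [h2, map_smul, smul_eq_mul] at h1
    exact (mul_eq_zero.1 h1).resolve_left (h.pos s₁ hs₁).ne'
  have horth : ∀ e : EuclideanSpace ℂ (Fin n), inner ℝ ω e = 0 → D (e, 0) = 0 := by
    intro e hωe
    rcases eq_or_ne e 0 with rfl | he
    · exact map_zero D
    · have h1 := hunit (‖e‖⁻¹ • e) (by rw [norm_smul, norm_inv, norm_norm,
        inv_mul_cancel₀ (norm_ne_zero_iff.2 he)]) (by rw [inner_smul_right, hωe, mul_zero])
      have h2 : ((‖e‖⁻¹ • e, 0) : Heis n) = ‖e‖⁻¹ • ((e, 0) : Heis n) := by ext <;> simp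
      rw [h2, map_smul, smul_eq_mul] at h1
      exact (mul_eq_zero.1 h1).resolve_left (inv_ne_zero (norm_ne_zero_iff.2 he))
  refine hu.fderiv_ne_zero _ hp ?_
  ext v
  · have h1 : ((v, 0) : Heis n) = ((inner ℝ ω v • ω, 0) : Heis n)
        + ((v - inner ℝ ω v • ω, 0) : Heis n) := by ext <;> simp
    have h2 : D (v, 0) = 0 := by
      rw [h1, map_add, hsplit, hD1, horth _ ?_]
      · simp
      · rw [inner_sub_right, inner_smul_right, real_inner_self_eq_norm_sq, hω1]
        ring
    simpa using h2
  · simpa using hD2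

end IsSolution

/-! ### The classification -/

theorem mainTheorem1 (n : ℕ) (hn : 1 ≤ n) (H E : ℝ) (I : Set ℝ) (x t σ : ℝ → ℝ)
    (hγ : IsCompleteSolution n H I x t σ)
    (s₀ : ℝ) (hs₀ : s₀ ∈ I) (hE : energy n H (x s₀) (σ s₀) = E) :
    -- the energy is constant along the solution
    (∀ s ∈ I, energy n H (x s) (σ s) = E) ∧
    -- the generated hypersurface has constant mean curvature `H`, and its points on the
    -- `t`-axis, if any, are exactly the singular ones
    IsCMCImmersion (revolution n x t) (revolutionNormal n x σ) (revolutionDomain n I)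
      (revolutionTangent n) H ∧
    (∀ b ∈ revolutionDomain n I, (revolutionNormal n x σ b).1 ≠ 0) ∧
    (∀ τ : ℝ, ((0, τ) : Heis n) ∈ generatedHypersurface n I x t →
      IsSingularPoint (generatedHypersurface n I x t) (0, τ)) ∧
    -- hyperplanes
    (H = 0 → E = 0 → ∃ t₀ : ℝ,
      generatingCurve I x t = {q | 0 < q.1 ∧ q.2 = t₀} ∧
      generatedHypersurface n I x t = {p | p.2 = t₀}) ∧
    -- catenoids
    (H = 0 → E ≠ 0 →
      IsCatenoidCurve (generatingCurve I x t) ∧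
      InjOn (fun s => (x s, t s)) I ∧
      IsEmbeddedHypersurface (generatedHypersurface n I x t) ∧
      (2 ≤ n → ∃ a b : ℝ, ∀ p ∈ generatedHypersurface n I x t, a < p.2 ∧ p.2 < b)) ∧
    -- spheres
    (H ≠ 0 → E = 0 →
      IsCompact (generatedHypersurface n I x t) ∧
      InjOn (fun s => (x s, t s)) I ∧
      IsEmbeddedHypersurface (generatedHypersurface n I x t) ∧
      Nonempty (generatedHypersurface n I x t ≃ₜ
        Metric.sphere (0 : EuclideanSpace ℝ (Fin (2 * n + 1))) 1) ∧
      ∃ t₀ : ℝ, generatedHypersurface n I x t = Heis.mul (0, t₀) '' sphereS n |H|) ∧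
    -- cylinders and unduloids
    (0 < E * H →
      (∃ (f : ℝ → ℝ) (P : ℝ), 0 < P ∧ Function.Periodic f P ∧
        generatingCurve I x t = graphOver univ f) ∧
      InjOn (fun s => (x s, t s)) I ∧
      IsEmbeddedHypersurface (generatedHypersurface n I x t) ∧
      (generatedHypersurface n I x t = {p | ‖p.1‖ = (2 * n - 1) / (2 * n * |H|)} ∨
        IsUnduloidCurve (generatingCurve I x t))) ∧
    -- nodoids
    (E * H < 0 →
      IsNodoidCurve I x t σ ∧
      HasSelfIntersection I x t σ ∧
      ¬ IsEmbeddedHypersurface (generatedHypersurface n I x t)) := by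
  have hE : ∀ s ∈ I, energy n H (x s) (σ s) = E := fun s hs => (hγ.energy_eq hn hs₀ hs).trans hE
  have hinj : (∀ s ∈ I, Real.cos (σ s) ≠ 0) → InjOn (fun s => (x s, t s)) I :=
    fun hc r hr s hs hrs => hγ.injOn_t hc hr hs (congrArg Prod.snd hrs)
  refine ⟨hE, hγ.isCMCImmersion hn, fun b hb => hγ.revolutionNormal_fst_ne_zero hb,
    fun τ hτ => ?_, ?_, ?_, ?_, fun hEH => ?_, fun hEH => ?_⟩
  · rcases eq_or_ne E 0 with rfl | hE0
    · exact hγ.isSingularPoint_of_energy_zero hn hE hτ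
    · -- the curve stays away from the axis
      obtain ⟨m, hm, -, hmx⟩ := hγ.exists_le_of_energy_ne_zero hn hE hE0
      exact absurd rfl (fst_ne_zero_of_mem_generatedHypersurface hm hmx hτ)
  · rintro rfl rfl
    exact hγ.generatedHypersurface_of_energy_zero hn hE
  · rintro rfl hE0
    obtain ⟨m, hm, -, hmx⟩ := hγ.exists_le_of_energy_ne_zero hn hE hE0
    obtain ⟨hcat, hslab⟩ := hγ.catenoid hn hE hE0
    have hc : ∀ s ∈ I, Real.cos (σ s) ≠ 0 := fun s hs => by
      have hx := hγ.pos s hs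
      rw [cos_eq_tiltCos_mul hx, tiltCos_eq_of_energy hn hx (hE s hs), zero_mul, add_zero]
      exact mul_ne_zero (div_ne_zero hE0 (pow_pos hx _).ne') (tiltNorm_pos hx _).ne'
    refine ⟨hcat, hinj hc, hγ.isEmbeddedHypersurface hc hm hmx, fun hn2 => ?_⟩
    obtain ⟨a, b, hab⟩ := hslab hn2
    refine ⟨a, b, fun p hp => hab _ ((mem_generatedHypersurface_of_ne hγ.pos ?_).1 hp)⟩
    exact fst_ne_zero_of_mem_generatedHypersurface hm hmx hp
  · rintro hH rfl
    obtain ⟨t₀, hS⟩ := hγ.generatedHypersurface_eq_sphereS hn hH hE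
    obtain ⟨e⟩ := nonempty_homeomorph_sphereS n (abs_pos.2 hH) t₀
    refine ⟨?_, hinj (hγ.cos_ne_zero_of_energy_zero hn hH hE),
      hγ.isEmbeddedHypersurface_of_energy_zero hn hH hE, ?_, t₀, hS⟩
    · rw [hS, isCompact_iff_compactSpace]
      exact e.symm.compactSpace
    · rw [hS]
      exact ⟨e⟩
  · obtain ⟨m, hm, -, hmx⟩ := hγ.exists_le_of_energy_ne_zero hn hE (left_ne_zero_of_mul hEH.ne')
    obtain ⟨hc, hper, htype⟩ := hγ.cylinder_or_unduloid hn hE hEH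
    exact ⟨hper, hinj hc, hγ.isEmbeddedHypersurface hc hm hmx, htype⟩
  · obtain rfl := hγ.eq_univ_of_energy_ne_zero hn hE (left_ne_zero_of_mul hEH.ne)
    obtain ⟨hnod, hself⟩ := hγ.isNodoidCurve hn (fun s => hE s (mem_univ s)) hEH
    exact ⟨hnod, hself, hγ.not_isEmbeddedHypersurface hn hself⟩
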